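/- Model of computation. A randomized real RAM has a memory of natural numbers (for vertices, counters and addresses) and a memory of real numbers. In unit time it can perform one of the operations $+,-,\times$ on natural numbers (with truncated subtraction) or $+,-,\times,/$ on real numbers, compare two numbers, load a natural-number constant, convert a natural number to a real number, read or write a memory cell (whose address may be computed), probe one entry $J_{i,j}$ or $h_i$ of the input, or draw a fresh independent uniformly random vertex from $\{1,\dots,n\}$. A program is a fixed finite program with branches and while loops; it does not depend on the input or on the parameters, which it receives in its initial memory. For $n\ge 1$, a real symmetric matrix $J\in\mathbb R^{n\times n}$ and $h=(h_i)\in\mathbb R^n$, the Ising model with interactions $J$ and external field $h$ is the probability distribution on $\{\pm1\}^n$ $$\Pr[X=x]=\frac1Z\exp\Big\{\sum_{i,j}J_{i,j}x_ix_j+\sum_i h_ix_i\Big\},\qquad Z=\sum_{x\in\{\pm1\}^n}\exp\Big\{\sum_{i,j}J_{i,j}x_ix_j+\sum_i h_ix_i\Big\}.$$ Write $\|\vec J\|_1=\sum_{i,j}|J_{i,j}|$, $\|\vec J\|_\infty=\max_{i,j}|J_{i,j}|$, $\|h\|_1=\sum_i|h_i|$, $\|h\|_\infty=\max_i|h_i|$.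 For $h_0\in\mathbb R$ let $m_{h_0}=\mathbb E\big[\sum_i X_i\big]$ be the expected total magnetization of the Ising model with interactions $J$ and external field $(h_i+h_0)_i$. Theorem. There are a single program and a function $T:\mathbb R\times\mathbb R\to\mathbb R$ such that the following holds for all $\epsilon,\Delta>0$, all $n\ge1$, and all symmetric $J\in\mathbb R^{n\times n}$ and $h\in\mathbb R^n$ with $$\Delta\|\vec J\|_\infty\le\frac{\|\vec J\|_1}{n^2},\qquad \Delta\|h\|_\infty\le\frac{\|h\|_1}{n}.$$ There is a real number $h_0$ with $|h_0|<\epsilon$ such that for every $\delta\in(0,1)$ the program, given $n,\epsilon,\Delta,\delta$ and probe access to $J$ and $h$, always halts in time at most $T(\epsilon,\Delta)\,(1+\log(1/\delta))$, which does not depend on $n$, $J$ or $h$, and with probability at least $1-\delta$ over its random draws its output $y$ satisfies $$|y-m_{h_0}|\le\epsilon\,(n+\|\vec J\|_1).$$ In particular, for any fixed success probability the running time depends only on $\epsilon$ and $\Delta$. -/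

import Mathlib

/-! ### Ising models with external fields -/

namespace IsingModel

/-- The weight `exp (∑ i j, J i j x i x j + ∑ i, h i x i)` of a configuration `x ∈ {±1}ⁿ`.
The spins `1, -1` are the units of `ℤ`. -/
noncomputable def weight {n : ℕ} (J : Matrix (Fin n) (Fin n) ℝ) (h : Fin n → ℝ)
    (x : Fin n → ℤˣ) : ℝ :=
  Real.exp ((∑ i, ∑ j, J i j * ((x i : ℤ) : ℝ) * ((x j : ℤ) : ℝ)) +
    ∑ i, h i * ((x i : ℤ) : ℝ))

/-- The partition function `Z`. -/
noncomputable def partitionFunction {n : ℕ} (J : Matrix (Fin n) (Fin n) ℝ)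
    (h : Fin n → ℝ) : ℝ :=
  ∑ x : Fin n → ℤˣ, weight J h x

/-- The probability `Pr[X = x]` in the Ising model. -/
noncomputable def prob {n : ℕ} (J : Matrix (Fin n) (Fin n) ℝ) (h : Fin n → ℝ)
    (x : Fin n → ℤˣ) : ℝ :=
  weight J h x / partitionFunction J h

/-- The expected total magnetization `E[∑ i, X i]`. -/
noncomputable def magnetization {n : ℕ} (J : Matrix (Fin n) (Fin n) ℝ)
    (h : Fin n → ℝ) : ℝ :=
  ∑ x : Fin n → ℤˣ, prob J h x * ∑ i, ((x i : ℤ) : ℝ)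

/-- The entrywise `L¹` norm of a matrix. -/
def matrixNormOne {n : ℕ} (J : Matrix (Fin n) (Fin n) ℝ) : ℝ := ∑ i, ∑ j, |J i j|

/-- The entrywise `L^∞` norm of a matrix (the norm of a function on a finite type is its
maximum). -/
noncomputable def matrixNormInf {n : ℕ} (J : Matrix (Fin n) (Fin n) ℝ) : ℝ :=
  ‖fun p : Fin n × Fin n => J p.1 p.2‖

/-- `Δ`-density of the interaction matrix. -/
def DenseMatrix {n : ℕ} (Δ : ℝ) (J : Matrix (Fin n) (Fin n) ℝ) : Prop :=
  Δ * matrixNormInf J ≤ matrixNormOne J / (n : ℝ) ^ 2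

/-- `Δ`-density of the external field; `‖h‖` is the maximum norm. -/
def DenseField {n : ℕ} (Δ : ℝ) (h : Fin n → ℝ) : Prop :=
  Δ * ‖h‖ ≤ (∑ i, |h i|) / (n : ℝ)

end IsingModel

/-! ### A randomized real RAM that probes an Ising model

The machine has a memory of natural numbers (for vertices, counters and addresses) and a memory
of real numbers. Each arithmetic operation, comparison, memory access, probe of an entry of `J` or
`h`, and draw of a uniformly random vertex takes one unit of time. There are no real constants
and no rounding of reals to integers, and a program does not depend on its input. -/

namespace RealRAM

/-- Expressions for natural numbers; `load a` reads the natural-number memory at address `a`. -/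
inductive NatExp : Type
  | lit (k : ℕ) : NatExp
  | load (a : NatExp) : NatExp
  | add (a b : NatExp) : NatExp
  | sub (a b : NatExp) : NatExp
  | mul (a b : NatExp) : NatExp

/-- Expressions for real numbers; `load a` reads the real memory at address `a`, `probeJ i j`
and `probeH i` read an entry of the input. -/
inductive RealExp : Type
  | ofNat (a : NatExp) : RealExp
  | load (a : NatExp) : RealExp
  | probeJ (i j : NatExp) : RealExp
  | probeH (i : NatExp) : RealExp
  | add (a b : RealExp) : RealExp
  | sub (a b : RealExp) : RealExp
  | mul (a b : RealExp) : RealExp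
  | div (a b : RealExp) : RealExp

/-- Tests for branches and loops. -/
inductive Test : Type
  | natLE (a b : NatExp) : Test
  | realLE (a b : RealExp) : Test
  | not (b : Test) : Test

/-- Programs. `setNat a e` and `setReal a e` write the value of `e` at address `a`, and
`sample a` writes a fresh uniformly random vertex at address `a` of the natural-number memory. -/
inductive Prog : Type
  | skip : Prog
  | setNat (a e : NatExp) : Prog
  | setReal (a : NatExp) (e : RealExp) : Prog
  | sample (a : NatExp) : Prog
  | seq (p q : Prog) : Prog
  | ite (b : Test) (p q : Prog) : Prog
  | while (b : Test) (p : Prog) : Prog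

/-- A state of the machine: both memories and the number of random vertices drawn so far. -/
structure State : Type where
  nat : ℕ → ℕ
  real : ℕ → ℝ
  drawn : ℕ

/-- The entry `J i j`, and `0` if an index is out of range. -/
def entryJ {n : ℕ} (J : Matrix (Fin n) (Fin n) ℝ) (i j : ℕ) : ℝ :=
  if hij : i < n ∧ j < n then J ⟨i, hij.1⟩ ⟨j, hij.2⟩ else 0

/-- The entry `h i`, and `0` if the index is out of range. -/
def entryH {n : ℕ} (h : Fin n → ℝ) (i : ℕ) : ℝ :=
  if hi : i < n then h ⟨i, hi⟩ else 0

def NatExp.eval (s : State) : NatExp → ℕ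
  | .lit k => k
  | .load a => s.nat (a.eval s)
  | .add a b => a.eval s + b.eval s
  | .sub a b => a.eval s - b.eval s
  | .mul a b => a.eval s * b.eval s

noncomputable def RealExp.eval {n : ℕ} (J : Matrix (Fin n) (Fin n) ℝ) (h : Fin n → ℝ)
    (s : State) : RealExp → ℝ
  | .ofNat a => (a.eval s : ℝ)
  | .load a => s.real (a.eval s)
  | .probeJ i j => entryJ J (i.eval s) (j.eval s)
  | .probeH i => entryH h (i.eval s)
  | .add a b => a.eval J h s + b.eval J h s
  | .sub a b => a.eval J h s - b.eval J h s
  | .mul a b => a.eval J h s * b.eval J h s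
  | .div a b => a.eval J h s / b.eval J h s

def Test.holds {n : ℕ} (J : Matrix (Fin n) (Fin n) ℝ) (h : Fin n → ℝ) (s : State) :
    Test → Prop
  | .natLE a b => a.eval s ≤ b.eval s
  | .realLE a b => a.eval J h s ≤ b.eval J h s
  | .not b => ¬ b.holds J h s

/-- The time needed to evaluate an expression: the number of its operations. -/
def NatExp.time : NatExp → ℕ
  | .lit _ => 1
  | .load a => a.time + 1
  | .add a b => a.time + b.time + 1
  | .sub a b => a.time + b.time + 1
  | .mul a b => a.time + b.time + 1

def RealExp.time : RealExp → ℕ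
  | .ofNat a => a.time + 1
  | .load a => a.time + 1
  | .probeJ i j => i.time + j.time + 1
  | .probeH i => i.time + 1
  | .add a b => a.time + b.time + 1
  | .sub a b => a.time + b.time + 1
  | .mul a b => a.time + b.time + 1
  | .div a b => a.time + b.time + 1

def Test.time : Test → ℕ
  | .natLE a b => a.time + b.time + 1
  | .realLE a b => a.time + b.time + 1
  | .not b => b.time + 1

/-- `Exec J h ω p s t s'`: on the input `J, h`, and with `ω 0, ω 1, …` as the random vertices, the
program `p` started in the state `s` halts in the state `s'` after exactly `t` units of time. -/
inductive Exec {n : ℕ} (J : Matrix (Fin n) (Fin n) ℝ) (h : Fin n → ℝ) (ω : ℕ → Fin n) :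
    Prog → State → ℕ → State → Prop
  | skip (s : State) : Exec J h ω .skip s 1 s
  | setNat (a e : NatExp) (s : State) :
      Exec J h ω (.setNat a e) s (a.time + e.time + 1)
        ⟨Function.update s.nat (a.eval s) (e.eval s), s.real, s.drawn⟩
  | setReal (a : NatExp) (e : RealExp) (s : State) :
      Exec J h ω (.setReal a e) s (a.time + e.time + 1)
        ⟨s.nat, Function.update s.real (a.eval s) (e.eval J h s), s.drawn⟩
  | sample (a : NatExp) (s : State) :
      Exec J h ω (.sample a) s (a.time + 1)
        ⟨Function.update s.nat (a.eval s) (ω s.drawn : ℕ), s.real, s.drawn + 1⟩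
  | seq {p q : Prog} {s s₁ s₂ : State} {t₁ t₂ : ℕ} :
      Exec J h ω p s t₁ s₁ → Exec J h ω q s₁ t₂ s₂ →
        Exec J h ω (.seq p q) s (t₁ + t₂) s₂
  | ite_true {b : Test} {p q : Prog} {s s' : State} {t : ℕ} :
      b.holds J h s → Exec J h ω p s t s' →
        Exec J h ω (.ite b p q) s (b.time + t) s'
  | ite_false {b : Test} {p q : Prog} {s s' : State} {t : ℕ} :
      ¬ b.holds J h s → Exec J h ω q s t s' →
        Exec J h ω (.ite b p q) s (b.time + t) s'
  | while_false {b : Test} {p : Prog} {s : State} :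
      ¬ b.holds J h s → Exec J h ω (.while b p) s b.time s
  | while_true {b : Test} {p : Prog} {s s₁ s₂ : State} {t₁ t₂ : ℕ} :
      b.holds J h s → Exec J h ω p s t₁ s₁ → Exec J h ω (.while b p) s₁ t₂ s₂ →
        Exec J h ω (.while b p) s (b.time + t₁ + t₂) s₂

/-- A run is determined by the input and the random vertices. -/
theorem Exec.unique {n : ℕ} {J : Matrix (Fin n) (Fin n) ℝ} {h : Fin n → ℝ} {ω : ℕ → Fin n}
    {p : Prog} {s s₁ s₂ : State} {t₁ t₂ : ℕ}
    (h₁ : Exec J h ω p s t₁ s₁) (h₂ : Exec J h ω p s t₂ s₂) : t₁ = t₂ ∧ s₁ = s₂ := by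
  induction h₁ generalizing t₂ s₂ with
  | skip => cases h₂; exact ⟨rfl, rfl⟩
  | setNat => cases h₂; exact ⟨rfl, rfl⟩
  | setReal => cases h₂; exact ⟨rfl, rfl⟩
  | sample => cases h₂; exact ⟨rfl, rfl⟩
  | seq _ _ ih₁ ih₂ =>
    cases h₂ with
    | seq a b =>
      obtain ⟨rfl, rfl⟩ := ih₁ a
      obtain ⟨rfl, rfl⟩ := ih₂ b
      exact ⟨rfl, rfl⟩
  | ite_true hb _ ih =>
    cases h₂ with
    | ite_true _ a => obtain ⟨rfl, rfl⟩ := ih a; exact ⟨rfl, rfl⟩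
    | ite_false hb' _ => exact absurd hb hb'
  | ite_false hb _ ih =>
    cases h₂ with
    | ite_true hb' _ => exact absurd hb' hb
    | ite_false _ a => obtain ⟨rfl, rfl⟩ := ih a; exact ⟨rfl, rfl⟩
  | while_false hb =>
    cases h₂ with
    | while_false _ => exact ⟨rfl, rfl⟩
    | while_true hb' _ _ => exact absurd hb' hb
  | while_true hb _ _ ih₁ ih₂ =>
    cases h₂ with
    | while_false hb' => exact absurd hb hb'
    | while_true _ a b =>
      obtain ⟨rfl, rfl⟩ := ih₁ a
      obtain ⟨rfl, rfl⟩ := ih₂ b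
      exact ⟨rfl, rfl⟩

/-- The initial state: `n` is in cell `0` of the natural-number memory, and `ε, Δ, δ` are in
cells `0, 1, 2` of the real memory; all other cells hold `0`. -/
noncomputable def init (n : ℕ) (ε Δ δ : ℝ) : State where
  nat := fun k => if k = 0 then n else 0
  real := fun k => if k = 0 then ε else if k = 1 then Δ else if k = 2 then δ else 0
  drawn := 0

/-- The program halts in time at most `B`. -/
def HaltsWithin {n : ℕ} (J : Matrix (Fin n) (Fin n) ℝ) (h : Fin n → ℝ) (ω : ℕ → Fin n)
    (p : Prog) (s : State) (B : ℝ) : Prop :=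
  ∃ (t : ℕ) (s' : State), Exec J h ω p s t s' ∧ (t : ℝ) ≤ B

/-- The program halts with the number `y` in cell `0` of the real memory. -/
def Outputs {n : ℕ} (J : Matrix (Fin n) (Fin n) ℝ) (h : Fin n → ℝ) (ω : ℕ → Fin n)
    (p : Prog) (s : State) (y : ℝ) : Prop :=
  ∃ (t : ℕ) (s' : State), Exec J h ω p s t s' ∧ s'.real 0 = y

/-- The law of a sequence of independent uniformly random vertices. -/
noncomputable def vertexLaw (n : ℕ) [NeZero n] : MeasureTheory.Measure (ℕ → Fin n) :=
  MeasureTheory.Measure.infinitePi fun _ : ℕ => (PMF.uniformOfFintype (Fin n)).toMeasure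

end RealRAM

namespace IsingSampling

open Finset
open scoped BigOperators

/-! ### Averages over tuples of random vertices -/

section Averages

variable {ι κ : Type*} [Fintype ι] [Fintype κ]

theorem abs_expect_sub_le {f g : ι → ℝ} : |𝔼 i, f i - 𝔼 i, g i| ≤ 𝔼 i, |f i - g i| := by
  rw [← expect_sub_distrib]
  exact abs_expect_le _ _

theorem expect_le_of_forall_le [Nonempty ι] {f : ι → ℝ} {a : ℝ} (h : ∀ i, f i ≤ a) :
    𝔼 i, f i ≤ a :=
  expect_le univ_nonempty fun i _ => h i

theorem le_expect_of_forall_le [Nonempty ι] {f : ι → ℝ} {a : ℝ} (h : ∀ i, a ≤ f i) :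
    a ≤ 𝔼 i, f i :=
  le_expect univ_nonempty fun i _ => h i

theorem expect_mono' {f g : ι → ℝ} (h : ∀ i, f i ≤ g i) : 𝔼 i, f i ≤ 𝔼 i, g i :=
  expect_le_expect fun i _ => h i

theorem abs_expect_le_of_forall [Nonempty ι] {f : ι → ℝ} {C : ℝ} (h : ∀ i, |f i| ≤ C) :
    |𝔼 i, f i| ≤ C :=
  (abs_expect_le _ _).trans (expect_le_of_forall_le h)

theorem expect_prod_type (f : ι × κ → ℝ) : 𝔼 p, f p = 𝔼 i, 𝔼 j, f (i, j) := by
  rw [← univ_product_univ, expect_product]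

theorem expect_fin_cons {s : ℕ} (f : (Fin (s + 1) → ι) → ℝ) :
    𝔼 t, f t = 𝔼 a, 𝔼 t : Fin s → ι, f (Fin.cons a t) := by
  rw [← expect_prod_type (fun p : ι × (Fin s → ι) => f (Fin.cons p.1 p.2))]
  exact (Fintype.expect_equiv (Fin.consEquiv fun _ => ι) _ _ fun _ => rfl).symm

/-- The average over all tuples of a function of the last entry and of the other entries. -/
theorem expect_fin_snoc {s : ℕ} (f : (Fin (s + 1) → ι) → ℝ) :
    𝔼 t, f t = 𝔼 t : Fin s → ι, 𝔼 a, f (Fin.snoc t a) := by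
  rw [expect_comm, ← expect_prod_type (fun p : ι × (Fin s → ι) => f (Fin.snoc p.2 p.1))]
  exact (Fintype.expect_equiv (Fin.snocEquiv fun _ => ι) _ _ fun _ => rfl).symm

theorem expect_sum_sq_of_expect_eq_zero [Nonempty ι] {g : ι → ℝ} (hg : 𝔼 i, g i = 0) (s : ℕ) :
    (𝔼 t : Fin s → ι, ∑ k, g (t k)) = 0 ∧
      𝔼 t : Fin s → ι, (∑ k, g (t k)) ^ 2 = s * 𝔼 i, g i ^ 2 := by
  induction s with
  | zero => simp
  | succ s ih =>
    constructor
    · rw [expect_fin_cons]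
      simp only [Fin.sum_univ_succ, Fin.cons_zero, Fin.cons_succ, expect_add_distrib, ih.1,
        Fintype.expect_const, hg, add_zero]
    · rw [expect_fin_cons]
      have : ∀ a : ι, 𝔼 t : Fin s → ι, (∑ k, g ((Fin.cons a t : Fin (s + 1) → ι) k)) ^ 2 =
          g a ^ 2 + s * 𝔼 i, g i ^ 2 := by
        intro a
        simp only [Fin.sum_univ_succ, Fin.cons_zero, Fin.cons_succ, add_sq, expect_add_distrib,
          Fintype.expect_const, ih.2, ← mul_expect, ih.1, mul_zero, add_zero]
      simp only [this, expect_add_distrib, Fintype.expect_const]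
      push_cast
      ring

theorem expect_abs_le_of_expect_sq_le [Nonempty ι] {X : ι → ℝ} {c : ℝ} (hc : 0 < c)
    (h : 𝔼 i, X i ^ 2 ≤ c ^ 2) : 𝔼 i, |X i| ≤ c := by
  have h1 : ∀ i, |X i| ≤ X i ^ 2 / (2 * c) + c / 2 := by
    intro i
    have := sq_nonneg (|X i| - c)
    rw [← sq_abs (X i)]
    field_simp
    nlinarith
  calc 𝔼 i, |X i| ≤ 𝔼 i, (X i ^ 2 / (2 * c) + c / 2) := expect_mono' h1
    _ = (𝔼 i, X i ^ 2) / (2 * c) + c / 2 := by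
      rw [expect_add_distrib, ← expect_div, Fintype.expect_const]
    _ ≤ c ^ 2 / (2 * c) + c / 2 := by gcongr
    _ = c := by field_simp; ring

/-- The weak law of large numbers in mean. -/
theorem expect_abs_mean_sub_le [Nonempty ι] {f : ι → ℝ} {C : ℝ} (hf : ∀ i, |f i| ≤ C)
    {s : ℕ} (hs : 0 < s) :
    𝔼 t : Fin s → ι, |𝔼 k, f (t k) - 𝔼 i, f i| ≤ C / √s := by
  have : Nonempty (Fin s) := ⟨⟨0, hs⟩⟩
  have hs' : (0 : ℝ) < s := by exact_mod_cast hs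
  have hC : 0 ≤ C := (abs_nonneg _).trans (hf (Classical.arbitrary ι))
  rcases hC.eq_or_lt with rfl | hC
  · have : ∀ i, f i = 0 := fun i => abs_nonpos_iff.1 (hf i)
    simp [this]
  set g : ι → ℝ := fun i => f i - 𝔼 j, f j with hg
  have hg0 : 𝔼 i, g i = 0 := by
    simp [hg, expect_sub_distrib]
  have hg2 : 𝔼 i, g i ^ 2 ≤ C ^ 2 := by
    have h1 : 𝔼 i, g i ^ 2 = 𝔼 i, f i ^ 2 - (𝔼 i, f i) ^ 2 := by
      simp only [hg, sub_sq, expect_add_distrib, expect_sub_distrib, Fintype.expect_const,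
        ← expect_mul, ← mul_expect]
      ring
    have h2 : 𝔼 i, f i ^ 2 ≤ C ^ 2 :=
      expect_le_of_forall_le fun i => sq_le_sq' (abs_le.1 (hf i)).1 (abs_le.1 (hf i)).2
    nlinarith [sq_nonneg (𝔼 i, f i)]
  have key : ∀ t : Fin s → ι, 𝔼 k, f (t k) - 𝔼 i, f i = (∑ k, g (t k)) / s := by
    intro t
    simp only [hg, sum_sub_distrib, Fintype.expect_eq_sum_div_card (fun k => f (t k)),
      Fintype.card_fin, sum_const, card_univ, nsmul_eq_mul]
    field_simp
  refine expect_abs_le_of_expect_sq_le (by positivity) ?_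
  simp only [key, div_pow, ← expect_div, (expect_sum_sq_of_expect_eq_zero hg0 s).2]
  rw [Real.sq_sqrt hs'.le]
  calc s * (𝔼 i, g i ^ 2) / (s : ℝ) ^ 2 = (𝔼 i, g i ^ 2) / s := by field_simp
    _ ≤ C ^ 2 / s := by gcongr

/-- Resampling the entries outside of a set `B` does not change an average. -/
theorem expect_eq_expect_merge {q : ℕ} [Nonempty ι] (B : Finset (Fin q))
    (F : (Fin q → ι) → ℝ) :
    𝔼 S, F S = 𝔼 S : Fin q → ι, 𝔼 S' : Fin q → ι, F (fun a => if a ∈ B then S a else S' a) := by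
  have h1 : 𝔼 S, F S = 𝔼 p : (Fin q → ι) × (Fin q → ι), F p.1 := by
    rw [expect_prod_type]; simp
  rw [h1, ← expect_prod_type
    (fun p : (Fin q → ι) × (Fin q → ι) => F (fun a => if a ∈ B then p.1 a else p.2 a))]
  set φ : (Fin q → ι) × (Fin q → ι) → (Fin q → ι) × (Fin q → ι) := fun p =>
    (fun a => if a ∈ B then p.1 a else p.2 a, fun a => if a ∈ B then p.2 a else p.1 a) with hφ
  have hinv : Function.Involutive φ := by
    rintro ⟨S, S'⟩
    simp only [hφ, Prod.mk.injEq]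
    constructor <;> funext a <;> by_cases h : a ∈ B <;> simp [h]
  exact (Fintype.expect_equiv hinv.toPerm _ _ fun _ => rfl).symm

/-- `F S` depends only on the entries of the tuple `S` in `B`. -/
def DependsOnEntries {q : ℕ} {β : Type*} (B : Finset (Fin q)) (F : (Fin q → ι) → β) : Prop :=
  ∀ S S' : Fin q → ι, (∀ a ∈ B, S a = S' a) → F S = F S'

/-- The law of large numbers for a function that may depend on a few of the samples. -/
theorem expect_abs_mean_sub_le_of_dependsOn [Nonempty ι] {q : ℕ} (hq : 0 < q)
    {B : Finset (Fin q)} {f : (Fin q → ι) → ι → ℝ} (hB : DependsOnEntries B f)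
    {C : ℝ} (hf : ∀ S i, |f S i| ≤ C) :
    𝔼 S, |𝔼 a, f S (S a) - 𝔼 i, f S i| ≤ C / √q + 2 * C * #B / q := by
  have hq' : (0 : ℝ) < q := by exact_mod_cast hq
  have : Nonempty (Fin q) := ⟨⟨0, hq⟩⟩
  rw [expect_eq_expect_merge B]
  refine expect_le_of_forall_le fun S => ?_
  have hm : ∀ S' : Fin q → ι, f (fun a => if a ∈ B then S a else S' a) = f S := fun S' =>
    hB _ _ fun a ha => by simp [ha]
  simp only [hm]
  have h1 : ∀ S' : Fin q → ι,
      |𝔼 a, f S (if a ∈ B then S a else S' a) - 𝔼 i, f S i| ≤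
        |𝔼 a, f S (S' a) - 𝔼 i, f S i| + 2 * C * #B / q := by
    intro S'
    have h2 : |𝔼 a, f S (if a ∈ B then S a else S' a) - 𝔼 a, f S (S' a)| ≤ 2 * C * #B / q := by
      refine abs_expect_sub_le.trans ?_
      rw [Fintype.expect_eq_sum_div_card, Fintype.card_fin]
      gcongr
      calc ∑ a, |f S (if a ∈ B then S a else S' a) - f S (S' a)|
          ≤ ∑ a, if a ∈ B then 2 * C else 0 := by
            refine sum_le_sum fun a _ => ?_
            split_ifs with h
            · have := abs_le.1 (hf S (S a))
              have := abs_le.1 (hf S (S' a))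
              rw [abs_le]; constructor <;> linarith
            · simp
        _ = 2 * C * #B := by
            rw [← sum_filter]; simp [mul_comm]
    calc _ = |(𝔼 a, f S (S' a) - 𝔼 i, f S i) +
          (𝔼 a, f S (if a ∈ B then S a else S' a) - 𝔼 a, f S (S' a))| := by ring_nf
      _ ≤ _ := (abs_add_le _ _).trans (by linarith)
  calc _ ≤ 𝔼 S' : Fin q → ι, (|𝔼 a, f S (S' a) - 𝔼 i, f S i| + 2 * C * #B / q) :=
        expect_mono' h1
    _ = (𝔼 S' : Fin q → ι, |𝔼 a, f S (S' a) - 𝔼 i, f S i|) + 2 * C * #B / q := by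
        rw [expect_add_distrib, Fintype.expect_const]
    _ ≤ _ := by
        gcongr
        exact expect_abs_mean_sub_le (hf S) hq

/-- The law of large numbers for a function of pairs that may depend on a few of the samples. -/
theorem expect_abs_mean_pair_sub_le_of_dependsOn [Nonempty ι] {q : ℕ} (hq : 0 < q)
    {B : Finset (Fin q)} {k : (Fin q → ι) → ι → ι → ℝ} (hB : DependsOnEntries B k)
    {C : ℝ} (hk : ∀ S i j, |k S i j| ≤ C) :
    𝔼 S, |𝔼 a, 𝔼 b, k S (S a) (S b) - 𝔼 i, 𝔼 j, k S i j| ≤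
      2 * C / √q + 2 * C * (2 * #B + 1) / q := by
  have hq' : (0 : ℝ) < q := by exact_mod_cast hq
  have : Nonempty (Fin q) := ⟨⟨0, hq⟩⟩
  have hC : 0 ≤ C := (abs_nonneg _).trans
    (hk (fun _ => Classical.arbitrary ι) (Classical.arbitrary ι) (Classical.arbitrary ι))
  have h1 : ∀ a : Fin q, 𝔼 S, |𝔼 b, k S (S a) (S b) - 𝔼 j, k S (S a) j| ≤
      C / √q + 2 * C * (#B + 1) / q := by
    intro a
    have := expect_abs_mean_sub_le_of_dependsOn (ι := ι) hq (B := insert a B)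
      (f := fun S j => k S (S a) j) (by
        intro S S' h
        simp only
        rw [hB S S' fun b hb => h b (mem_insert_of_mem hb), h a (mem_insert_self _ _)])
      (fun S j => hk S (S a) j)
    refine this.trans ?_
    gcongr
    exact_mod_cast card_insert_le a B
  have h2 := expect_abs_mean_sub_le_of_dependsOn (ι := ι) hq (B := B)
    (f := fun S i => 𝔼 j, k S i j)
    (by intro S S' h; simp only; rw [hB S S' h])
    (fun S i => abs_expect_le_of_forall (hk S i))
  have h3 : ∀ S : Fin q → ι, |𝔼 a, 𝔼 b, k S (S a) (S b) - 𝔼 i, 𝔼 j, k S i j| ≤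
      𝔼 a, |𝔼 b, k S (S a) (S b) - 𝔼 j, k S (S a) j| +
        |𝔼 a, 𝔼 j, k S (S a) j - 𝔼 i, 𝔼 j, k S i j| := by
    intro S
    refine (abs_sub_le _ (𝔼 a, 𝔼 j, k S (S a) j) _).trans ?_
    gcongr
    exact abs_expect_sub_le
  refine (expect_mono' h3).trans ?_
  rw [expect_add_distrib, expect_comm]
  refine (add_le_add (expect_le_of_forall_le h1) h2).trans (le_of_eq ?_)
  field_simp
  ring

end Averages

/-! ### Two-point distributions -/

section TwoPoint

/-- The spin `±1` as a real number. -/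
abbrev spin (e : ℤˣ) : ℝ := ((e : ℤ) : ℝ)

theorem spin_cases (e : ℤˣ) : spin e = 1 ∨ spin e = -1 := by
  rcases Int.units_eq_one_or e with rfl | rfl <;> simp [spin]

theorem spin_mul_self (e : ℤˣ) : spin e * spin e = 1 := by
  rcases spin_cases e with h | h <;> rw [h] <;> norm_num

theorem abs_spin (e : ℤˣ) : |spin e| = 1 := by
  rcases spin_cases e with h | h <;> rw [h] <;> norm_num

theorem sum_units (f : ℤˣ → ℝ) : ∑ e, f e = f 1 + f (-1) := by
  have : (univ : Finset ℤˣ) = {1, -1} := by decide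
  rw [this, sum_pair (by decide)]

/-- Every function of a spin is affine. -/
theorem eq_affine_spin (f : ℤˣ → ℝ) (e : ℤˣ) :
    f e = (f 1 + f (-1)) / 2 + spin e * ((f 1 - f (-1)) / 2) := by
  rcases Int.units_eq_one_or e with rfl | rfl <;> simp [spin] <;> ring

/-- The probability of the spin `e` when the mean is `μ`. -/
noncomputable def spinProb (μ : ℝ) (e : ℤˣ) : ℝ := (1 + μ * spin e) / 2

/-- The entropy of a spin with mean `μ`. -/
noncomputable def ent (μ : ℝ) : ℝ := Real.binEntropy ((1 + μ) / 2)

theorem ent_eq (μ : ℝ) : ent μ = -((Real.log (spinProb μ 1) + Real.log (spinProb μ (-1))) / 2 +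
    μ * ((Real.log (spinProb μ 1) - Real.log (spinProb μ (-1))) / 2)) := by
  have h : 1 - (1 + μ) / 2 = (1 - μ) / 2 := by ring
  simp only [ent, Real.binEntropy, spinProb, spin, Real.log_inv, h]
  simp only [Units.val_one, Int.cast_one, mul_one, Units.val_neg, Int.cast_neg, mul_neg,
    ← sub_eq_add_neg]
  ring

theorem continuous_ent : Continuous ent := by
  unfold ent
  fun_prop

theorem abs_ent_le {μ : ℝ} (h : |μ| ≤ 1) : |ent μ| ≤ 1 := by
  rw [abs_le] at h
  have h1 : 0 ≤ ent μ := Real.binEntropy_nonneg (by linarith) (by linarith)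
  have h2 : ent μ ≤ Real.log 2 := Real.binEntropy_le_log_two
  rw [abs_of_nonneg h1]
  linarith [Real.log_two_lt_d9]

theorem spinProb_nonneg {μ : ℝ} (h : |μ| ≤ 1) (e : ℤˣ) : 0 ≤ spinProb μ e := by
  rw [abs_le] at h
  unfold spinProb
  rcases spin_cases e with he | he <;> rw [he] <;> linarith

theorem mul_log_sub_log_le {p r : ℝ} (hp : 0 ≤ p) (hr : 0 < r) :
    p * (Real.log r - Real.log p) ≤ r - p := by
  rcases hp.eq_or_lt with rfl | hp
  · simpa using hr.le
  · rw [← Real.log_div hr.ne' hp.ne']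
    have := Real.log_le_sub_one_of_pos (div_pos hr hp)
    calc p * Real.log (r / p) ≤ p * (r / p - 1) := by gcongr
      _ = r - p := by field_simp

theorem mul_log_sub_log_lt {p r : ℝ} (hp : 0 ≤ p) (hr : 0 < r) (hne : p ≠ r) :
    p * (Real.log r - Real.log p) < r - p := by
  rcases hp.eq_or_lt with rfl | hp
  · simpa using hr
  · rw [← Real.log_div hr.ne' hp.ne']
    have hne' : r / p ≠ 1 := by
      rw [Ne, div_eq_one_iff_eq hp.ne']; exact hne.symm
    have := Real.log_lt_sub_one_of_pos (div_pos hr hp) hne'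
    calc p * Real.log (r / p) < p * (r / p - 1) := by gcongr
      _ = r - p := by field_simp

theorem log_spinProb_tanh (f : ℝ) (e : ℤˣ) :
    Real.log (spinProb (Real.tanh f) e) = f * spin e - Real.log (2 * Real.cosh f) := by
  have hc := Real.cosh_pos f
  have : spinProb (Real.tanh f) e = Real.exp (f * spin e) / (2 * Real.cosh f) := by
    unfold spinProb
    rw [Real.tanh_eq_sinh_div_cosh]
    rcases spin_cases e with h | h <;> rw [h]
    · rw [mul_one, mul_one, ← Real.cosh_add_sinh]; field_simp
    · rw [mul_neg_one, mul_neg_one, ← Real.cosh_sub_sinh]; field_simp; ring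
  rw [this, Real.log_div (Real.exp_pos _).ne' (by positivity), Real.log_exp]

theorem spinProb_tanh_pos (f : ℝ) (e : ℤˣ) : 0 < spinProb (Real.tanh f) e := by
  have h1 := Real.tanh_lt_one f
  have h2 := Real.neg_one_lt_tanh f
  unfold spinProb
  rcases spin_cases e with h | h <;> rw [h] <;> linarith

theorem mul_add_ent_eq (f x : ℝ) :
    f * x + ent x = Real.log (2 * Real.cosh f) +
      ∑ e, spinProb x e * (Real.log (spinProb (Real.tanh f) e) - Real.log (spinProb x e)) := by
  rw [ent_eq, sum_units, log_spinProb_tanh, log_spinProb_tanh]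
  simp only [spinProb, spin, Units.val_one, Int.cast_one, mul_one, Units.val_neg, Int.cast_neg,
    mul_neg]
  ring

theorem sum_spinProb (x : ℝ) : ∑ e, spinProb x e = 1 := by
  rw [sum_units]; simp [spinProb, spin]; ring

theorem mul_add_ent_tanh (f : ℝ) :
    f * Real.tanh f + ent (Real.tanh f) = Real.log (2 * Real.cosh f) := by
  rw [mul_add_ent_eq]; simp

/-- The variational principle for one spin. -/
theorem mul_add_ent_le (f : ℝ) {x : ℝ} (hx : |x| ≤ 1) :
    f * x + ent x ≤ f * Real.tanh f + ent (Real.tanh f) := by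
  rw [mul_add_ent_tanh, mul_add_ent_eq]
  have : ∑ e, spinProb x e * (Real.log (spinProb (Real.tanh f) e) - Real.log (spinProb x e)) ≤
      ∑ e, (spinProb (Real.tanh f) e - spinProb x e) :=
    sum_le_sum fun e _ => mul_log_sub_log_le (spinProb_nonneg hx e) (spinProb_tanh_pos f e)
  rw [sum_sub_distrib, sum_spinProb, sum_spinProb] at this
  linarith

theorem eq_tanh_of_le_mul_add_ent {f x : ℝ} (hx : |x| ≤ 1)
    (h : f * Real.tanh f + ent (Real.tanh f) ≤ f * x + ent x) : x = Real.tanh f := by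
  by_contra hne
  rw [mul_add_ent_tanh, mul_add_ent_eq] at h
  have : ∑ e, spinProb x e * (Real.log (spinProb (Real.tanh f) e) - Real.log (spinProb x e)) <
      ∑ e, (spinProb (Real.tanh f) e - spinProb x e) := by
    refine sum_lt_sum_of_nonempty univ_nonempty fun e _ =>
      mul_log_sub_log_lt (spinProb_nonneg hx e) (spinProb_tanh_pos f e) fun he => hne ?_
    unfold spinProb at he
    rcases spin_cases e with h' | h' <;> rw [h'] at he <;> linarith
  rw [sum_sub_distrib, sum_spinProb, sum_spinProb] at this
  linarith

theorem abs_tanh_sub_tanh_le (x y : ℝ) : |Real.tanh x - Real.tanh y| ≤ |x - y| := by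
  have hd : ∀ z ∈ (Set.univ : Set ℝ),
      HasDerivWithinAt Real.tanh (1 / Real.cosh z ^ 2) Set.univ z := by
    intro z _
    have h := (Real.hasDerivAt_sinh z).div (Real.hasDerivAt_cosh z) (Real.cosh_pos z).ne'
    have h' : HasDerivAt Real.tanh (1 / Real.cosh z ^ 2) z := by
      convert! h using 1
      · funext w; exact Real.tanh_eq_sinh_div_cosh w
      · rw [← Real.cosh_sq_sub_sinh_sq z]; ring
    exact h'.hasDerivWithinAt
  have := Convex.norm_image_sub_le_of_norm_hasDerivWithin_le (C := 1) hd (fun z _ => by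
    have := Real.one_le_cosh z
    rw [Real.norm_eq_abs, abs_of_nonneg (by positivity), div_le_one (by positivity)]
    nlinarith) convex_univ (Set.mem_univ y) (Set.mem_univ x)
  simpa using this

end TwoPoint

/-! ### The mean-field functional -/

section MeanField

variable {d : ℕ}

/-- The quadratic form `∑ i j, A i j μ i μ j`. -/
def quad (A : Matrix (Fin d) (Fin d) ℝ) (μ : Fin d → ℝ) : ℝ := ∑ i, ∑ j, A i j * μ i * μ j

/-- The mean-field free energy of a product measure with means `μ`. -/
noncomputable def meanField (A : Matrix (Fin d) (Fin d) ℝ) (h μ : Fin d → ℝ) : ℝ :=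
  quad A μ + ∑ i, (h i * μ i + ent (μ i))

theorem weight_eq (A : Matrix (Fin d) (Fin d) ℝ) (h : Fin d → ℝ) (x : Fin d → ℤˣ) :
    IsingModel.weight A h x =
      Real.exp (quad A (fun i => spin (x i)) + ∑ i, h i * spin (x i)) := rfl

theorem weight_pos (A : Matrix (Fin d) (Fin d) ℝ) (h : Fin d → ℝ) (x : Fin d → ℤˣ) :
    0 < IsingModel.weight A h x := Real.exp_pos _

theorem partitionFunction_pos (A : Matrix (Fin d) (Fin d) ℝ) (h : Fin d → ℝ) :
    0 < IsingModel.partitionFunction A h :=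
  sum_pos (fun x _ => weight_pos A h x) univ_nonempty

theorem quad_eq_sum_mul (A : Matrix (Fin d) (Fin d) ℝ) (μ : Fin d → ℝ) :
    quad A μ = ∑ i, μ i * ∑ j, A i j * μ j := by
  simp only [quad, mul_sum]
  exact sum_congr rfl fun i _ => sum_congr rfl fun j _ => by ring

theorem quad_add {A : Matrix (Fin d) (Fin d) ℝ} (hA : A.IsSymm) (μ z : Fin d → ℝ) :
    quad A (μ + z) = quad A μ + 2 * ∑ i, z i * ∑ j, A i j * μ j + quad A z := by
  have h1 : ∑ i, ∑ j, A i j * μ i * z j = ∑ i, ∑ j, A i j * z i * μ j := by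
    rw [sum_comm]
    exact sum_congr rfl fun i _ => sum_congr rfl fun j _ => by rw [hA.apply i j]; ring
  have h2 : ∑ i, z i * ∑ j, A i j * μ j = ∑ i, ∑ j, A i j * z i * μ j := by
    simp only [mul_sum]
    exact sum_congr rfl fun i _ => sum_congr rfl fun j _ => by ring
  have h3 : quad A (μ + z) = quad A μ + ∑ i, ∑ j, A i j * μ i * z j +
      ∑ i, ∑ j, A i j * z i * μ j + quad A z := by
    simp only [quad, ← sum_add_distrib, Pi.add_apply]
    exact sum_congr rfl fun i _ => sum_congr rfl fun j _ => by ring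
  rw [h3, h1, h2]; ring

theorem abs_quad_sub_quad_le {A : Matrix (Fin d) (Fin d) ℝ} {K : ℝ} (hK : 0 ≤ K)
    (hA : ∀ i j, |A i j| ≤ K / d) {μ ν : Fin d → ℝ} (hμ : ∀ i, |μ i| ≤ 1) (hν : ∀ i, |ν i| ≤ 1) :
    |quad A μ - quad A ν| ≤ 2 * K * ∑ i, |μ i - ν i| := by
  rcases Nat.eq_zero_or_pos d with rfl | hd
  · simp [quad]
  have hd' : (0 : ℝ) < d := by exact_mod_cast hd
  calc |quad A μ - quad A ν| = |∑ i, ∑ j, A i j * (μ i * (μ j - ν j) + (μ i - ν i) * ν j)| := by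
        simp only [quad, ← sum_sub_distrib]
        congr 1
        exact sum_congr rfl fun i _ => sum_congr rfl fun j _ => by ring
    _ ≤ ∑ i, ∑ j, K / d * (|μ j - ν j| + |μ i - ν i|) := by
        refine (abs_sum_le_sum_abs _ _).trans (sum_le_sum fun i _ =>
          (abs_sum_le_sum_abs _ _).trans (sum_le_sum fun j _ => ?_))
        rw [abs_mul]
        refine mul_le_mul (hA i j) ((abs_add_le _ _).trans ?_) (abs_nonneg _) (by positivity)
        rw [abs_mul, abs_mul]
        have h1 := mul_le_mul_of_nonneg_right (hμ i) (abs_nonneg (μ j - ν j))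
        have h2 := mul_le_mul_of_nonneg_left (hν j) (abs_nonneg (μ i - ν i))
        linarith
    _ = 2 * K * ∑ i, |μ i - ν i| := by
        simp only [← mul_sum, sum_add_distrib, sum_const, card_univ, Fintype.card_fin,
          nsmul_eq_mul]
        field_simp
        ring

/-! ### The Gibbs variational principle -/

theorem sum_prod_spin (f : Fin d → ℤˣ → ℝ) :
    ∑ x : Fin d → ℤˣ, ∏ i, f i (x i) = ∏ i, ∑ e, f i e :=
  (Fintype.prod_sum f).symm

/-- The probability of `x` when the spins are independent with means `μ`. -/
noncomputable def prodProb (μ : Fin d → ℝ) (x : Fin d → ℤˣ) : ℝ := ∏ i, spinProb (μ i) (x i)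

theorem sum_spinProb_mul_spin (μ : ℝ) : ∑ e, spinProb μ e * spin e = μ := by
  rw [sum_units]; simp [spinProb, spin]; ring

theorem sum_prodProb (μ : Fin d → ℝ) : ∑ x, prodProb μ x = 1 := by
  simp only [prodProb, sum_prod_spin fun i e => spinProb (μ i) e, sum_spinProb, prod_const_one]

theorem sum_prodProb_mul_spin (μ : Fin d → ℝ) (i : Fin d) :
    ∑ x, prodProb μ x * spin (x i) = μ i := by
  have h : ∀ x : Fin d → ℤˣ, prodProb μ x * spin (x i) =
      ∏ k, (spinProb (μ k) (x k) * if k = i then spin (x k) else 1) := by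
    intro x
    rw [prod_mul_distrib, prodProb]
    simp
  simp only [h]
  rw [sum_prod_spin fun k e => spinProb (μ k) e * if k = i then spin e else 1]
  have h2 : ∀ k, ∑ e, (spinProb (μ k) e * if k = i then spin e else 1) =
      if k = i then μ k else 1 := by
    intro k
    split_ifs
    · exact sum_spinProb_mul_spin _
    · simp only [mul_one, sum_spinProb]
  simp only [h2, prod_ite_eq', mem_univ, if_true]

theorem sum_prodProb_mul_spin_mul_spin (μ : Fin d → ℝ) {i j : Fin d} (hij : i ≠ j) :
    ∑ x, prodProb μ x * (spin (x i) * spin (x j)) = μ i * μ j := by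
  have h : ∀ x : Fin d → ℤˣ, prodProb μ x * (spin (x i) * spin (x j)) =
      ∏ k, (spinProb (μ k) (x k) * ((if k = i then spin (x k) else 1) *
        if k = j then spin (x k) else 1)) := by
    intro x
    rw [prod_mul_distrib, prod_mul_distrib, prodProb]
    simp
  simp only [h]
  rw [sum_prod_spin fun k e =>
    spinProb (μ k) e * ((if k = i then spin e else 1) * if k = j then spin e else 1)]
  have h2 : ∀ k, ∑ e, (spinProb (μ k) e * ((if k = i then spin e else 1) *
      if k = j then spin e else 1)) = (if k = i then μ k else 1) * if k = j then μ k else 1 := by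
    intro k
    by_cases h1 : k = i
    · subst h1; simp only [if_true, hij, if_false, mul_one, sum_spinProb_mul_spin]
    · by_cases h2 : k = j
      · subst h2; simp only [if_true, h1, if_false, one_mul, sum_spinProb_mul_spin]
      · simp only [h1, h2, if_false, mul_one, sum_spinProb]
  simp only [h2, prod_mul_distrib]
  simp

theorem log_prodProb {μ : Fin d → ℝ} {x : Fin d → ℤˣ} (h : prodProb μ x ≠ 0) :
    Real.log (prodProb μ x) = ∑ i, Real.log (spinProb (μ i) (x i)) :=
  Real.log_prod fun i _ => (prod_ne_zero_iff.1 h) i (mem_univ i)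

theorem prodProb_nonneg {μ : Fin d → ℝ} (hμ : ∀ i, |μ i| ≤ 1) (x : Fin d → ℤˣ) :
    0 ≤ prodProb μ x := prod_nonneg fun i _ => spinProb_nonneg (hμ i) (x i)

/-- The cross entropy of a distribution with the product measure of the same means. -/
theorem sum_mul_sum_log_spinProb {s : Finset (Fin d → ℤˣ)} {p : (Fin d → ℤˣ) → ℝ}
    (hp : ∑ x ∈ s, p x = 1) {μ : Fin d → ℝ} (hμ : ∀ i, ∑ x ∈ s, p x * spin (x i) = μ i) :
    ∑ x ∈ s, p x * ∑ i, Real.log (spinProb (μ i) (x i)) = -∑ i, ent (μ i) := by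
  simp only [mul_sum]
  rw [sum_comm, ← sum_neg_distrib]
  refine sum_congr rfl fun i _ => ?_
  rw [ent_eq, neg_neg]
  set φ : ℤˣ → ℝ := fun e => Real.log (spinProb (μ i) e)
  calc ∑ x ∈ s, p x * φ (x i)
      = ∑ x ∈ s, (p x * ((φ 1 + φ (-1)) / 2) + p x * spin (x i) * ((φ 1 - φ (-1)) / 2)) :=
        sum_congr rfl fun x _ => by rw [eq_affine_spin φ (x i)]; ring
    _ = _ := by rw [sum_add_distrib, ← sum_mul, ← sum_mul, hp, hμ, one_mul]

/-- The Gibbs variational principle for product measures. -/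
theorem meanField_le_log_partitionFunction {A : Matrix (Fin d) (Fin d) ℝ} {K : ℝ} (hK : 0 ≤ K)
    (hA : ∀ i j, |A i j| ≤ K / d) (h : Fin d → ℝ) {μ : Fin d → ℝ} (hμ : ∀ i, |μ i| ≤ 1) :
    meanField A h μ ≤ Real.log (IsingModel.partitionFunction A h) + K := by
  set Z := IsingModel.partitionFunction A h with hZ
  have hZpos : 0 < Z := partitionFunction_pos A h
  have h1 : ∀ x : Fin d → ℤˣ, prodProb μ x * (quad A (fun i => spin (x i)) +
      ∑ i, h i * spin (x i) - ∑ i, Real.log (spinProb (μ i) (x i)) - Real.log Z) ≤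
      IsingModel.weight A h x / Z - prodProb μ x := by
    intro x
    have hw := div_pos (weight_pos A h x) hZpos
    by_cases hx : prodProb μ x = 0
    · rw [hx]; simpa using hw.le
    · have := mul_log_sub_log_le (prodProb_nonneg hμ x) hw
      rw [Real.log_div (weight_pos A h x).ne' hZpos.ne', weight_eq, Real.log_exp,
        log_prodProb hx] at this
      rw [weight_eq]
      refine le_trans (le_of_eq ?_) this
      ring
  have h2 := sum_le_sum fun x (_ : x ∈ univ) => h1 x
  have h3 : ∑ x : Fin d → ℤˣ, (IsingModel.weight A h x / Z - prodProb μ x) = 0 := by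
    rw [sum_sub_distrib, ← sum_div, sum_prodProb]
    rw [show ∑ x, IsingModel.weight A h x = Z from rfl, div_self hZpos.ne', sub_self]
  have h4 : ∑ x, prodProb μ x * ∑ i, h i * spin (x i) = ∑ i, h i * μ i := by
    simp only [mul_sum]
    rw [sum_comm]
    refine sum_congr rfl fun i _ => ?_
    rw [← sum_prodProb_mul_spin μ i, mul_sum]
    exact sum_congr rfl fun x _ => by ring
  have h5 : quad A μ - K ≤ ∑ x, prodProb μ x * quad A (fun i => spin (x i)) := by
    have : ∑ x, prodProb μ x * quad A (fun i => spin (x i)) =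
        ∑ i, ∑ j, (A i j * μ i * μ j + if i = j then A i j * (1 - μ i * μ j) else 0) := by
      simp only [quad, mul_sum]
      rw [sum_comm]
      refine sum_congr rfl fun i _ => ?_
      rw [sum_comm]
      refine sum_congr rfl fun j _ => ?_
      have e : ∀ x : Fin d → ℤˣ, prodProb μ x * (A i j * spin (x i) * spin (x j)) =
          A i j * (prodProb μ x * (spin (x i) * spin (x j))) := fun x => by ring
      simp only [e, ← mul_sum]
      split_ifs with hij
      · subst hij
        simp only [spin_mul_self, mul_one, sum_prodProb]
        ring
      · rw [sum_prodProb_mul_spin_mul_spin μ hij]; ring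
    rw [this]
    simp only [sum_add_distrib, sum_ite_eq, mem_univ, if_true]
    have h6 : -K ≤ ∑ i, A i i * (1 - μ i * μ i) := by
      rcases Nat.eq_zero_or_pos d with rfl | hd
      · simpa using hK
      have hd' : (0 : ℝ) < d := by exact_mod_cast hd
      calc -K = ∑ _i : Fin d, -(K / d) := by simp; field_simp
        _ ≤ _ := by
          refine sum_le_sum fun i _ => ?_
          have h7 := abs_le.1 (hA i i)
          have h8 : μ i * μ i ≤ 1 := by
            have := abs_le.1 (hμ i); nlinarith
          have h9 : 0 ≤ K / d := by positivity
          nlinarith [mul_self_nonneg (μ i)]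
    unfold quad
    linarith
  simp only [mul_sub, mul_add, sum_sub_distrib, sum_add_distrib, ← sum_mul, sum_prodProb,
    sum_mul_sum_log_spinProb (sum_prodProb μ) (sum_prodProb_mul_spin μ), h4] at h2
  rw [sum_sub_distrib, sum_prodProb] at h3
  unfold meanField
  rw [sum_add_distrib]
  linarith

/-- The entropy bound: a sum of exponentials of a linear form over a set of configurations. -/
theorem exists_mean_log_sum_exp_le {s : Finset (Fin d → ℤˣ)} (hs : s.Nonempty)
    (f : Fin d → ℝ) :
    ∃ p : (Fin d → ℤˣ) → ℝ, (∀ x, 0 ≤ p x) ∧ ∑ x ∈ s, p x = 1 ∧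
      Real.log (∑ x ∈ s, Real.exp (∑ i, f i * spin (x i))) ≤
        ∑ i, (f i * (∑ x ∈ s, p x * spin (x i)) + ent (∑ x ∈ s, p x * spin (x i))) := by
  set Z := ∑ x ∈ s, Real.exp (∑ i, f i * spin (x i)) with hZ
  have hZpos : 0 < Z := sum_pos (fun x _ => Real.exp_pos _) hs
  set p : (Fin d → ℤˣ) → ℝ := fun x => Real.exp (∑ i, f i * spin (x i)) / Z with hp
  have hp0 : ∀ x, 0 < p x := fun x => div_pos (Real.exp_pos _) hZpos
  have hp1 : ∑ x ∈ s, p x = 1 := by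
    rw [hp, ← sum_div, div_self hZpos.ne']
  refine ⟨p, fun x => (hp0 x).le, hp1, ?_⟩
  set μ : Fin d → ℝ := fun i => ∑ x ∈ s, p x * spin (x i) with hμ
  have hprob : ∀ i, ∀ x ∈ s, p x ≤ spinProb (μ i) (x i) := by
    intro i x hx
    have h1 : spinProb (μ i) (x i) = ∑ y ∈ s, p y * ((1 + spin (y i) * spin (x i)) / 2) := by
      have : ∑ y ∈ s, p y * ((1 + spin (y i) * spin (x i)) / 2) =
          ∑ y ∈ s, (p y / 2 + p y * spin (y i) * (spin (x i) / 2)) :=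
        sum_congr rfl fun y _ => by ring
      rw [this, sum_add_distrib, ← sum_mul, ← sum_div, hp1]
      simp only [spinProb, hμ]; ring
    rw [h1]
    have h2 : p x = p x * ((1 + spin (x i) * spin (x i)) / 2) := by
      rw [spin_mul_self]; ring
    rw [h2]
    refine single_le_sum (f := fun y => p y * ((1 + spin (y i) * spin (x i)) / 2))
      (fun y _ => mul_nonneg (hp0 y).le ?_) hx
    rcases spin_cases (y i) with h | h <;> rcases spin_cases (x i) with h' | h' <;>
      rw [h, h'] <;> norm_num
  have hμ1 : ∀ i, |μ i| ≤ 1 := by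
    intro i
    refine (abs_sum_le_sum_abs _ _).trans ?_
    simp only [abs_mul, abs_spin, mul_one, abs_of_pos (hp0 _), hp1, le_refl]
  have hpos : ∀ x ∈ s, 0 < prodProb μ x := fun x hx =>
    prod_pos fun i _ => (hp0 x).trans_le (hprob i x hx)
  have h1 : ∀ x ∈ s, p x * (∑ i, Real.log (spinProb (μ i) (x i)) -
      ((∑ i, f i * spin (x i)) - Real.log Z)) ≤ prodProb μ x - p x := by
    intro x hx
    have := mul_log_sub_log_le (hp0 x).le (hpos x hx)
    rw [log_prodProb (hpos x hx).ne'] at this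
    rwa [show Real.log (p x) = (∑ i, f i * spin (x i)) - Real.log Z by
      rw [hp, Real.log_div (Real.exp_pos _).ne' hZpos.ne', Real.log_exp]] at this
  have h2 := sum_le_sum h1
  have h3 : ∑ x ∈ s, (prodProb μ x - p x) ≤ 0 := by
    rw [sum_sub_distrib, hp1, ← sum_prodProb μ, sub_nonpos]
    exact sum_le_sum_of_subset_of_nonneg (subset_univ _) fun x _ _ => prodProb_nonneg hμ1 x
  have h4 : ∑ x ∈ s, p x * ∑ i, f i * spin (x i) = ∑ i, f i * μ i := by
    simp only [mul_sum]
    rw [sum_comm]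
    refine sum_congr rfl fun i _ => ?_
    simp only [hμ, mul_sum]
    exact sum_congr rfl fun x _ => by ring
  have h5 := sum_mul_sum_log_spinProb hp1 (fun i => rfl : ∀ i, ∑ x ∈ s, p x * spin (x i) = μ i)
  simp only [mul_sub, sum_sub_distrib, ← sum_mul, hp1, one_mul, h4] at h2
  rw [sum_add_distrib]
  rw [sum_sub_distrib, hp1] at h3
  simp only [hμ] at h5 h2
  linarith

end MeanField

section MeanFieldUpper

variable {d : ℕ}

/-- The interaction field of the spins estimated from the spins `v` at the sites `b`. -/
noncomputable def sampledField (A : Matrix (Fin d) (Fin d) ℝ) {s : ℕ} (b : Fin s → Fin d)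
    (v : Fin s → ℝ) (a : Fin d) : ℝ := 𝔼 k, d * A a (b k) * v k

theorem abs_mul_entry_le {A : Matrix (Fin d) (Fin d) ℝ} {K : ℝ} (hA : ∀ i j, |A i j| ≤ K / d)
    (i j : Fin d) : |d * A i j| ≤ K := by
  have hd : (0 : ℝ) < d := by exact_mod_cast i.pos
  rw [abs_mul, abs_of_pos hd]
  calc d * |A i j| ≤ d * (K / d) := by gcongr; exact hA i j
    _ = K := by field_simp

theorem abs_mul_entry_mul_le {A : Matrix (Fin d) (Fin d) ℝ} {K : ℝ}
    (hA : ∀ i j, |A i j| ≤ K / d) {v : ℝ} (hv : |v| ≤ 1) (i j : Fin d) : |d * A i j * v| ≤ K := by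
  have := abs_mul_entry_le hA i j
  rw [abs_mul]
  nlinarith [abs_nonneg v, abs_nonneg (d * A i j)]

theorem abs_sampledField_le {A : Matrix (Fin d) (Fin d) ℝ} {K : ℝ}
    (hA : ∀ i j, |A i j| ≤ K / d) {s : ℕ} (hs : 0 < s) (b : Fin s → Fin d) {v : Fin s → ℝ}
    (hv : ∀ k, |v k| ≤ 1) (a : Fin d) : |sampledField A b v a| ≤ K := by
  have : Nonempty (Fin s) := ⟨⟨0, hs⟩⟩
  exact abs_expect_le_of_forall fun k => abs_mul_entry_mul_le hA (hv k) a (b k)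

theorem sum_entry_mul_eq_expect (A : Matrix (Fin d) (Fin d) ℝ) (μ : Fin d → ℝ) (a : Fin d) :
    ∑ c, A a c * μ c = 𝔼 c, d * A a c * μ c := by
  have hd : (0 : ℝ) < d := by exact_mod_cast a.pos
  rw [Fintype.expect_eq_sum_div_card, Fintype.card_fin, eq_div_iff hd.ne', sum_mul]
  exact sum_congr rfl fun c _ => by ring

theorem expect_abs_sampledField_sub_le {A : Matrix (Fin d) (Fin d) ℝ} {K : ℝ}
    (hA : ∀ i j, |A i j| ≤ K / d) {s : ℕ} (hs : 0 < s) {μ : Fin d → ℝ} (hμ : ∀ i, |μ i| ≤ 1)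
    (a : Fin d) :
    𝔼 b : Fin s → Fin d, |sampledField A b (μ ∘ b) a - ∑ c, A a c * μ c| ≤ K / √s := by
  have : Nonempty (Fin d) := ⟨a⟩
  rw [sum_entry_mul_eq_expect]
  exact expect_abs_mean_sub_le (fun c => abs_mul_entry_mul_le hA (hμ c) a c) hs

theorem abs_sum_mul_sub_le {x f g : Fin d → ℝ} (hx : ∀ i, |x i| ≤ 1) {D : ℝ}
    (h : ∑ a, |g a - f a| ≤ D) : |∑ a, x a * f a - ∑ a, x a * g a| ≤ D := by
  rw [← sum_sub_distrib]
  refine ((abs_sum_le_sum_abs _ _).trans (sum_le_sum fun a _ => ?_)).trans h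
  rw [← mul_sub, abs_mul, abs_sub_comm]
  exact mul_le_of_le_one_left (abs_nonneg _) (hx a)

/-- The contribution to the partition function of the configurations whose interaction field
is close to `g` is controlled by the mean-field functional. -/
theorem sum_weight_le_exp {A : Matrix (Fin d) (Fin d) ℝ} {h : Fin d → ℝ} {c : ℝ}
    (hc : ∀ μ : Fin d → ℝ, (∀ i, |μ i| ≤ 1) → meanField A h μ ≤ c) {g : Fin d → ℝ} {D : ℝ}
    {s : Finset (Fin d → ℤˣ)}
    (hs : ∀ x ∈ s, ∑ a, |g a - ∑ c, A a c * spin (x c)| ≤ D) :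
    ∑ x ∈ s, IsingModel.weight A h x ≤ Real.exp (c + 2 * D) := by
  rcases s.eq_empty_or_nonempty with rfl | hne
  · simpa using (Real.exp_pos _).le
  obtain ⟨p, hp0, hp1, hlog⟩ := exists_mean_log_sum_exp_le hne (fun a => g a + h a)
  set μ : Fin d → ℝ := fun i => ∑ x ∈ s, p x * spin (x i) with hμ
  have hμ1 : ∀ i, |μ i| ≤ 1 := by
    intro i
    refine (abs_sum_le_sum_abs _ _).trans ?_
    simp only [abs_mul, abs_spin, mul_one, abs_of_nonneg (hp0 _), hp1, le_refl]
  have hgμ : ∑ a, |g a - ∑ c, A a c * μ c| ≤ D := by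
    have h1 : ∀ a, g a - ∑ c, A a c * μ c =
        ∑ x ∈ s, p x * (g a - ∑ c, A a c * spin (x c)) := by
      intro a
      simp only [mul_sub, sum_sub_distrib, ← sum_mul, hp1, one_mul]
      congr 1
      simp only [hμ, mul_sum]
      rw [sum_comm]
      exact sum_congr rfl fun x _ => sum_congr rfl fun c _ => by ring
    calc ∑ a, |g a - ∑ c, A a c * μ c|
        ≤ ∑ a, ∑ x ∈ s, p x * |g a - ∑ c, A a c * spin (x c)| := by
          refine sum_le_sum fun a _ => ?_
          rw [h1]
          refine (abs_sum_le_sum_abs _ _).trans (sum_le_sum fun x _ => ?_)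
          rw [abs_mul, abs_of_nonneg (hp0 x)]
      _ = ∑ x ∈ s, p x * ∑ a, |g a - ∑ c, A a c * spin (x c)| := by
          rw [sum_comm]; simp only [mul_sum]
      _ ≤ ∑ x ∈ s, p x * D :=
          sum_le_sum fun x hx => mul_le_mul_of_nonneg_left (hs x hx) (hp0 x)
      _ = D := by rw [← sum_mul, hp1, one_mul]
  have hw : ∀ x ∈ s, IsingModel.weight A h x ≤
      Real.exp D * Real.exp (∑ a, (g a + h a) * spin (x a)) := by
    intro x hx
    rw [weight_eq, ← Real.exp_add, Real.exp_le_exp, quad_eq_sum_mul]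
    have := (abs_le.1 (abs_sum_mul_sub_le (x := fun a => spin (x a))
      (fun a => (abs_spin (x a)).le) (hs x hx))).2
    have e : ∑ a, (g a + h a) * spin (x a) = ∑ a, spin (x a) * g a + ∑ a, h a * spin (x a) := by
      rw [← sum_add_distrib]
      exact sum_congr rfl fun a _ => by ring
    linarith
  have hpos : 0 < ∑ x ∈ s, Real.exp (∑ a, (g a + h a) * spin (x a)) :=
    sum_pos (fun x _ => Real.exp_pos _) hne
  calc ∑ x ∈ s, IsingModel.weight A h x
      ≤ ∑ x ∈ s, Real.exp D * Real.exp (∑ a, (g a + h a) * spin (x a)) := sum_le_sum hw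
    _ = Real.exp (D + Real.log (∑ x ∈ s, Real.exp (∑ a, (g a + h a) * spin (x a)))) := by
        rw [← mul_sum, Real.exp_add, Real.exp_log hpos]
    _ ≤ Real.exp (c + 2 * D) := by
        rw [Real.exp_le_exp]
        have h1 := hc μ hμ1
        have h2 := (abs_le.1 (abs_sum_mul_sub_le hμ1 hgμ)).1
        unfold meanField at h1
        rw [quad_eq_sum_mul] at h1
        have e : ∑ a, ((g a + h a) * μ a + ent (μ a)) =
            ∑ a, μ a * g a + ∑ a, (h a * μ a + ent (μ a)) := by
          rw [← sum_add_distrib]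
          exact sum_congr rfl fun a _ => by ring
        linarith

/-- The mean-field approximation: the free energy exceeds the maximum of the mean-field
functional by little. -/
theorem log_partitionFunction_le {A : Matrix (Fin d) (Fin d) ℝ} {K : ℝ} (hK : 0 < K)
    (hd : 0 < d) (hA : ∀ i j, |A i j| ≤ K / d) {h : Fin d → ℝ} {c : ℝ}
    (hc : ∀ μ : Fin d → ℝ, (∀ i, |μ i| ≤ 1) → meanField A h μ ≤ c) {s : ℕ} (hs : 0 < s) :
    Real.log (IsingModel.partitionFunction A h) ≤ c + 4 * K * d / √s + (s + 1) := by
  have hd' : (0 : ℝ) < d := by exact_mod_cast hd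
  have hs' : (0 : ℝ) < s := by exact_mod_cast hs
  have : Nonempty (Fin d) := ⟨⟨0, hd⟩⟩
  classical
  set D : ℝ := 2 * (d * (K / √s)) with hD
  have hDpos : 0 < D := by positivity
  set X : (Fin s → Fin d) → (Fin d → ℤˣ) → ℝ := fun b x =>
    ∑ a, |sampledField A b (fun k => spin (x (b k))) a - ∑ c, A a c * spin (x c)| with hX
  have hX0 : ∀ b x, 0 ≤ X b x := fun b x => sum_nonneg fun a _ => abs_nonneg _
  have hmean : ∀ x, 𝔼 b, X b x ≤ D / 2 := by
    intro x
    rw [hX, expect_sum_comm]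
    calc _ ≤ ∑ _a : Fin d, K / √s := sum_le_sum fun a _ =>
          expect_abs_sampledField_sub_le hA hs (μ := fun c => spin (x c))
            (fun c => (abs_spin (x c)).le) a
      _ = D / 2 := by simp [hD]
  have hhalf : ∀ x, 1 / 2 ≤ 𝔼 b : Fin s → Fin d, if X b x ≤ D then (1 : ℝ) else 0 := by
    intro x
    calc (1 : ℝ) / 2 ≤ 𝔼 b : Fin s → Fin d, (1 - X b x / D) := by
          rw [expect_sub_distrib, Fintype.expect_const, ← expect_div]
          have : (𝔼 b, X b x) / D ≤ 1 / 2 := by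
            rw [div_le_iff₀ hDpos]; linarith [hmean x]
          linarith
      _ ≤ _ := by
          refine expect_mono' fun b => ?_
          split_ifs with hb
          · have := div_nonneg (hX0 b x) hDpos.le
            linarith
          · have : 1 ≤ X b x / D := by
              rw [one_le_div hDpos]; exact (not_le.1 hb).le
            linarith
  have hpart : ∀ b : Fin s → Fin d, ∑ x, IsingModel.weight A h x * (if X b x ≤ D then 1 else 0) ≤
      2 ^ s * Real.exp (c + 2 * D) := by
    intro b
    simp only [mul_ite, mul_one, mul_zero]
    rw [← sum_filter]
    rw [← sum_fiberwise _ (fun x => x ∘ b)]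
    calc _ ≤ ∑ _v : Fin s → ℤˣ, Real.exp (c + 2 * D) := by
          refine sum_le_sum fun v _ => sum_weight_le_exp hc
            (g := sampledField A b fun k => spin (v k)) fun x hx => ?_
          simp only [mem_filter, mem_univ, true_and] at hx
          obtain ⟨h1, rfl⟩ := hx
          exact h1
      _ = _ := by
          simp
  have hZ : IsingModel.partitionFunction A h ≤ 2 * (2 ^ s * Real.exp (c + 2 * D)) := by
    calc IsingModel.partitionFunction A h
        ≤ ∑ x, IsingModel.weight A h x *
            (2 * 𝔼 b : Fin s → Fin d, if X b x ≤ D then (1 : ℝ) else 0) := by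
          refine sum_le_sum fun x _ => ?_
          have := weight_pos A h x
          nlinarith [hhalf x]
      _ = 2 * 𝔼 b, ∑ x, IsingModel.weight A h x * (if X b x ≤ D then 1 else 0) := by
          rw [expect_sum_comm, mul_sum]
          refine sum_congr rfl fun x _ => ?_
          rw [← mul_expect]; ring
      _ ≤ _ := by
          gcongr
          exact expect_le_of_forall_le hpart
  have h2 : (2 : ℝ) ≤ Real.exp 1 := by linarith [Real.add_one_le_exp 1]
  have hZ2 : IsingModel.partitionFunction A h ≤ Real.exp (c + 4 * K * d / √s + (s + 1)) := by
    refine hZ.trans ?_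
    have e : c + 4 * K * d / √s + ((s : ℝ) + 1) = 1 + (s * 1 + (c + 2 * D)) := by
      rw [hD]; ring
    rw [e, Real.exp_add 1, Real.exp_add (s * 1 : ℝ), Real.exp_nat_mul]
    gcongr
  exact (Real.log_le_iff_le_exp (partitionFunction_pos A h)).2 hZ2

end MeanFieldUpper

/-! ### Maximizers of the mean-field functional -/

section Maximizer

variable {d : ℕ}

theorem continuous_meanField (A : Matrix (Fin d) (Fin d) ℝ) (h : Fin d → ℝ) :
    Continuous (meanField A h) := by
  have := continuous_ent
  unfold meanField quad
  fun_prop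

theorem exists_isMax_meanField (A : Matrix (Fin d) (Fin d) ℝ) (h : Fin d → ℝ) :
    ∃ μ : Fin d → ℝ, (∀ i, |μ i| ≤ 1) ∧
      ∀ ν : Fin d → ℝ, (∀ i, |ν i| ≤ 1) → meanField A h ν ≤ meanField A h μ := by
  have hc : IsCompact (Set.pi Set.univ fun _ : Fin d => Set.Icc (-1 : ℝ) 1) :=
    isCompact_univ_pi fun _ => isCompact_Icc
  obtain ⟨μ, hμ, hmax⟩ := hc.exists_isMaxOn ⟨0, fun _ _ => by simp⟩
    (continuous_meanField A h).continuousOn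
  refine ⟨μ, fun i => abs_le.2 (hμ i trivial), fun ν hν => hmax fun i _ => abs_le.1 (hν i)⟩

/-- A maximizer of the mean-field functional satisfies the mean-field equation. -/
theorem eq_tanh_of_isMax_meanField {A : Matrix (Fin d) (Fin d) ℝ} (hA : A.IsSymm)
    (hdiag : ∀ i, A i i = 0) {h μ : Fin d → ℝ} (hμ : ∀ i, |μ i| ≤ 1)
    (hmax : ∀ ν : Fin d → ℝ, (∀ i, |ν i| ≤ 1) → meanField A h ν ≤ meanField A h μ) (a : Fin d) :
    μ a = Real.tanh (h a + 2 * ∑ c, A a c * μ c) := by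
  set f := h a + 2 * ∑ c, A a c * μ c with hf
  refine eq_tanh_of_le_mul_add_ent (hμ a) ?_
  set y := Real.tanh f with hy
  have hy1 : |y| ≤ 1 := (Real.abs_tanh_lt_one f).le
  have h1 := hmax (Function.update μ a y) fun i => by
    by_cases hi : i = a
    · subst hi; simpa using hy1
    · simpa [hi] using hμ i
  have e : Function.update μ a y = μ + Pi.single a (y - μ a) := by
    funext i
    by_cases hi : i = a
    · subst hi; simp
    · simp [hi]
  have h2 : quad A (Function.update μ a y) =
      quad A μ + 2 * ((y - μ a) * ∑ c, A a c * μ c) := by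
    rw [e, quad_add hA]
    have h3 : quad A (Pi.single a (y - μ a)) = 0 := by
      unfold quad
      refine sum_eq_zero fun i _ => sum_eq_zero fun j _ => ?_
      by_cases hi : i = a
      · by_cases hj : j = a
        · rw [hi, hj, hdiag]; simp
        · simp [hj]
      · simp [hi]
    rw [h3]
    simp [Pi.single_apply]
  have h4 : ∑ i, (h i * Function.update μ a y i + ent (Function.update μ a y i)) -
      ∑ i, (h i * μ i + ent (μ i)) = h a * y + ent y - (h a * μ a + ent (μ a)) := by
    rw [← sum_sub_distrib]
    rw [sum_eq_single a]
    · simp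
    · intro i _ hi; simp [hi]
    · simp
  unfold meanField at h1
  rw [h2] at h1
  rw [hf]
  nlinarith

/-- The means given by the interaction fields estimated from the sites `b`. -/
noncomputable def sampledMean (A : Matrix (Fin d) (Fin d) ℝ) (h : Fin d → ℝ) {s : ℕ}
    (b : Fin s → Fin d) (v : Fin s → ℝ) (a : Fin d) : ℝ :=
  Real.tanh (h a + 2 * sampledField A b v a)

theorem mul_add_ent_sub_le {h w x : ℝ} (hx : |x| ≤ 1) :
    h * x + ent x - (h * Real.tanh (h + w) + ent (Real.tanh (h + w))) ≤
      |w| * |x - Real.tanh (h + w)| := by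
  have := mul_add_ent_le (h + w) hx
  rw [← abs_mul]
  have h2 := neg_abs_le (w * (x - Real.tanh (h + w)))
  nlinarith

theorem meanField_sub_sampledMean_le {A : Matrix (Fin d) (Fin d) ℝ} {K : ℝ} (hK : 0 ≤ K)
    (hA : ∀ i j, |A i j| ≤ K / d) {h μ : Fin d → ℝ} (hμ : ∀ i, |μ i| ≤ 1) {s : ℕ} (hs : 0 < s)
    (b : Fin s → Fin d) {v : Fin s → ℝ} (hv : ∀ k, |v k| ≤ 1) :
    meanField A h μ - meanField A h (sampledMean A h b v) ≤
      4 * K * ∑ a, |μ a - sampledMean A h b v a| := by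
  have hν : ∀ i, |sampledMean A h b v i| ≤ 1 := fun i => (Real.abs_tanh_lt_one _).le
  have h1 := (abs_le.1 (abs_quad_sub_quad_le hK hA hμ hν)).2
  have h2 : ∑ i, (h i * μ i + ent (μ i)) -
      ∑ i, (h i * sampledMean A h b v i + ent (sampledMean A h b v i)) ≤
      2 * K * ∑ a, |μ a - sampledMean A h b v a| := by
    rw [← sum_sub_distrib, mul_sum]
    refine sum_le_sum fun i _ => (mul_add_ent_sub_le (hμ i)).trans ?_
    refine mul_le_mul_of_nonneg_right ?_ (abs_nonneg _)
    rw [abs_mul, abs_two]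
    linarith [abs_sampledField_le hA hs b hv i]
  unfold meanField
  linarith

/-- A near-maximizer of the mean-field functional is determined, up to a small error, by its
values at a few random sites. -/
theorem exists_meanField_le_expect_sampledMean {A : Matrix (Fin d) (Fin d) ℝ} (hsymm : A.IsSymm)
    {K : ℝ} (hK : 0 ≤ K) (hd : 0 < d) (hA : ∀ i j, |A i j| ≤ K / d) (h : Fin d → ℝ)
    {s : ℕ} (hs : 0 < s) :
    ∃ μ : Fin d → ℝ, (∀ i, |μ i| ≤ 1) ∧
      (∀ ν : Fin d → ℝ, (∀ i, |ν i| ≤ 1) → meanField A h ν ≤ meanField A h μ + 2 * K) ∧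
      ∀ (γ : ℝ) (V : (Fin s → Fin d) → Fin s → ℝ), (∀ b k, |V b k| ≤ 1) →
        (∀ b k, |μ (b k) - V b k| ≤ γ) →
        meanField A h μ ≤ 𝔼 b, meanField A h (sampledMean A h b (V b)) +
          8 * K ^ 2 * (d / √s + d * γ + 1) := by
  have hd' : (0 : ℝ) < d := by exact_mod_cast hd
  have : Nonempty (Fin d) := ⟨⟨0, hd⟩⟩
  have hns : Nonempty (Fin s) := ⟨⟨0, hs⟩⟩
  set A₀ : Matrix (Fin d) (Fin d) ℝ := fun i j => if i = j then 0 else A i j with hA₀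
  have hsymm₀ : A₀.IsSymm := by
    refine Matrix.IsSymm.ext fun i j => ?_
    simp only [hA₀, eq_comm (a := j), hsymm.apply i j]
  obtain ⟨μ, hμ, hmax⟩ := exists_isMax_meanField A₀ h
  have hstat := eq_tanh_of_isMax_meanField hsymm₀ (fun i => by simp [hA₀]) hμ hmax
  have hsplit : ∀ (a : Fin d) (ν : Fin d → ℝ),
      ∑ c, A₀ a c * ν c = ∑ c, A a c * ν c - A a a * ν a := by
    intro a ν
    rw [eq_sub_iff_add_eq]
    have : A a a * ν a = ∑ c, if a = c then A a c * ν c else 0 := by simp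
    rw [this, ← sum_add_distrib]
    refine sum_congr rfl fun c _ => ?_
    by_cases hc : a = c <;> simp [hA₀, hc]
  have hquad : ∀ ν : Fin d → ℝ, (∀ i, |ν i| ≤ 1) → |meanField A h ν - meanField A₀ h ν| ≤ K := by
    intro ν hν
    have e : meanField A h ν - meanField A₀ h ν = ∑ a, A a a * ν a * ν a := by
      simp only [meanField, quad_eq_sum_mul, hsplit, mul_sub, sum_sub_distrib]
      rw [add_sub_add_right_eq_sub, sub_sub_cancel]
      exact sum_congr rfl fun a _ => by ring
    rw [e]
    calc _ ≤ ∑ _a : Fin d, K / d := by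
          refine (abs_sum_le_sum_abs _ _).trans (sum_le_sum fun a _ => ?_)
          rw [abs_mul, abs_mul]
          have h1 := hν a
          have h2 := abs_nonneg (ν a)
          have h3 := abs_nonneg (A a a)
          calc |A a a| * |ν a| * |ν a| ≤ |A a a| * 1 * 1 := by gcongr
            _ ≤ K / d := by rw [mul_one, mul_one]; exact hA a a
      _ = K := by simp; field_simp
  refine ⟨μ, hμ, fun ν hν => ?_, fun γ V hV hγ => ?_⟩
  · have h1 := (abs_le.1 (hquad ν hν)).2
    have h2 := (abs_le.1 (hquad μ hμ)).1
    have h3 := hmax ν hν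
    linarith
  · have h1 : ∀ b, meanField A h μ ≤ meanField A h (sampledMean A h b (V b)) +
        4 * K * ∑ a, |μ a - sampledMean A h b (V b) a| := fun b => by
      linarith [meanField_sub_sampledMean_le hK hA hμ hs b (hV b) (h := h)]
    have h2 : ∀ b a, |μ a - sampledMean A h b (V b) a| ≤
        2 * |sampledField A b (μ ∘ b) a - ∑ c, A a c * μ c| + 2 * (K * γ) + 2 * (K / d) := by
      intro b a
      rw [hstat a, sampledMean]
      refine (abs_tanh_sub_tanh_le _ _).trans ?_
      have h3 : |sampledField A b (μ ∘ b) a - sampledField A b (V b) a| ≤ K * γ := by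
        refine abs_expect_sub_le.trans (expect_le_of_forall_le fun k => ?_)
        rw [← mul_sub, abs_mul]
        exact mul_le_mul (abs_mul_entry_le hA a (b k)) (hγ b k) (abs_nonneg _) hK
      have h4 : |A a a * μ a| ≤ K / d := by
        rw [abs_mul]
        calc |A a a| * |μ a| ≤ |A a a| * 1 := by gcongr; exact hμ a
          _ ≤ K / d := by rw [mul_one]; exact hA a a
      rw [hsplit]
      have h5 : h a + 2 * (∑ c, A a c * μ c - A a a * μ a) - (h a + 2 * sampledField A b (V b) a) =
          2 * (-(sampledField A b (μ ∘ b) a - ∑ c, A a c * μ c) +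
            (sampledField A b (μ ∘ b) a - sampledField A b (V b) a) - A a a * μ a) := by ring
      rw [h5, abs_mul, abs_two]
      have h6 := abs_sub (-(sampledField A b (μ ∘ b) a - ∑ c, A a c * μ c) +
            (sampledField A b (μ ∘ b) a - sampledField A b (V b) a)) (A a a * μ a)
      have h7 := abs_add_le (-(sampledField A b (μ ∘ b) a - ∑ c, A a c * μ c))
            (sampledField A b (μ ∘ b) a - sampledField A b (V b) a)
      rw [abs_neg] at h7
      linarith
    have h3 : 𝔼 b, ∑ a, |μ a - sampledMean A h b (V b) a| ≤
        d * (2 * (K / √s) + 2 * (K * γ) + 2 * (K / d)) := by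
      rw [expect_sum_comm]
      calc _ ≤ ∑ _a : Fin d, (2 * (K / √s) + 2 * (K * γ) + 2 * (K / d)) := by
            refine sum_le_sum fun a _ => (expect_mono' fun b => h2 b a).trans ?_
            rw [expect_add_distrib, expect_add_distrib, Fintype.expect_const,
              Fintype.expect_const, ← mul_expect]
            gcongr
            exact expect_abs_sampledField_sub_le hA hs hμ a
        _ = _ := by rw [sum_const, card_univ, Fintype.card_fin, nsmul_eq_mul]
    calc meanField A h μ ≤ 𝔼 b, (meanField A h (sampledMean A h b (V b)) +
          4 * K * ∑ a, |μ a - sampledMean A h b (V b) a|) := le_expect_of_forall_le h1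
      _ ≤ 𝔼 b, meanField A h (sampledMean A h b (V b)) +
          4 * K * (d * (2 * (K / √s) + 2 * (K * γ) + 2 * (K / d))) := by
          rw [expect_add_distrib, ← mul_expect]
          gcongr
      _ = _ := by field_simp; ring

end Maximizer

/-! ### Random induced submodels -/

section Sampling

variable {n q : ℕ}

/-- The interactions of the model induced on the sampled vertices. -/
noncomputable def subInteraction (J : Matrix (Fin n) (Fin n) ℝ) (S : Fin q → Fin n) :
    Matrix (Fin q) (Fin q) ℝ := fun a b => n / q * J (S a) (S b)

theorem subInteraction_isSymm {J : Matrix (Fin n) (Fin n) ℝ} (hJ : J.IsSymm) (S : Fin q → Fin n) :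
    (subInteraction J S).IsSymm :=
  Matrix.IsSymm.ext fun i j => by simp only [subInteraction, hJ.apply]

theorem abs_subInteraction_le {J : Matrix (Fin n) (Fin n) ℝ} {K : ℝ}
    (hJ : ∀ i j, |J i j| ≤ K / n) (S : Fin q → Fin n) (a b : Fin q) :
    |subInteraction J S a b| ≤ K / q := by
  have := abs_mul_entry_le hJ (S a) (S b)
  rw [subInteraction, div_mul_eq_mul_div, abs_div, Nat.abs_cast]
  gcongr

theorem meanField_div_eq (A : Matrix (Fin q) (Fin q) ℝ) (h μ : Fin q → ℝ) :
    meanField A h μ / q =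
      (𝔼 a, 𝔼 b, q * A a b * μ a * μ b) + 𝔼 a, (h a * μ a + ent (μ a)) := by
  rcases Nat.eq_zero_or_pos q with rfl | hq
  · simp
  have hq' : (0 : ℝ) < q := by exact_mod_cast hq
  simp only [Fintype.expect_eq_sum_div_card, Fintype.card_fin, ← sum_div]
  rw [meanField, quad, add_div, ← mul_right_inj' hq'.ne']
  simp only [mul_add, mul_assoc, ← mul_sum]
  field_simp

theorem meanField_subInteraction_div_eq (hn : 0 < n) (hq : 0 < q) (J : Matrix (Fin n) (Fin n) ℝ)
    (h μ : Fin n → ℝ) (S : Fin q → Fin n) :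
    meanField (subInteraction J S) (h ∘ S) (μ ∘ S) / q =
      (𝔼 a, 𝔼 b, n * J (S a) (S b) * μ (S a) * μ (S b)) +
        𝔼 a, (h (S a) * μ (S a) + ent (μ (S a))) := by
  have hq' : (q : ℝ) ≠ 0 := by exact_mod_cast hq.ne'
  rw [meanField_div_eq]
  congr 1
  refine expect_congr rfl fun a _ => expect_congr rfl fun b _ => ?_
  simp only [subInteraction, Function.comp]
  field_simp

/-- A bound for the sampling error of the mean-field functional. -/
noncomputable def sampErr (K M : ℝ) (q B : ℕ) : ℝ :=
  2 * K / √q + 2 * K * (2 * B + 1) / q + ((M + 1) / √q + 2 * (M + 1) * B / q)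

theorem sampErr_mono {K M : ℝ} (hK : 0 ≤ K) (hM : 0 ≤ M) (q : ℕ) {B B' : ℕ} (h : B ≤ B') :
    sampErr K M q B ≤ sampErr K M q B' := by
  unfold sampErr
  gcongr

theorem expect_abs_meanField_sub_le (hn : 0 < n) (hq : 0 < q) {J : Matrix (Fin n) (Fin n) ℝ}
    {K M : ℝ} (hJ : ∀ i j, |J i j| ≤ K / n) {h : Fin n → ℝ} (hh : ∀ i, |h i| ≤ M)
    {B : Finset (Fin q)} {μ : (Fin q → Fin n) → Fin n → ℝ} (hB : DependsOnEntries B μ)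
    (hμ : ∀ S i, |μ S i| ≤ 1) :
    𝔼 S : Fin q → Fin n, |meanField (subInteraction J S) (h ∘ S) (μ S ∘ S) / q -
      meanField J h (μ S) / n| ≤ sampErr K M q #B := by
  have : Nonempty (Fin n) := ⟨⟨0, hn⟩⟩
  have hM : 0 ≤ M := (abs_nonneg _).trans (hh ⟨0, hn⟩)
  have h1 := expect_abs_mean_pair_sub_le_of_dependsOn (ι := Fin n) hq (B := B)
    (k := fun S i j => n * J i j * μ S i * μ S j) (C := K)
    (by intro S S' hS; simp only [hB S S' hS])
    (fun S i j => by
      have := abs_mul_entry_mul_le hJ (hμ S i) i j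
      rw [abs_mul]
      nlinarith [hμ S j, abs_nonneg (μ S j), abs_nonneg (n * J i j * μ S i)])
  have h2 := expect_abs_mean_sub_le_of_dependsOn (ι := Fin n) hq (B := B)
    (f := fun S i => h i * μ S i + ent (μ S i)) (C := M + 1)
    (by intro S S' hS; simp only [hB S S' hS])
    (fun S i => by
      refine (abs_add_le _ _).trans (add_le_add ?_ (abs_ent_le (hμ S i)))
      rw [abs_mul]
      calc |h i| * |μ S i| ≤ M * 1 := by gcongr; exacts [hh i, hμ S i]
        _ = M := mul_one M)
  refine le_trans ?_ (add_le_add h1 h2)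
  rw [← expect_add_distrib]
  refine expect_mono' fun S => ?_
  rw [meanField_subInteraction_div_eq hn hq, meanField_div_eq, add_sub_add_comm]
  exact abs_add_le _ _

/-- The grid point `-1 + j / G`. -/
noncomputable def gridPoint {G : ℕ} (j : Fin (2 * G + 1)) : ℝ := (j : ℕ) / G - 1

theorem abs_gridPoint_le {G : ℕ} (j : Fin (2 * G + 1)) : |gridPoint j| ≤ 1 := by
  unfold gridPoint
  have h1 : ((j : ℕ) : ℝ) ≤ 2 * G := by exact_mod_cast Nat.lt_succ_iff.1 j.2
  have h2 : (0 : ℝ) ≤ ((j : ℕ) : ℝ) / G := by positivity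
  have h3 : ((j : ℕ) : ℝ) / G ≤ 2 := div_le_of_le_mul₀ (by positivity) (by norm_num) h1
  rw [abs_le]; constructor <;> linarith

theorem exists_gridPoint {G : ℕ} (hG : 0 < G) {x : ℝ} (hx : |x| ≤ 1) :
    ∃ j : Fin (2 * G + 1), |x - gridPoint j| ≤ 1 / G := by
  have hG' : (0 : ℝ) < G := by exact_mod_cast hG
  rw [abs_le] at hx
  have h0 : 0 ≤ (x + 1) * G := by nlinarith
  refine ⟨⟨⌊(x + 1) * G⌋₊, ?_⟩, ?_⟩
  · rw [Nat.lt_succ_iff]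
    refine Nat.floor_le_of_le ?_
    push_cast
    nlinarith
  · have h1 := Nat.floor_le h0
    have h2 := (Nat.lt_floor_add_one ((x + 1) * G)).le
    unfold gridPoint
    simp only
    have e : x - (⌊(x + 1) * G⌋₊ / (G : ℝ) - 1) = ((x + 1) * G - ⌊(x + 1) * G⌋₊) / G := by
      field_simp; ring
    rw [e, abs_of_nonneg (by apply div_nonneg <;> linarith)]
    gcongr
    linarith

theorem sampledMean_subInteraction (hq : 0 < q) (J : Matrix (Fin n) (Fin n) ℝ) (h : Fin n → ℝ)
    (S : Fin q → Fin n) {s : ℕ} (b : Fin s → Fin q) (v : Fin s → ℝ) :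
    sampledMean (subInteraction J S) (h ∘ S) b v = sampledMean J h (S ∘ b) v ∘ S := by
  have hq' : (q : ℝ) ≠ 0 := by exact_mod_cast hq.ne'
  funext a
  simp only [sampledMean, sampledField, subInteraction, Function.comp]
  congr 4
  funext k
  field_simp

/-- The free energy of a random induced submodel is at most the maximum of the mean-field
functional, up to a small error. -/
theorem expect_log_partitionFunction_le (hn : 0 < n) (hq : 0 < q)
    {J : Matrix (Fin n) (Fin n) ℝ} (hsymm : J.IsSymm) {K M : ℝ} (hK : 0 < K)
    (hJ : ∀ i j, |J i j| ≤ K / n) {h : Fin n → ℝ} (hh : ∀ i, |h i| ≤ M) {c : ℝ}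
    (hc : ∀ μ : Fin n → ℝ, (∀ i, |μ i| ≤ 1) → meanField J h μ ≤ c)
    {s G : ℕ} (hs : 0 < s) (hG : 0 < G) :
    𝔼 S : Fin q → Fin n,
        Real.log (IsingModel.partitionFunction (subInteraction J S) (h ∘ S)) / q ≤
      c / n + (2 * G + 1) ^ s * sampErr K M q s + 8 * K ^ 2 * (1 / √s + 1 / G + 1 / q) +
        4 * K / √s + (2 * K + (s + 1)) / q := by
  have hq' : (0 : ℝ) < q := by exact_mod_cast hq
  have : Nonempty (Fin n) := ⟨⟨0, hn⟩⟩
  have : Nonempty (Fin q) := ⟨⟨0, hq⟩⟩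
  have hM : 0 ≤ M := (abs_nonneg _).trans (hh ⟨0, hn⟩)
  set diff : (Fin q → Fin n) → (Fin s → Fin q) → (Fin s → Fin (2 * G + 1)) → ℝ := fun S b v =>
    |meanField (subInteraction J S) (h ∘ S) (sampledMean J h (S ∘ b) (gridPoint ∘ v) ∘ S) / q -
      meanField J h (sampledMean J h (S ∘ b) (gridPoint ∘ v)) / n| with hdiff
  have hdiff_le : ∀ b v, 𝔼 S, diff S b v ≤ sampErr K M q s := by
    intro b v
    have := expect_abs_meanField_sub_le hn hq hJ hh (B := univ.image b)
      (μ := fun S => sampledMean J h (S ∘ b) (gridPoint ∘ v))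
      (by
        intro S S' hS
        have : S ∘ b = S' ∘ b := funext fun k => hS _ (mem_image_of_mem _ (mem_univ k))
        simp only [this])
      (fun S i => (Real.abs_tanh_lt_one _).le)
    refine this.trans (sampErr_mono hK.le hM q ?_)
    exact card_image_le.trans (by simp)
  have hS : ∀ S : Fin q → Fin n,
      Real.log (IsingModel.partitionFunction (subInteraction J S) (h ∘ S)) / q ≤
        𝔼 b, ∑ v, diff S b v + (c / n + 8 * K ^ 2 * (1 / √s + 1 / G + 1 / q) +
          4 * K / √s + (2 * K + (s + 1)) / q) := by
    intro S
    have hA := abs_subInteraction_le hJ S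
    obtain ⟨μ, hμ, hmax, hlin⟩ := exists_meanField_le_expect_sampledMean
      (subInteraction_isSymm hsymm S) hK.le hq hA (h ∘ S) hs
    choose r hr using fun (b : Fin s → Fin q) (k : Fin s) => exists_gridPoint hG (hμ (b k))
    have h1 := log_partitionFunction_le hK hq hA hmax hs
    have h2 := hlin (1 / G) (fun b => gridPoint ∘ r b) (fun b k => abs_gridPoint_le _) hr
    have h3 : (𝔼 b, meanField (subInteraction J S) (h ∘ S)
        (sampledMean (subInteraction J S) (h ∘ S) b (gridPoint ∘ r b))) / q ≤
        𝔼 b, ∑ v, diff S b v + c / n := by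
      rw [expect_div]
      refine (expect_mono' (g := fun b => ∑ v, diff S b v + c / n) fun b => ?_).trans
        (by rw [expect_add_distrib, Fintype.expect_const])
      rw [sampledMean_subInteraction hq]
      have h4 : diff S b (r b) ≤ ∑ v, diff S b v :=
        single_le_sum (f := fun v => diff S b v) (fun v _ => abs_nonneg _) (mem_univ _)
      have h5 := le_abs_self (meanField (subInteraction J S) (h ∘ S)
        (sampledMean J h (S ∘ b) (gridPoint ∘ r b) ∘ S) / q -
          meanField J h (sampledMean J h (S ∘ b) (gridPoint ∘ r b)) / n)
      have h6 : meanField J h (sampledMean J h (S ∘ b) (gridPoint ∘ r b)) / n ≤ c / n := by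
        gcongr
        exact hc _ fun i => (Real.abs_tanh_lt_one _).le
      simp only [hdiff] at h4 ⊢
      linarith
    have h4 : Real.log (IsingModel.partitionFunction (subInteraction J S) (h ∘ S)) / q ≤
        ((𝔼 b, meanField (subInteraction J S) (h ∘ S)
        (sampledMean (subInteraction J S) (h ∘ S) b (gridPoint ∘ r b))) +
          8 * K ^ 2 * (q / √s + q * (1 / G) + 1) + 2 * K + 4 * K * q / √s + (s + 1)) / q := by
      gcongr
      linarith
    have h5 : ((𝔼 b, meanField (subInteraction J S) (h ∘ S)
        (sampledMean (subInteraction J S) (h ∘ S) b (gridPoint ∘ r b))) +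
          8 * K ^ 2 * (q / √s + q * (1 / G) + 1) + 2 * K + 4 * K * q / √s + (s + 1)) / q =
        (𝔼 b, meanField (subInteraction J S) (h ∘ S)
        (sampledMean (subInteraction J S) (h ∘ S) b (gridPoint ∘ r b))) / q +
          8 * K ^ 2 * (1 / √s + 1 / G + 1 / q) + 4 * K / √s + (2 * K + (s + 1)) / q := by
      field_simp
      ring
    linarith
  refine (expect_mono' hS).trans ?_
  rw [expect_add_distrib, Fintype.expect_const, expect_comm]
  have h6 : 𝔼 b, 𝔼 S, ∑ v, diff S b v ≤ (2 * G + 1) ^ s * sampErr K M q s := by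
    have : Nonempty (Fin s → Fin q) := inferInstance
    refine expect_le_of_forall_le fun b => ?_
    rw [expect_sum_comm]
    refine (sum_le_sum fun v _ => hdiff_le b v).trans (le_of_eq ?_)
    simp
  linarith

/-- A bound for the difference between the free energies per vertex of a model and of its random
induced submodels. -/
noncomputable def keyErr (K M : ℝ) (q s G : ℕ) : ℝ :=
  (2 * G + 1) ^ s * sampErr K M q s + 8 * K ^ 2 * (1 / √s + 1 / G + 1 / q) + 4 * K / √s +
    (3 * K + (s + 1)) / q

/-- The free energy per vertex of a model is close to the mean free energy per vertex of its random
induced submodels. -/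
theorem abs_expect_log_partitionFunction_sub_le (hq : 0 < q) (hqn : q ≤ n)
    {J : Matrix (Fin n) (Fin n) ℝ} (hsymm : J.IsSymm) {K M : ℝ} (hK : 0 < K)
    (hJ : ∀ i j, |J i j| ≤ K / n) {h : Fin n → ℝ} (hh : ∀ i, |h i| ≤ M)
    {s G : ℕ} (hs : 0 < s) (hG : 0 < G) :
    |𝔼 S : Fin q → Fin n,
        Real.log (IsingModel.partitionFunction (subInteraction J S) (h ∘ S)) / q -
      Real.log (IsingModel.partitionFunction J h) / n| ≤ keyErr K M q s G := by
  have hn : 0 < n := hq.trans_le hqn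
  have hq' : (0 : ℝ) < q := by exact_mod_cast hq
  have hn' : (0 : ℝ) < n := by exact_mod_cast hn
  have hqn' : (q : ℝ) ≤ n := by exact_mod_cast hqn
  have : Nonempty (Fin n) := ⟨⟨0, hn⟩⟩
  have hM : 0 ≤ M := (abs_nonneg _).trans (hh ⟨0, hn⟩)
  set F := 𝔼 S : Fin q → Fin n,
    Real.log (IsingModel.partitionFunction (subInteraction J S) (h ∘ S)) / q with hF
  have hKn : K / n ≤ K / q := by gcongr
  rw [abs_le]
  constructor
  · have h1 : ∀ μ : Fin n → ℝ, (∀ i, |μ i| ≤ 1) →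
        meanField J h μ ≤ (F + K / q + sampErr K M q s) * n := by
      intro μ hμ
      rw [← div_le_iff₀ hn']
      have h2 := expect_abs_meanField_sub_le hn hq hJ hh (B := ∅) (μ := fun _ => μ)
        (fun _ _ _ => rfl) (fun _ => hμ)
      have h3 : 𝔼 S : Fin q → Fin n, meanField (subInteraction J S) (h ∘ S) (μ ∘ S) / q ≤
          F + K / q := by
        rw [hF]
        refine (expect_mono' (g := fun S : Fin q → Fin n =>
          Real.log (IsingModel.partitionFunction (subInteraction J S) (h ∘ S)) / q + K / q)
          fun S => ?_).trans (by rw [expect_add_distrib, Fintype.expect_const])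
        rw [← add_div]
        gcongr
        exact meanField_le_log_partitionFunction hK.le (abs_subInteraction_le hJ S) _
          fun a => hμ (S a)
      have h4 : meanField J h μ / n - 𝔼 S : Fin q → Fin n,
          meanField (subInteraction J S) (h ∘ S) (μ ∘ S) / q ≤ sampErr K M q #(∅ : Finset (Fin q)) := by
        refine le_trans ?_ h2
        refine le_trans ?_ (abs_expect_sub_le (f := fun S : Fin q → Fin n =>
          meanField (subInteraction J S) (h ∘ S) (μ ∘ S) / q) (g := fun _ => meanField J h μ / n))
        rw [Fintype.expect_const, abs_sub_comm]
        exact le_abs_self _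
      have h5 := sampErr_mono hK.le hM q (Nat.zero_le s)
      rw [card_empty] at h4
      linarith
    have h2 := log_partitionFunction_le hK hn hJ h1 hs
    have h3 : Real.log (IsingModel.partitionFunction J h) / n ≤
        F + K / q + sampErr K M q s + 4 * K / √s + (s + 1) / n := by
      rw [div_le_iff₀ hn']
      refine h2.trans (le_of_eq ?_)
      field_simp
    have h4 : ((s : ℝ) + 1) / n ≤ (s + 1) / q := by gcongr
    have h5 : 0 ≤ sampErr K M q s := by unfold sampErr; positivity
    have h6 : sampErr K M q s ≤ (2 * G + 1) ^ s * sampErr K M q s := by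
      refine le_mul_of_one_le_left h5 (one_le_pow₀ ?_)
      have : (0 : ℝ) ≤ G := by positivity
      linarith
    have h7 : 0 ≤ 8 * K ^ 2 * (1 / √s + 1 / G + 1 / q) := by positivity
    have h8 : (3 * K + ((s : ℝ) + 1)) / q = 3 * (K / q) + (s + 1) / q := by field_simp
    have h9 : 0 ≤ K / q := by positivity
    unfold keyErr
    linarith
  · have h1 := expect_log_partitionFunction_le hn hq hsymm hK hJ hh
      (fun μ hμ => meanField_le_log_partitionFunction hK.le hJ h hμ) hs hG
    have h2 : (Real.log (IsingModel.partitionFunction J h) + K) / n ≤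
        Real.log (IsingModel.partitionFunction J h) / n + K / q := by
      rw [add_div]; linarith
    have h8 : (3 * K + ((s : ℝ) + 1)) / q = K / q + (2 * K + (s + 1)) / q := by
      field_simp; ring
    unfold keyErr
    linarith

end Sampling

/-! ### Magnetizations and free energies -/

section Magnetization

variable {d : ℕ}

/-- The free energy in the presence of an additional homogeneous field `u`. -/
noncomputable def freeEnergy (A : Matrix (Fin d) (Fin d) ℝ) (f : Fin d → ℝ) (u : ℝ) : ℝ :=
  Real.log (IsingModel.partitionFunction A fun i => f i + u)

/-- The magnetization in the presence of an additional homogeneous field `u`. -/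
noncomputable def mag (A : Matrix (Fin d) (Fin d) ℝ) (f : Fin d → ℝ) (u : ℝ) : ℝ :=
  IsingModel.magnetization A fun i => f i + u

theorem magnetization_eq (A : Matrix (Fin d) (Fin d) ℝ) (f : Fin d → ℝ) :
    IsingModel.magnetization A f = (∑ x, IsingModel.weight A f x * ∑ i, spin (x i)) /
      ∑ x, IsingModel.weight A f x := by
  unfold IsingModel.magnetization IsingModel.prob
  rw [sum_div]
  exact sum_congr rfl fun x _ => by rw [IsingModel.partitionFunction]; ring

theorem abs_sum_spin_le (x : Fin d → ℤˣ) : |∑ i, spin (x i)| ≤ d := by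
  refine (abs_sum_le_sum_abs _ _).trans ?_
  simp [abs_spin]

theorem sum_prob (A : Matrix (Fin d) (Fin d) ℝ) (f : Fin d → ℝ) :
    ∑ x, IsingModel.prob A f x = 1 := by
  unfold IsingModel.prob
  rw [← sum_div]
  exact div_self (partitionFunction_pos A f).ne'

theorem prob_nonneg (A : Matrix (Fin d) (Fin d) ℝ) (f : Fin d → ℝ) (x : Fin d → ℤˣ) :
    0 ≤ IsingModel.prob A f x :=
  div_nonneg (weight_pos A f x).le (partitionFunction_pos A f).le

theorem abs_magnetization_le (A : Matrix (Fin d) (Fin d) ℝ) (f : Fin d → ℝ) :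
    |IsingModel.magnetization A f| ≤ d := by
  unfold IsingModel.magnetization
  refine (abs_sum_le_sum_abs _ _).trans ?_
  calc _ ≤ ∑ x, IsingModel.prob A f x * d := by
        refine sum_le_sum fun x _ => ?_
        rw [abs_mul, abs_of_nonneg (prob_nonneg A f x)]
        exact mul_le_mul_of_nonneg_left (abs_sum_spin_le x) (prob_nonneg A f x)
    _ = d := by rw [← sum_mul, sum_prob, one_mul]

theorem weight_add (A : Matrix (Fin d) (Fin d) ℝ) (f g : Fin d → ℝ) (x : Fin d → ℤˣ) :
    IsingModel.weight A (fun i => f i + g i) x =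
      IsingModel.weight A f x * Real.exp (∑ i, g i * spin (x i)) := by
  rw [weight_eq, weight_eq, ← Real.exp_add]
  simp only [add_mul, sum_add_distrib]
  ring_nf

/-- The free energy is convex with the magnetization as its derivative. -/
theorem sub_mul_mag_le (A : Matrix (Fin d) (Fin d) ℝ) (f : Fin d → ℝ) (a b : ℝ) :
    (b - a) * mag A f a ≤ freeEnergy A f b - freeEnergy A f a := by
  set w := IsingModel.weight A fun i => f i + a
  set Z := IsingModel.partitionFunction A fun i => f i + a with hZ
  have hZpos : 0 < Z := partitionFunction_pos _ _
  set c := (b - a) * mag A f a with hc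
  have h1 : ∀ x : Fin d → ℤˣ, IsingModel.weight A (fun i => f i + b) x =
      w x * Real.exp ((b - a) * ∑ i, spin (x i)) := by
    intro x
    have := weight_add A (fun i => f i + a) (fun _ => b - a) x
    rw [← mul_sum] at this
    rw [← this]
    congr 1
    funext i; ring
  have h2 : Z * Real.exp c ≤ IsingModel.partitionFunction A fun i => f i + b := by
    have h3 : ∑ x, w x * (Real.exp c * (1 + ((b - a) * ∑ i, spin (x i) - c))) =
        Z * Real.exp c := by
      have h4 : ∑ x, w x * ∑ i, spin (x i) = mag A f a * Z := by
        rw [mag, magnetization_eq]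
        exact (div_mul_cancel₀ _ hZpos.ne').symm
      have h5 : ∀ x, w x * (Real.exp c * (1 + ((b - a) * ∑ i, spin (x i) - c))) =
          Real.exp c * (1 - c) * w x + Real.exp c * (b - a) * (w x * ∑ i, spin (x i)) :=
        fun x => by ring
      simp only [h5, sum_add_distrib, ← mul_sum, h4]
      rw [show ∑ x, w x = Z from rfl, hc]
      ring
    rw [← h3, IsingModel.partitionFunction]
    refine sum_le_sum fun x _ => ?_
    rw [h1]
    refine mul_le_mul_of_nonneg_left ?_ (weight_pos _ _ _).le
    rw [show (b - a) * ∑ i, spin (x i) = c + ((b - a) * ∑ i, spin (x i) - c) by ring, Real.exp_add]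
    gcongr
    linarith [Real.add_one_le_exp ((b - a) * ∑ i, spin (x i) - c)]
  unfold freeEnergy
  have := Real.log_le_log (by positivity) h2
  rw [Real.log_mul hZpos.ne' (Real.exp_pos _).ne', Real.log_exp] at this
  linarith

theorem continuous_mag (A : Matrix (Fin d) (Fin d) ℝ) (f : Fin d → ℝ) :
    Continuous (mag A f) := by
  unfold mag
  simp only [magnetization_eq]
  refine Continuous.div ?_ ?_ fun u => (partitionFunction_pos A fun i => f i + u).ne' <;>
  · unfold IsingModel.weight
    fun_prop

/-- The mean value theorem for the free energy. -/
theorem exists_mag_eq_slope (A : Matrix (Fin d) (Fin d) ℝ) (f : Fin d → ℝ) {t : ℝ}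
    (ht : 0 < t) :
    ∃ h₀, 0 ≤ h₀ ∧ h₀ ≤ t ∧ mag A f h₀ = (freeEnergy A f t - freeEnergy A f 0) / t := by
  have h1 := sub_mul_mag_le A f 0 t
  have h2 := sub_mul_mag_le A f t 0
  have h3 : (freeEnergy A f t - freeEnergy A f 0) / t ∈ Set.Icc (mag A f 0) (mag A f t) := by
    constructor
    · rw [le_div_iff₀ ht]; linarith
    · rw [div_le_iff₀ ht]; linarith
  obtain ⟨u, hu, he⟩ := intermediate_value_Icc ht.le (continuous_mag A f).continuousOn h3
  exact ⟨u, hu.1, hu.2, he⟩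

/-- Riemann sums of the magnetization approximate the slope of the free energy. -/
theorem abs_expect_mag_sub_slope_le (A : Matrix (Fin d) (Fin d) ℝ) (f : Fin d → ℝ) {t : ℝ}
    (ht : 0 < t) {n : ℕ} (hn : 0 < n) :
    |𝔼 v : Fin n, mag A f (t * v / n) - (freeEnergy A f t - freeEnergy A f 0) / t| ≤
      2 * d / n := by
  have hn' : (0 : ℝ) < n := by exact_mod_cast hn
  set m : ℕ → ℝ := fun v => mag A f (t * v / n) with hm
  have hstep : ∀ v : ℕ, t * ((v + 1 : ℕ) : ℝ) / n - t * v / n = t / n := by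
    intro v; push_cast; ring
  have htel := sum_range_sub (fun v : ℕ => freeEnergy A f (t * v / n)) n
  have e1 : t * (n : ℝ) / n = t := by field_simp
  simp only [e1, Nat.cast_zero, mul_zero, zero_div] at htel
  have hlow : t / n * ∑ v ∈ range n, m v ≤ freeEnergy A f t - freeEnergy A f 0 := by
    rw [← htel, mul_sum]
    refine sum_le_sum fun v _ => ?_
    rw [← hstep v]
    exact sub_mul_mag_le A f _ _
  have hup : freeEnergy A f t - freeEnergy A f 0 ≤ t / n * ∑ v ∈ range n, m (v + 1) := by
    rw [← htel, mul_sum]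
    refine sum_le_sum fun v _ => ?_
    have := sub_mul_mag_le A f (t * ((v + 1 : ℕ) : ℝ) / n) (t * v / n)
    rw [← hstep v]
    simp only [hm]
    linarith
  have hshift : ∑ v ∈ range n, m (v + 1) ≤ ∑ v ∈ range n, m v + 2 * d := by
    have h1 := sum_range_succ' m n
    have h2 := sum_range_succ m n
    have h3 := (abs_le.1 (abs_magnetization_le A fun i => f i + t * (n : ℕ) / n)).2
    have h4 := (abs_le.1 (abs_magnetization_le A fun i => f i + t * (0 : ℕ) / n)).1
    simp only [hm, mag] at *
    linarith
  have e2 : 𝔼 v : Fin n, mag A f (t * v / n) = (∑ v ∈ range n, m v) / n := by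
    rw [Fintype.expect_eq_sum_div_card, Fintype.card_fin, ← Fin.sum_univ_eq_sum_range]
  rw [e2]
  have h5 : (∑ v ∈ range n, m v) / n ≤ (freeEnergy A f t - freeEnergy A f 0) / t := by
    rw [le_div_iff₀ ht]
    refine le_trans (le_of_eq ?_) hlow
    ring
  have h6 : (freeEnergy A f t - freeEnergy A f 0) / t ≤
      (∑ v ∈ range n, m v) / n + 2 * d / n := by
    rw [div_le_iff₀ ht]
    calc _ ≤ t / n * ∑ v ∈ range n, m (v + 1) := hup
      _ ≤ t / n * (∑ v ∈ range n, m v + 2 * d) := by gcongr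
      _ = _ := by ring
  rw [abs_le]
  have : 0 ≤ 2 * (d : ℝ) / n := by positivity
  constructor <;> linarith

end Magnetization

/-! ### Reweighting -/

section Reweighting

/-- Multiplying the weights by factors in `[0, 1]` that are close to `1` on average changes the
mean of a bounded function by little. -/
theorem abs_reweighted_mean_sub_le {ι : Type*} [Fintype ι] {w ρ X : ι → ℝ} {θ D : ℝ}
    (hw : ∀ x, 0 ≤ w x) (hZ : 0 < ∑ x, w x) (hρ0 : ∀ x, 0 ≤ ρ x) (hρ1 : ∀ x, ρ x ≤ 1)
    (hθ : θ < 1) (hρ : (1 - θ) * ∑ x, w x ≤ ∑ x, w x * ρ x) (hX : ∀ x, |X x| ≤ D) :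
    |(∑ x, w x * ρ x * X x) / (∑ x, w x * ρ x) - (∑ x, w x * X x) / ∑ x, w x| ≤ 2 * D * θ := by
  set Z := ∑ x, w x with hZdef
  set Z' := ∑ x, w x * ρ x with hZ'
  have hZ'pos : 0 < Z' := lt_of_lt_of_le (mul_pos (by linarith) hZ) hρ
  have hne : Nonempty ι := by
    by_contra h
    rw [not_nonempty_iff] at h
    simp [hZdef] at hZ
  have hD : 0 ≤ D := (abs_nonneg _).trans (hX (Classical.arbitrary ι))
  have hle : Z' ≤ Z := sum_le_sum fun x _ => mul_le_of_le_one_right (hw x) (hρ1 x)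
  have h1 : |∑ x, w x * ρ x * X x| ≤ Z' * D := by
    rw [hZ', sum_mul]
    refine (abs_sum_le_sum_abs _ _).trans (sum_le_sum fun x _ => ?_)
    have := mul_nonneg (hw x) (hρ0 x)
    rw [abs_mul, abs_of_nonneg this]
    exact mul_le_mul_of_nonneg_left (hX x) this
  have h2 : |∑ x, w x * ρ x * X x - ∑ x, w x * X x| ≤ (Z - Z') * D := by
    rw [hZ', hZdef, ← sum_sub_distrib, ← sum_sub_distrib, sum_mul]
    refine (abs_sum_le_sum_abs _ _).trans (sum_le_sum fun x _ => ?_)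
    have e : w x * ρ x * X x - w x * X x = -((w x - w x * ρ x) * X x) := by ring
    have := sub_nonneg.2 (mul_le_of_le_one_right (hw x) (hρ1 x))
    rw [e, abs_neg, abs_mul, abs_of_nonneg this]
    exact mul_le_mul_of_nonneg_left (hX x) this
  have e : (∑ x, w x * ρ x * X x) / Z' - (∑ x, w x * X x) / Z =
      ((∑ x, w x * ρ x * X x) * ((Z - Z') / Z') +
        (∑ x, w x * ρ x * X x - ∑ x, w x * X x)) / Z := by
    field_simp
    ring
  rw [e, abs_div, abs_of_pos hZ, div_le_iff₀ hZ]
  refine (abs_add_le _ _).trans ?_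
  rw [abs_mul, abs_of_nonneg (div_nonneg (sub_nonneg.2 hle) hZ'pos.le)]
  have h3 : |∑ x, w x * ρ x * X x| * ((Z - Z') / Z') ≤ Z' * D * ((Z - Z') / Z') :=
    mul_le_mul_of_nonneg_right h1 (div_nonneg (sub_nonneg.2 hle) hZ'pos.le)
  have h4 : Z' * D * ((Z - Z') / Z') = D * (Z - Z') := by field_simp
  have h5 : D * (Z - Z') ≤ D * (θ * Z) := mul_le_mul_of_nonneg_left (by linarith) hD
  linarith

variable {d : ℕ}

theorem abs_energy_le {A : Matrix (Fin d) (Fin d) ℝ} {K M : ℝ}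
    (hA : ∀ i j, |A i j| ≤ K / d) {f : Fin d → ℝ} (hf : ∀ i, |f i| ≤ M) (x : Fin d → ℤˣ) :
    |quad A (fun i => spin (x i)) + ∑ i, f i * spin (x i)| ≤ d * (K + M) := by
  rcases Nat.eq_zero_or_pos d with rfl | hd
  · simp [quad]
  have hd' : (0 : ℝ) < d := by exact_mod_cast hd
  have h1 : |quad A fun i => spin (x i)| ≤ ∑ _i : Fin d, ∑ _j : Fin d, K / d := by
    refine (abs_sum_le_sum_abs _ _).trans (sum_le_sum fun i _ =>
      (abs_sum_le_sum_abs _ _).trans (sum_le_sum fun j _ => ?_))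
    rw [abs_mul, abs_mul, abs_spin, abs_spin, mul_one, mul_one]
    exact hA i j
  have h2 : |∑ i, f i * spin (x i)| ≤ ∑ _i : Fin d, M := by
    refine (abs_sum_le_sum_abs _ _).trans (sum_le_sum fun i _ => ?_)
    rw [abs_mul, abs_spin, mul_one]
    exact hf i
  refine (abs_add_le _ _).trans ((add_le_add h1 h2).trans (le_of_eq ?_))
  simp
  field_simp

theorem one_add_div_pow_le_exp {N : ℕ} {z : ℝ} (hz : |z| ≤ N / 2) :
    (1 + z / N) ^ N ≤ Real.exp z := by
  rcases Nat.eq_zero_or_pos N with rfl | hN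
  · have : z = 0 := by simpa using hz
    simp [this]
  have hN' : (0 : ℝ) < N := by exact_mod_cast hN
  have h1 : -(1 / 2) ≤ z / N := by
    rw [le_div_iff₀ hN']; linarith [(abs_le.1 hz).1]
  calc (1 + z / N) ^ N ≤ Real.exp (z / N) ^ N :=
        pow_le_pow_left₀ (by linarith) (by linarith [Real.add_one_le_exp (z / N)]) N
    _ = Real.exp z := by rw [← Real.exp_nat_mul]; congr 1; field_simp

theorem exp_mul_le_one_add_div_pow {N : ℕ} {z : ℝ} (hN : 0 < N) (hz : |z| ≤ N / 2) :
    Real.exp z * (1 - 2 * z ^ 2 / N) ≤ (1 + z / N) ^ N := by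
  have hN' : (0 : ℝ) < N := by exact_mod_cast hN
  have h1 : -(1 / 2) ≤ z / N := by
    rw [le_div_iff₀ hN']; linarith [(abs_le.1 hz).1]
  have h2 : z / N - 2 * (z / N) ^ 2 ≤ Real.log (1 + z / N) := by
    have h3 := Real.one_sub_inv_le_log_of_pos (show 0 < 1 + z / N by linarith)
    refine le_trans ?_ h3
    have h4 : 0 < 1 + z / N := by linarith
    have e : 1 - (1 + z / N)⁻¹ = (z / N) / (1 + z / N) := by
      rw [eq_div_iff h4.ne', sub_mul, inv_mul_cancel₀ h4.ne']; ring
    rw [e, le_div_iff₀ h4]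
    nlinarith [mul_nonneg (sq_nonneg (z / N)) (show 0 ≤ z / N + 1 / 2 by linarith)]
  calc Real.exp z * (1 - 2 * z ^ 2 / N) ≤ Real.exp z * Real.exp (-(2 * z ^ 2 / N)) := by
        gcongr; linarith [Real.add_one_le_exp (-(2 * z ^ 2 / N))]
    _ = Real.exp (N * (z / N - 2 * (z / N) ^ 2)) := by
        rw [← Real.exp_add]; congr 1; field_simp; ring
    _ ≤ Real.exp (N * Real.log (1 + z / N)) := by gcongr
    _ = (1 + z / N) ^ N := by
        rw [← Real.log_pow, Real.exp_log (pow_pos (by linarith) N)]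

/-- The magnetization with the exponential function replaced by `(1 + z / N) ^ N`. -/
noncomputable def approxMag (N : ℕ) (A : Matrix (Fin d) (Fin d) ℝ) (f : Fin d → ℝ) : ℝ :=
  (∑ x : Fin d → ℤˣ, (1 + (quad A (fun i => spin (x i)) + ∑ i, f i * spin (x i)) / N) ^ N *
      ∑ i, spin (x i)) /
    ∑ x : Fin d → ℤˣ, (1 + (quad A (fun i => spin (x i)) + ∑ i, f i * spin (x i)) / N) ^ N

theorem abs_approxMag_le {N : ℕ} (hN : Even N) (A : Matrix (Fin d) (Fin d) ℝ) (f : Fin d → ℝ) :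
    |approxMag N A f| ≤ d := by
  unfold approxMag
  set p : (Fin d → ℤˣ) → ℝ := fun x =>
    (1 + (quad A (fun i => spin (x i)) + ∑ i, f i * spin (x i)) / N) ^ N with hp
  have hp0 : ∀ x, 0 ≤ p x := fun x => hN.pow_nonneg _
  rw [abs_div, abs_of_nonneg (sum_nonneg fun x _ => hp0 x)]
  refine div_le_of_le_mul₀ (sum_nonneg fun x _ => hp0 x) (Nat.cast_nonneg d) ?_
  rw [mul_sum]
  refine (abs_sum_le_sum_abs _ _).trans (sum_le_sum fun x _ => ?_)
  rw [abs_mul, abs_of_nonneg (hp0 x), mul_comm]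
  exact mul_le_mul_of_nonneg_right (abs_sum_spin_le x) (hp0 x)

theorem abs_approxMag_sub_le {A : Matrix (Fin d) (Fin d) ℝ} {f : Fin d → ℝ} {N : ℕ}
    (hN : 0 < N) {L : ℝ} (hL : ∀ x : Fin d → ℤˣ,
      |quad A (fun i => spin (x i)) + ∑ i, f i * spin (x i)| ≤ L)
    (hLN : L ≤ N / 2) (hLN' : 2 * L ^ 2 < N) :
    |approxMag N A f - IsingModel.magnetization A f| ≤ 2 * d * (2 * L ^ 2 / N) := by
  have hN' : (0 : ℝ) < N := by exact_mod_cast hN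
  set E : (Fin d → ℤˣ) → ℝ := fun x => quad A (fun i => spin (x i)) + ∑ i, f i * spin (x i)
  set ρ : (Fin d → ℤˣ) → ℝ := fun x => (1 + E x / N) ^ N / Real.exp (E x) with hρ
  have hw : ∀ x, IsingModel.weight A f x * ρ x = (1 + E x / N) ^ N := by
    intro x
    rw [weight_eq, hρ]
    exact mul_div_cancel₀ _ (Real.exp_pos _).ne'
  have hEN : ∀ x, |E x| ≤ N / 2 := fun x => (hL x).trans hLN
  have hpos : ∀ x, 0 ≤ 1 + E x / N := fun x => by
    have : -(1 / 2) ≤ E x / N := by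
      rw [le_div_iff₀ hN']; linarith [(abs_le.1 (hEN x)).1]
    linarith
  have key := abs_reweighted_mean_sub_le (w := IsingModel.weight A f) (ρ := ρ)
    (X := fun x => ∑ i, spin (x i)) (θ := 2 * L ^ 2 / N) (D := d)
    (fun x => (weight_pos A f x).le) (partitionFunction_pos A f)
    (fun x => div_nonneg (pow_nonneg (hpos x) N) (Real.exp_pos _).le)
    (fun x => (div_le_one (Real.exp_pos _)).2 (one_add_div_pow_le_exp (hEN x)))
    ((div_lt_one hN').2 hLN')
    (by
      rw [mul_sum]
      refine sum_le_sum fun x _ => ?_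
      rw [hw]
      refine le_trans ?_ (exp_mul_le_one_add_div_pow hN (hEN x))
      rw [mul_comm, weight_eq]
      have h1 : E x ^ 2 ≤ L ^ 2 := sq_le_sq' (by linarith [(abs_le.1 (hL x)).1]) (abs_le.1 (hL x)).2
      gcongr)
    abs_sum_spin_le
  simp only [hw] at key
  rw [magnetization_eq]
  exact key

end Reweighting

/-! ### Truncating the external field -/

section Clip

variable {n : ℕ}

/-- The truncation of `x` to `[-M, M]`. -/
def clip (M x : ℝ) : ℝ := max (-M) (min M x)

theorem abs_clip_le {M : ℝ} (hM : 0 ≤ M) (x : ℝ) : |clip M x| ≤ M := by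
  rw [abs_le, clip]
  exact ⟨le_max_left _ _, max_le (by linarith) (min_le_left _ _)⟩

theorem clip_cases {M : ℝ} (hM : 0 ≤ M) (x : ℝ) :
    x - clip M x = 0 ∨ (0 < x - clip M x ∧ clip M x = M) ∨
      (x - clip M x < 0 ∧ clip M x = -M) := by
  unfold clip
  rcases le_total x M with h1 | h1
  · rcases le_total (-M) x with h2 | h2
    · left; rw [min_eq_right h1, max_eq_right h2, sub_self]
    · rw [min_eq_right h1, max_eq_left h2]
      rcases h2.eq_or_lt with h3 | h3
      · left; linarith
      · right; right; exact ⟨by linarith, rfl⟩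
  · rw [min_eq_left h1, max_eq_right (by linarith)]
    rcases h1.eq_or_lt with h3 | h3
    · left; linarith
    · right; left; exact ⟨by linarith, rfl⟩

theorem abs_sub_mul_spin_update (x : Fin n → ℤˣ) (i : Fin n) :
    ∑ k, |spin (Function.update x i (-x i) k) - spin (x k)| = 2 := by
  rw [sum_eq_single i]
  · simp only [Function.update_self, spin, Units.val_neg, Int.cast_neg]
    rcases spin_cases (x i) with h | h <;> simp only [spin] at h <;> rw [h] <;> norm_num
  · intro k _ hk; simp [hk]
  · simp

theorem sum_mul_spin_update (f : Fin n → ℝ) (x : Fin n → ℤˣ) (i : Fin n) :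
    ∑ k, f k * spin (Function.update x i (-x i) k) =
      ∑ k, f k * spin (x k) - 2 * (f i * spin (x i)) := by
  rw [eq_sub_iff_add_eq, ← eq_sub_iff_add_eq', ← sum_sub_distrib, sum_eq_single i]
  · simp only [Function.update_self, spin, Units.val_neg, Int.cast_neg]; ring
  · intro k _ hk; simp [hk]
  · simp

/-- The penalty for violating the excess fields `e` at the sites in `T`. -/
noncomputable def penalty (e : Fin n → ℝ) (T : Finset (Fin n)) (x : Fin n → ℤˣ) : ℝ :=
  Real.exp (∑ i ∈ T, (e i * spin (x i) - |e i|))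

theorem penalty_pos (e : Fin n → ℝ) (T : Finset (Fin n)) (x : Fin n → ℤˣ) :
    0 < penalty e T x := Real.exp_pos _

theorem mul_spin_sub_abs_nonpos (e : ℝ) (y : ℤˣ) : e * spin y - |e| ≤ 0 := by
  have h1 := neg_abs_le e
  have h2 := le_abs_self e
  rcases spin_cases y with h | h <;> rw [h] <;> linarith

theorem penalty_le_one (e : Fin n → ℝ) (T : Finset (Fin n)) (x : Fin n → ℤˣ) :
    penalty e T x ≤ 1 :=
  Real.exp_le_one_iff.2 (sum_nonpos fun _ _ => mul_spin_sub_abs_nonpos _ _)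

/-- Strong fields are violated rarely. -/
theorem pow_mul_sum_weight_le {J : Matrix (Fin n) (Fin n) ℝ} {K M : ℝ} (hK : 0 ≤ K)
    (hJ : ∀ i j, |J i j| ≤ K / n) {f e : Fin n → ℝ}
    (hpos : ∀ i, 0 < e i → M ≤ f i) (hneg : ∀ i, e i < 0 → f i ≤ -M)
    (hη : Real.exp (4 * K - 2 * M) ≤ 1) :
    (1 - Real.exp (4 * K - 2 * M)) ^ n * ∑ x, IsingModel.weight J f x ≤
      ∑ x, IsingModel.weight J f x * penalty e univ x := by
  set η := Real.exp (4 * K - 2 * M) with hηdef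
  have main : ∀ T : Finset (Fin n), (1 - η) ^ #T * ∑ x, IsingModel.weight J f x ≤
      ∑ x, IsingModel.weight J f x * penalty e T x := by
    intro T
    induction T using Finset.induction_on with
    | empty => simp [penalty]
    | insert i T hi ih =>
      set W : (Fin n → ℤˣ) → ℝ := fun x => IsingModel.weight J f x * penalty e T x with hW
      have hW0 : ∀ x, 0 < W x := fun x => mul_pos (weight_pos _ _ _) (penalty_pos _ _ _)
      have hins : ∀ x, IsingModel.weight J f x * penalty e (insert i T) x =
          W x * Real.exp (e i * spin (x i) - |e i|) := by
        intro x
        simp only [hW, penalty, sum_insert hi, Real.exp_add]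
        ring
      have hflip : ∀ x : Fin n → ℤˣ, W x * (1 - Real.exp (e i * spin (x i) - |e i|)) ≤
          η * W (Function.update x i (-x i)) := by
        intro x
        have hR : 0 ≤ η * W (Function.update x i (-x i)) :=
          mul_nonneg (Real.exp_pos _).le (hW0 _).le
        by_cases hx : e i * spin (x i) = |e i|
        · rw [hx, sub_self, Real.exp_zero, sub_self, mul_zero]; exact hR
        · have hfx : f i * spin (x i) ≤ -M := by
            rcases lt_trichotomy (e i) 0 with h | h | h
            · have h1 := hneg i h
              rcases spin_cases (x i) with h' | h'
              · rw [h', mul_one]; exact h1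
              · exact absurd (by rw [h', abs_of_neg h]; ring) hx
            · exact absurd (by rw [h]; simp) hx
            · have h1 := hpos i h
              rcases spin_cases (x i) with h' | h'
              · exact absurd (by rw [h', abs_of_pos h]; ring) hx
              · rw [h']; linarith
          have hpen : penalty e T (Function.update x i (-x i)) = penalty e T x := by
            unfold penalty
            congr 1
            refine sum_congr rfl fun k hk => ?_
            have : k ≠ i := fun h => hi (h ▸ hk)
            simp [this]
          have hwt : IsingModel.weight J f x ≤
              η * IsingModel.weight J f (Function.update x i (-x i)) := by
            rw [weight_eq, weight_eq, hηdef, ← Real.exp_add, Real.exp_le_exp,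
              sum_mul_spin_update]
            have h1 := abs_quad_sub_quad_le hK hJ
              (μ := fun k => spin (Function.update x i (-x i) k)) (ν := fun k => spin (x k))
              (fun k => (abs_spin _).le) (fun k => (abs_spin _).le)
            rw [abs_sub_mul_spin_update] at h1
            have h2 := (abs_le.1 h1).1
            linarith
          calc W x * (1 - Real.exp (e i * spin (x i) - |e i|)) ≤ W x * 1 := by
                refine mul_le_mul_of_nonneg_left ?_ (hW0 x).le
                linarith [Real.exp_pos (e i * spin (x i) - |e i|)]
            _ ≤ _ := by
                rw [mul_one]
                simp only [hW, hpen]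
                rw [← mul_assoc]
                exact mul_le_mul_of_nonneg_right hwt (penalty_pos _ _ _).le
      have hinv : Function.Involutive fun x : Fin n → ℤˣ => Function.update x i (-x i) := by
        intro x; simp
      have hsum : ∑ x : Fin n → ℤˣ, W (Function.update x i (-x i)) = ∑ x, W x :=
        Fintype.sum_equiv hinv.toPerm _ _ fun x => rfl
      have h1 : ∑ x, W x - ∑ x, W x * Real.exp (e i * spin (x i) - |e i|) ≤ η * ∑ x, W x := by
        rw [← hsum, mul_sum, hsum, ← sum_sub_distrib]
        refine sum_le_sum fun x _ => ?_
        have := hflip x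
        linarith
      rw [card_insert_of_notMem hi]
      simp only [hins]
      calc (1 - η) ^ (#T + 1) * ∑ x, IsingModel.weight J f x
          = (1 - η) * ((1 - η) ^ #T * ∑ x, IsingModel.weight J f x) := by ring
        _ ≤ (1 - η) * ∑ x, W x := by
            refine mul_le_mul_of_nonneg_left ih (by linarith)
        _ ≤ _ := by linarith
  simpa using main univ

variable {J : Matrix (Fin n) (Fin n) ℝ} {K M : ℝ}

theorem weight_eq_weight_clip (J : Matrix (Fin n) (Fin n) ℝ) (M : ℝ) (h : Fin n → ℝ) (u : ℝ)
    (x : Fin n → ℤˣ) :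
    IsingModel.weight J (fun i => h i + u) x =
      Real.exp (∑ i, |h i - clip M (h i)|) * (IsingModel.weight J (fun i => clip M (h i) + u) x *
        penalty (fun i => h i - clip M (h i)) univ x) := by
  have e : (fun i => h i + u) = fun i => (clip M (h i) + u) + (h i - clip M (h i)) := by
    funext i; ring
  rw [e, weight_add, penalty, sum_sub_distrib, Real.exp_sub]
  field_simp

theorem clip_pow_mul_le (hK : 0 ≤ K) (hM : 0 ≤ M) (hJ : ∀ i j, |J i j| ≤ K / n)
    (h : Fin n → ℝ) {u : ℝ} (hu : |u| ≤ 1) (hη : Real.exp (4 * K - 2 * (M - 1)) ≤ 1) :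
    (1 - Real.exp (4 * K - 2 * (M - 1))) ^ n *
        ∑ x, IsingModel.weight J (fun i => clip M (h i) + u) x ≤
      ∑ x, IsingModel.weight J (fun i => clip M (h i) + u) x *
        penalty (fun i => h i - clip M (h i)) univ x := by
  have hu' := abs_le.1 hu
  refine pow_mul_sum_weight_le hK hJ (fun i hi => ?_) (fun i hi => ?_) hη
  · rcases clip_cases hM (h i) with h1 | h1 | h1
    · linarith
    · linarith [h1.2]
    · linarith [h1.1]
  · rcases clip_cases hM (h i) with h1 | h1 | h1
    · linarith
    · linarith [h1.1]
    · linarith [h1.2]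

theorem abs_freeEnergy_sub_clip_le (hK : 0 ≤ K) (hM : 0 ≤ M) (hJ : ∀ i j, |J i j| ≤ K / n)
    (h : Fin n → ℝ) {u : ℝ} (hu : |u| ≤ 1) (hη : Real.exp (4 * K - 2 * (M - 1)) ≤ 1 / 2) :
    |freeEnergy J h u - freeEnergy J (fun i => clip M (h i)) u -
        (∑ i, |h i - clip M (h i)| - n * Real.exp (4 * K - 2 * (M - 1)))| ≤
      n * Real.exp (4 * K - 2 * (M - 1)) := by
  set η := Real.exp (4 * K - 2 * (M - 1)) with hηdef
  have hη0 : 0 < η := Real.exp_pos _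
  set w := IsingModel.weight J (fun i => clip M (h i) + u) with hw
  set Z := ∑ x, w x with hZ
  have hZpos : 0 < Z := partitionFunction_pos _ _
  set Z' := ∑ x, w x * penalty (fun i => h i - clip M (h i)) univ x with hZ'
  have h1 : (1 - η) ^ n * Z ≤ Z' := clip_pow_mul_le hK hM hJ h hu (by linarith)
  have h2 : Z' ≤ Z := sum_le_sum fun x _ =>
    mul_le_of_le_one_right (weight_pos _ _ _).le (penalty_le_one _ _ _)
  have hp : 0 < (1 - η) ^ n := pow_pos (by linarith) n
  have hZ'pos : 0 < Z' := lt_of_lt_of_le (mul_pos hp hZpos) h1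
  have h3 : freeEnergy J h u = ∑ i, |h i - clip M (h i)| + Real.log Z' := by
    unfold freeEnergy IsingModel.partitionFunction
    simp only [weight_eq_weight_clip J M h u]
    rw [← mul_sum, Real.log_mul (Real.exp_pos _).ne' hZ'pos.ne', Real.log_exp]
  have h4 : freeEnergy J (fun i => clip M (h i)) u = Real.log Z := rfl
  have h5 := Real.log_le_log hZ'pos h2
  have h6 := Real.log_le_log (mul_pos hp hZpos) h1
  rw [Real.log_mul hp.ne' hZpos.ne', Real.log_pow] at h6
  have h7 : -(2 * η) ≤ Real.log (1 - η) := by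
    have h8 : 0 < 1 - η := by linarith
    refine le_trans ?_ (Real.one_sub_inv_le_log_of_pos h8)
    have e : 1 - (1 - η)⁻¹ = -η / (1 - η) := by field_simp; ring
    rw [e, le_div_iff₀ h8]
    nlinarith
  have h8 : (n : ℝ) * -(2 * η) ≤ n * Real.log (1 - η) := by gcongr
  rw [h3, h4, abs_le]
  constructor <;> linarith

theorem abs_magnetization_sub_clip_le (hK : 0 ≤ K) (hM : 0 ≤ M) (hJ : ∀ i j, |J i j| ≤ K / n)
    (h : Fin n → ℝ) (hη : n * Real.exp (4 * K - 2 * (M - 1)) < 1) (hn : 0 < n) :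
    |IsingModel.magnetization J (fun i => clip M (h i)) - IsingModel.magnetization J h| ≤
      2 * n * (n * Real.exp (4 * K - 2 * (M - 1))) := by
  set η := Real.exp (4 * K - 2 * (M - 1)) with hηdef
  have hη0 : 0 < η := Real.exp_pos _
  have hn1 : (1 : ℝ) ≤ n := by exact_mod_cast hn
  have hη1 : η ≤ 1 := by nlinarith
  have h0 := clip_pow_mul_le hK hM hJ h (u := 0) (by simp) hη1
  simp only [add_zero] at h0
  have key := abs_reweighted_mean_sub_le (w := IsingModel.weight J fun i => clip M (h i))
    (ρ := penalty (fun i => h i - clip M (h i)) univ)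
    (X := fun x => ∑ i, spin (x i)) (θ := n * η) (D := n)
    (fun x => (weight_pos _ _ x).le) (partitionFunction_pos _ _)
    (fun x => (penalty_pos _ _ x).le) (fun x => penalty_le_one _ _ x) hη
    (by
      refine le_trans ?_ h0
      refine mul_le_mul_of_nonneg_right ?_ (partitionFunction_pos _ _).le
      have := one_add_mul_le_pow (show -2 ≤ -η by linarith) n
      rw [← sub_eq_add_neg] at this
      linarith) abs_sum_spin_le
  have e : IsingModel.magnetization J h =
      (∑ x, IsingModel.weight J (fun i => clip M (h i)) x *
        penalty (fun i => h i - clip M (h i)) univ x * ∑ i, spin (x i)) /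
      ∑ x, IsingModel.weight J (fun i => clip M (h i)) x *
        penalty (fun i => h i - clip M (h i)) univ x := by
    have hx := weight_eq_weight_clip J M h 0
    simp only [add_zero] at hx
    rw [magnetization_eq]
    simp only [hx]
    rw [← mul_sum]
    simp only [mul_assoc]
    rw [← mul_sum, mul_div_mul_left _ _ (Real.exp_pos _).ne']
  rw [abs_sub_comm, e, magnetization_eq]
  exact key

end Clip

/-! ### The bias of the estimator -/

section Bias

variable {n q : ℕ}

/-- The estimate of the magnetization per vertex from the sampled vertices `T`; the last one
determines the additional homogeneous field. -/
noncomputable def sampleEstimate (N : ℕ) (M t : ℝ) (J : Matrix (Fin n) (Fin n) ℝ)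
    (h : Fin n → ℝ) (T : Fin (q + 1) → Fin n) : ℝ :=
  approxMag N (subInteraction J fun a : Fin q => T a.castSucc)
    (fun a => clip M (h (T a.castSucc)) + t * (T (Fin.last q) : ℕ) / n) / q

theorem abs_sampleEstimate_le {N : ℕ} (hN : Even N) (M t : ℝ) (J : Matrix (Fin n) (Fin n) ℝ)
    (h : Fin n → ℝ) (T : Fin (q + 1) → Fin n) : |sampleEstimate N M t J h T| ≤ 1 := by
  unfold sampleEstimate
  rw [abs_div, Nat.abs_cast]
  exact div_le_one_of_le₀ (abs_approxMag_le hN _ _) (Nat.cast_nonneg q)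

theorem exists_abs_expect_sampleEstimate_sub_le (hq : 0 < q) (hqn : q ≤ n)
    {J : Matrix (Fin n) (Fin n) ℝ} (hsymm : J.IsSymm) {K M t : ℝ} (hK : 0 < K) (hM : 0 ≤ M)
    (ht : 0 < t) (ht1 : t ≤ 1) (hJ : ∀ i j, |J i j| ≤ K / n) (h : Fin n → ℝ)
    {s G N : ℕ} (hs : 0 < s) (hG : 0 < G) (hN : 0 < N)
    (hLN : q * (K + (M + 1)) ≤ N / 2) (hLN' : 2 * (q * (K + (M + 1))) ^ 2 < N)
    (hη : Real.exp (4 * K - 2 * (M - 1)) ≤ 1 / 2) :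
    ∃ h₀, 0 ≤ h₀ ∧ h₀ ≤ t ∧
      |𝔼 T : Fin (q + 1) → Fin n, sampleEstimate N M t J h T - mag J h h₀ / n| ≤
        2 * (2 * (q * (K + (M + 1))) ^ 2 / N) + 2 / n + 2 * keyErr K (M + 1) q s G / t +
          2 * Real.exp (4 * K - 2 * (M - 1)) / t := by
  have hn : 0 < n := hq.trans_le hqn
  have hq' : (0 : ℝ) < q := by exact_mod_cast hq
  have hn' : (0 : ℝ) < n := by exact_mod_cast hn
  have : Nonempty (Fin n) := ⟨⟨0, hn⟩⟩
  obtain ⟨h₀, h₀0, h₀t, hslope⟩ := exists_mag_eq_slope J h ht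
  refine ⟨h₀, h₀0, h₀t, ?_⟩
  set η := Real.exp (4 * K - 2 * (M - 1)) with hηdef
  set L : ℝ := q * (K + (M + 1)) with hL
  set cl : Fin n → ℝ := fun i => clip M (h i) with hcl
  set F : (Fin q → Fin n) → ℝ → ℝ := fun S u => freeEnergy (subInteraction J S) (cl ∘ S) u with hF
  have hE1 : ∀ (S : Fin q → Fin n) (v : Fin n),
      |sampleEstimate N M t J h (Fin.snoc S v : Fin (q + 1) → Fin n) -
        mag (subInteraction J S) (cl ∘ S) (t * v / n) / q| ≤ 2 * (2 * L ^ 2 / N) := by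
    intro S v
    simp only [sampleEstimate, Fin.snoc_castSucc, Fin.snoc_last]
    have hu : |t * v / n| ≤ 1 := by
      have h1 : ((v : ℕ) : ℝ) ≤ n := by exact_mod_cast v.2.le
      rw [abs_of_nonneg (by positivity), div_le_one hn']
      nlinarith [Nat.cast_nonneg (α := ℝ) (v : ℕ)]
    have h1 := abs_approxMag_sub_le (A := subInteraction J S)
      (f := fun a => cl (S a) + t * v / n) hN (L := L)
      (abs_energy_le (abs_subInteraction_le hJ S) fun a => (abs_add_le _ _).trans
        (add_le_add (abs_clip_le hM (h (S a))) hu)) hLN hLN'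
    rw [← sub_div, abs_div, Nat.abs_cast, div_le_iff₀ hq']
    refine h1.trans (le_of_eq (by ring))
  have hE2 : ∀ S : Fin q → Fin n,
      |𝔼 v : Fin n, mag (subInteraction J S) (cl ∘ S) (t * v / n) / q -
        (F S t - F S 0) / t / q| ≤ 2 / n := by
    intro S
    have h1 := abs_expect_mag_sub_slope_le (subInteraction J S) (cl ∘ S) ht hn
    rw [← expect_div, ← sub_div, abs_div, Nat.abs_cast, div_le_iff₀ hq']
    refine h1.trans (le_of_eq (by ring))
  have hE3 : ∀ u, |u| ≤ 1 → |𝔼 S, F S u / q - freeEnergy J cl u / n| ≤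
      keyErr K (M + 1) q s G := by
    intro u hu
    exact abs_expect_log_partitionFunction_sub_le hq hqn hsymm hK hJ (h := fun i => cl i + u)
      (fun i => (abs_add_le _ _).trans (add_le_add (abs_clip_le hM _) hu)) hs hG
  have ht' : |t| ≤ 1 := by rw [abs_of_pos ht]; exact ht1
  have hS : |𝔼 T : Fin (q + 1) → Fin n, sampleEstimate N M t J h T -
      𝔼 S, (F S t - F S 0) / t / q| ≤ 2 * (2 * L ^ 2 / N) + 2 / n := by
    rw [expect_fin_snoc]
    refine abs_expect_sub_le.trans (expect_le_of_forall_le fun S => ?_)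
    refine (abs_sub_le _ (𝔼 v : Fin n, mag (subInteraction J S) (cl ∘ S) (t * v / n) / q) _).trans
      (add_le_add ?_ (hE2 S))
    exact abs_expect_sub_le.trans (expect_le_of_forall_le (hE1 S))
  have e1 : 𝔼 S, (F S t - F S 0) / t / q = (𝔼 S, F S t / q - 𝔼 S, F S 0 / q) / t := by
    rw [← expect_sub_distrib, expect_div]
    exact expect_congr rfl fun S _ => by ring
  have h4 := abs_le.1 (hE3 t ht')
  have h5 := abs_le.1 (hE3 0 (by simp))
  have h6 := abs_le.1 (abs_freeEnergy_sub_clip_le hK.le hM hJ h ht' hη)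
  have h7 := abs_le.1 (abs_freeEnergy_sub_clip_le hK.le hM hJ h (u := 0) (by simp) hη)
  have e2 : mag J h h₀ / n = (freeEnergy J h t - freeEnergy J h 0) / n / t := by
    rw [hslope]; ring
  have h8 : |(freeEnergy J cl t - freeEnergy J cl 0) / n -
      (freeEnergy J h t - freeEnergy J h 0) / n| ≤ 2 * η := by
    rw [← sub_div, abs_div, Nat.abs_cast, div_le_iff₀ hn', abs_le]
    simp only [hcl]
    constructor <;> linarith [h6.1, h6.2, h7.1, h7.2]
  have h9 : |(𝔼 S, F S t / q - 𝔼 S, F S 0 / q) / t - mag J h h₀ / n| ≤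
      2 * keyErr K (M + 1) q s G / t + 2 * η / t := by
    rw [e2, ← sub_div, abs_div, abs_of_pos ht, ← add_div]
    gcongr
    have h10 := abs_le.1 h8
    rw [sub_div] at h10
    rw [abs_le]
    constructor <;> linarith [h4.1, h4.2, h5.1, h5.2, h10.1, h10.2]
  refine (abs_sub_le _ (𝔼 S, (F S t - F S 0) / t / q) _).trans ?_
  rw [e1] at hS ⊢
  linarith

/-- For a small model the estimate from all vertices is accurate. -/
theorem abs_approxMag_clip_sub_le (hn : 0 < n) {J : Matrix (Fin n) (Fin n) ℝ} {K M : ℝ}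
    (hK : 0 ≤ K) (hM : 0 ≤ M) (hJ : ∀ i j, |J i j| ≤ K / n) (h : Fin n → ℝ) {N : ℕ} (hN : 0 < N)
    (hLN : n * (K + M) ≤ N / 2) (hLN' : 2 * (n * (K + M)) ^ 2 < N)
    (hη : n * Real.exp (4 * K - 2 * (M - 1)) < 1) :
    |approxMag N J (fun i => clip M (h i)) - IsingModel.magnetization J h| ≤
      n * (2 * (2 * (n * (K + M)) ^ 2 / N) + 2 * (n * Real.exp (4 * K - 2 * (M - 1)))) := by
  have h1 := abs_approxMag_sub_le (A := J) (f := fun i => clip M (h i)) hN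
    (abs_energy_le hJ fun i => abs_clip_le hM (h i)) hLN hLN'
  have h2 := abs_magnetization_sub_clip_le hK hM hJ h hη hn
  refine (abs_sub_le _ _ _).trans ((add_le_add h1 h2).trans (le_of_eq (by ring)))

end Bias

/-! ### The choice of the parameters -/

section Parameters

/-- The mesh of the grid for the means, which is also the root of the number of sites from which
the means are reconstructed. -/
def gridSize (m : ℕ) : ℕ := 400 * m ^ 6

/-- The bound for the external field. -/
def fieldBound (m : ℕ) : ℕ := (2 * gridSize m + 1) ^ (gridSize m ^ 2 + 1)

/-- The number of vertices in a sample. -/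
def sampleSize (m : ℕ) : ℕ := fieldBound m ^ 4

/-- The precision of the approximation of the exponential function. -/
def expPrecision (m : ℕ) : ℕ := 2 * fieldBound m ^ 12

theorem even_expPrecision (m : ℕ) : Even (expPrecision m) := even_two_mul _

variable {m : ℕ}

theorem gridSize_ge (hm : 0 < m) : (400 : ℝ) * m ^ 6 = gridSize m ∧ 400 ≤ gridSize m := by
  refine ⟨by simp [gridSize], ?_⟩
  unfold gridSize
  have := Nat.one_le_pow 6 m hm
  omega

theorem sq_two_mul_gridSize_le (hm : 0 < m) : (2 * gridSize m + 1) ^ 2 ≤ fieldBound m := by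
  have h := (gridSize_ge hm).2
  unfold fieldBound
  refine Nat.pow_le_pow_right (by omega) ?_
  have : 1 ≤ gridSize m ^ 2 := Nat.one_le_pow _ _ (by omega)
  omega

theorem gridSize_le_fieldBound (hm : 0 < m) :
    gridSize m ≤ fieldBound m ∧ gridSize m ^ 2 ≤ fieldBound m ∧ 1000 ≤ fieldBound m := by
  have h := (gridSize_ge hm).2
  have h2 := sq_two_mul_gridSize_le hm
  refine ⟨?_, ?_, ?_⟩ <;> nlinarith

theorem coupling_le (hm : 0 < m) : 8 * (m : ℝ) ^ 2 + 2 ≤ gridSize m := by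
  have h1 : (1 : ℝ) ≤ m := by exact_mod_cast hm
  rw [← (gridSize_ge hm).1]
  have h2 : (m : ℝ) ^ 2 ≤ m ^ 6 := pow_le_pow_right₀ h1 (by norm_num)
  have h3 : (1 : ℝ) ≤ m ^ 6 := one_le_pow₀ h1
  linarith

theorem exp_penalty_le (hm : 0 < m) :
    (fieldBound m : ℝ) ^ 4 * Real.exp (4 * (2 * (m : ℝ) ^ 2) - 2 * (fieldBound m - 1)) ≤
      1 / fieldBound m := by
  have hg := gridSize_le_fieldBound hm
  have h1 : (gridSize m : ℝ) ≤ fieldBound m := by exact_mod_cast hg.1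
  have h400 : (1000 : ℝ) ≤ fieldBound m := by exact_mod_cast hg.2.2
  set g : ℝ := ((fieldBound m : ℕ) : ℝ) with hgdef
  have hgpos : 0 < g := by linarith
  have h2 := coupling_le hm
  have h3 : Real.exp (4 * (2 * (m : ℝ) ^ 2) - 2 * (g - 1)) ≤ Real.exp (-g) := by
    rw [Real.exp_le_exp]; linarith
  have h4 : g ^ 6 / (Nat.factorial 6 : ℝ) ≤ Real.exp g := Real.pow_div_factorial_le_exp g hgpos.le 6
  have h5 : ((Nat.factorial 6 : ℕ) : ℝ) = 720 := by norm_num [Nat.factorial]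
  rw [h5] at h4
  calc _ ≤ g ^ 4 * Real.exp (-g) := by gcongr
    _ ≤ 1 / g := by
      rw [Real.exp_neg, ← div_eq_mul_inv, div_le_div_iff₀ (Real.exp_pos _) hgpos, one_mul]
      refine le_trans ?_ h4
      rw [le_div_iff₀ (by norm_num)]
      have : (0 : ℝ) < g ^ 5 := by positivity
      nlinarith

theorem sampErr_le (hm : 0 < m) :
    ((2 * gridSize m + 1 : ℝ)) ^ (gridSize m ^ 2) *
      sampErr (2 * (m : ℝ) ^ 2) (fieldBound m + 1) (sampleSize m) (gridSize m ^ 2) ≤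
      4 / gridSize m := by
  have hg := gridSize_le_fieldBound hm
  have h1 : (gridSize m : ℝ) ≤ fieldBound m := by exact_mod_cast hg.1
  have h1' : ((gridSize m ^ 2 : ℕ) : ℝ) ≤ fieldBound m := by exact_mod_cast hg.2.1
  have h400 : (1000 : ℝ) ≤ fieldBound m := by exact_mod_cast hg.2.2
  have hG0 : (400 : ℝ) ≤ gridSize m := by exact_mod_cast (gridSize_ge hm).2
  have hdef : (fieldBound m : ℝ) =
      (2 * gridSize m + 1 : ℝ) ^ (gridSize m ^ 2) * (2 * gridSize m + 1) := by
    unfold fieldBound; push_cast; ring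
  have h2 := coupling_le hm
  set P : ℝ := (2 * gridSize m + 1 : ℝ) ^ (gridSize m ^ 2) with hP
  have hPpos : 0 < P := by positivity
  set K : ℝ := 2 * (m : ℝ) ^ 2 with hK
  have hK0 : 0 ≤ K := by positivity
  have hKg : K ≤ fieldBound m := by linarith
  set g : ℝ := ((fieldBound m : ℕ) : ℝ) with hgdef
  have hgpos : 0 < g := by linarith
  have hq : ((sampleSize m : ℕ) : ℝ) = g ^ 4 := by simp [sampleSize, hgdef]
  have hsq : √((sampleSize m : ℕ) : ℝ) = g ^ 2 := by
    rw [hq, show g ^ 4 = (g ^ 2) ^ 2 by ring]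
    exact Real.sqrt_sq (by positivity)
  have hE : sampErr K (g + 1) (sampleSize m) (gridSize m ^ 2) ≤ 8 / g := by
    unfold sampErr
    rw [hsq, hq]
    set s : ℝ := ((gridSize m ^ 2 : ℕ) : ℝ) with hs
    have hs0 : 0 ≤ s := Nat.cast_nonneg _
    have a1 : 2 * K / g ^ 2 ≤ 2 / g := by
      rw [div_le_div_iff₀ (by positivity) hgpos]; nlinarith
    have a2 : 2 * K * (2 * s + 1) / g ^ 4 ≤ 2 / g := by
      rw [div_le_div_iff₀ (by positivity) hgpos]
      have : K * (2 * s + 1) ≤ g * (3 * g) := by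
        apply mul_le_mul hKg (by linarith) (by positivity) hgpos.le
      have h3 : g * (3 * g) * g ≤ g ^ 4 := by nlinarith [pow_pos hgpos 3]
      nlinarith
    have a3 : (g + 1 + 1) / g ^ 2 ≤ 2 / g := by
      rw [div_le_div_iff₀ (by positivity) hgpos]; nlinarith
    have a4 : 2 * (g + 1 + 1) * s / g ^ 4 ≤ 2 / g := by
      rw [div_le_div_iff₀ (by positivity) hgpos]
      have : (g + 1 + 1) * s ≤ (2 * g) * g := by
        apply mul_le_mul (by linarith) h1' hs0 (by positivity)
      have h3 : 2 * g * g * g ≤ g ^ 4 := by nlinarith [pow_pos hgpos 3]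
      nlinarith
    have : (8 : ℝ) / g = 2 / g + 2 / g + (2 / g + 2 / g) := by ring
    linarith
  calc P * sampErr K (g + 1) (sampleSize m) (gridSize m ^ 2) ≤ P * (8 / g) := by gcongr
    _ = 8 / (2 * gridSize m + 1) := by rw [hdef]; field_simp
    _ ≤ 8 / (2 * gridSize m) := by gcongr; linarith
    _ = 4 / gridSize m := by field_simp; norm_num

theorem keyErr_le (hm : 0 < m) :
    keyErr (2 * (m : ℝ) ^ 2) (fieldBound m + 1) (sampleSize m) (gridSize m ^ 2) (gridSize m) ≤
      (80 * (m : ℝ) ^ 4 + 6) / gridSize m := by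
  have hg := gridSize_le_fieldBound hm
  have h1 : (gridSize m : ℝ) ≤ fieldBound m := by exact_mod_cast hg.1
  have h1' : ((gridSize m ^ 2 : ℕ) : ℝ) ≤ fieldBound m := by exact_mod_cast hg.2.1
  have h400 : (1000 : ℝ) ≤ fieldBound m := by exact_mod_cast hg.2.2
  have hG0 : (400 : ℝ) ≤ gridSize m := by exact_mod_cast (gridSize_ge hm).2
  have h2 := coupling_le hm
  have h3 := sampErr_le hm
  have hm1 : (1 : ℝ) ≤ m := by exact_mod_cast hm
  set K : ℝ := 2 * (m : ℝ) ^ 2 with hK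
  have hK1 : 1 ≤ K := by nlinarith
  set g : ℝ := ((fieldBound m : ℕ) : ℝ) with hgdef
  set G : ℝ := ((gridSize m : ℕ) : ℝ) with hGdef
  have hgpos : 0 < g := by linarith
  have hGpos : 0 < G := by linarith
  have hKg : K ≤ g := by linarith
  have hq : ((sampleSize m : ℕ) : ℝ) = g ^ 4 := by simp [sampleSize, hgdef]
  have hs : √((gridSize m ^ 2 : ℕ) : ℝ) = G := by
    push_cast; exact Real.sqrt_sq hGpos.le
  have hgG : 1 / g ≤ 1 / G := by gcongr
  have a1 : 8 * K ^ 2 * (1 / g ^ 4) ≤ 1 / g := by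
    rw [mul_one_div, div_le_div_iff₀ (by positivity) hgpos]
    have : K ^ 2 ≤ g ^ 2 := by gcongr
    have h4 : 8 * g ^ 2 * g ≤ g ^ 4 := by nlinarith [pow_pos hgpos 3]
    nlinarith
  have a2 : (3 * K + (((gridSize m ^ 2 : ℕ) : ℝ) + 1)) / g ^ 4 ≤ 1 / g := by
    rw [div_le_div_iff₀ (by positivity) hgpos]
    have h4 : 5 * g * g ≤ g ^ 4 := by
      have h5 : 5 ≤ g ^ 2 := by nlinarith
      have e : g ^ 4 = g ^ 2 * g ^ 2 := by ring
      nlinarith [sq_nonneg g]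
    have h5 : 3 * K + (((gridSize m ^ 2 : ℕ) : ℝ) + 1) ≤ 5 * g := by linarith
    calc _ ≤ 5 * g * g := mul_le_mul_of_nonneg_right h5 hgpos.le
      _ ≤ _ := by linarith
  have a3 : 8 * K ^ 2 * (1 / G + 1 / G) + 4 * K / G ≤ 80 * (m : ℝ) ^ 4 / G := by
    have e : 8 * K ^ 2 * (1 / G + 1 / G) + 4 * K / G = (16 * K ^ 2 + 4 * K) / G := by ring
    rw [e]
    gcongr
    have : 80 * (m : ℝ) ^ 4 = 20 * K ^ 2 := by rw [hK]; ring
    nlinarith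
  unfold keyErr
  rw [hs, hq]
  have e : (80 * (m : ℝ) ^ 4 + 6) / G = 80 * (m : ℝ) ^ 4 / G + 4 / G + 1 / G + 1 / G := by ring
  rw [e]
  have e2 : 8 * K ^ 2 * (1 / G + 1 / G + 1 / g ^ 4) =
      8 * K ^ 2 * (1 / G + 1 / G) + 8 * K ^ 2 * (1 / g ^ 4) := by ring
  rw [e2]
  linarith

theorem energy_precision (hm : 0 < m) {d : ℕ} (hd : d ≤ sampleSize m) {M : ℝ} (hM0 : 0 ≤ M)
    (hM : M ≤ fieldBound m + 1) :
    d * (2 * (m : ℝ) ^ 2 + M) ≤ (expPrecision m : ℕ) / 2 ∧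
      2 * (d * (2 * (m : ℝ) ^ 2 + M)) ^ 2 < (expPrecision m : ℕ) ∧
      2 * (2 * (d * (2 * (m : ℝ) ^ 2 + M)) ^ 2 / (expPrecision m : ℕ)) ≤ 1 / fieldBound m := by
  have hg := gridSize_le_fieldBound hm
  have h1 : (gridSize m : ℝ) ≤ fieldBound m := by exact_mod_cast hg.1
  have h400 : (1000 : ℝ) ≤ fieldBound m := by exact_mod_cast hg.2.2
  have h2 := coupling_le hm
  have hd' : (d : ℝ) ≤ fieldBound m ^ 4 := by
    have : d ≤ fieldBound m ^ 4 := hd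
    exact_mod_cast this
  have hN : ((expPrecision m : ℕ) : ℝ) = 2 * fieldBound m ^ 12 := by simp [expPrecision]
  rw [hN]
  set g : ℝ := ((fieldBound m : ℕ) : ℝ) with hgdef
  have hgpos : 0 < g := by linarith
  have hL : d * (2 * (m : ℝ) ^ 2 + M) ≤ 3 * g ^ 5 := by
    calc d * (2 * (m : ℝ) ^ 2 + M) ≤ g ^ 4 * (3 * g) := by
          apply mul_le_mul hd' (by linarith) (by positivity) (by positivity)
      _ = 3 * g ^ 5 := by ring
  have hL0 : 0 ≤ d * (2 * (m : ℝ) ^ 2 + M) := by positivity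
  have hL2 : (d * (2 * (m : ℝ) ^ 2 + M)) ^ 2 ≤ 9 * g ^ 10 := by
    calc _ ≤ (3 * g ^ 5) ^ 2 := by gcongr
      _ = 9 * g ^ 10 := by ring
  have hp10 : 0 < g ^ 10 := by positivity
  have hg2 : 160000 ≤ g ^ 2 := by nlinarith
  have e12 : g ^ 12 = g ^ 10 * g ^ 2 := by ring
  refine ⟨?_, ?_, ?_⟩
  · have : 3 * g ^ 5 ≤ g ^ 12 := by
      have e : g ^ 12 = g ^ 5 * g ^ 7 := by ring
      have h7 : 3 ≤ g ^ 7 := by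
        have : (1 : ℝ) ≤ g ^ 5 := one_le_pow₀ (by linarith)
        have e7 : g ^ 7 = g ^ 5 * g ^ 2 := by ring
        nlinarith
      have h5 : 0 < g ^ 5 := by positivity
      nlinarith
    linarith
  · nlinarith
  · rw [← mul_div_assoc, div_le_div_iff₀ (by positivity) hgpos]
    have : g ^ 10 * g * 36 ≤ 2 * g ^ 12 := by
      rw [e12]
      have : g * 36 ≤ 2 * g ^ 2 := by nlinarith
      nlinarith
    nlinarith

/-- The bias of the estimator is small when the model is larger than the sample. -/
theorem exists_abs_expect_sampleEstimate_sub_le' (hm : 0 < m) {n : ℕ} (hn : sampleSize m ≤ n)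
    {J : Matrix (Fin n) (Fin n) ℝ} (hsymm : J.IsSymm)
    (hJ : ∀ i j, |J i j| ≤ 2 * (m : ℝ) ^ 2 / n) (h : Fin n → ℝ) :
    ∃ h₀ : ℝ, 0 ≤ h₀ ∧ h₀ ≤ 1 / m ∧
      |𝔼 T : Fin (sampleSize m + 1) → Fin n,
          sampleEstimate (expPrecision m) (fieldBound m) (1 / m) J h T - mag J h h₀ / n| ≤
        1 / (2 * m) := by
  have hg := gridSize_le_fieldBound hm
  have h1 : (gridSize m : ℝ) ≤ fieldBound m := by exact_mod_cast hg.1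
  have h400 : (1000 : ℝ) ≤ fieldBound m := by exact_mod_cast hg.2.2
  have hG0 : (400 : ℝ) ≤ gridSize m := by exact_mod_cast (gridSize_ge hm).2
  have hm1 : (1 : ℝ) ≤ m := by exact_mod_cast hm
  have hq : 0 < sampleSize m := pow_pos (by omega) 4
  have hpen := exp_penalty_le hm
  have hkey := keyErr_le hm
  have hGm := (gridSize_ge hm).1
  obtain ⟨p1, p2, p3⟩ := energy_precision hm le_rfl (M := fieldBound m + 1) (by positivity) le_rfl
  set g : ℝ := ((fieldBound m : ℕ) : ℝ) with hgdef
  set G : ℝ := ((gridSize m : ℕ) : ℝ) with hGdef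
  have hgpos : 0 < g := by linarith
  have hGpos : 0 < G := by linarith
  have hgG : 1 / g ≤ 1 / G := by gcongr
  set η := Real.exp (4 * (2 * (m : ℝ) ^ 2) - 2 * (g - 1)) with hη
  have hη0 : 0 < η := Real.exp_pos _
  have hη1 : η ≤ 1 / g := by
    refine le_trans ?_ hpen
    have : (1 : ℝ) ≤ g ^ 4 := one_le_pow₀ (by linarith)
    nlinarith
  have hη2 : η ≤ 1 / 2 := by
    refine hη1.trans ?_
    gcongr; linarith
  obtain ⟨h₀, h₀0, h₀1, hb⟩ := exists_abs_expect_sampleEstimate_sub_le hq hn hsymm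
    (K := 2 * (m : ℝ) ^ 2) (M := g) (t := 1 / m) (by positivity) hgpos.le (by positivity)
    (by rw [div_le_one (by positivity)]; exact hm1) hJ h (s := gridSize m ^ 2) (G := gridSize m)
    (N := expPrecision m) (pow_pos (by have := (gridSize_ge hm).2; omega) 2)
    (by have := (gridSize_ge hm).2; omega)
    (by unfold expPrecision; have : 0 < fieldBound m := by omega
        positivity) p1 p2 hη2
  refine ⟨h₀, h₀0, h₀1, hb.trans ?_⟩
  have hn1 : 2 / (n : ℝ) ≤ 2 / G := by
    have : (fieldBound m : ℝ) ≤ n := by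
      have h2 : fieldBound m ≤ n := le_trans (Nat.le_self_pow (by norm_num) _) hn
      exact_mod_cast h2
    gcongr
    linarith
  have e1 : 2 * keyErr (2 * (m : ℝ) ^ 2) (g + 1) (sampleSize m) (gridSize m ^ 2) (gridSize m) /
      (1 / (m : ℝ)) ≤ 2 * m * ((80 * (m : ℝ) ^ 4 + 6) / G) := by
    rw [div_div_eq_mul_div, div_one, mul_right_comm]
    gcongr
  have e2 : 2 * η / (1 / (m : ℝ)) ≤ 2 * m * (1 / G) := by
    rw [div_div_eq_mul_div, div_one, mul_right_comm]
    gcongr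
    linarith
  have e3 : 1 / G + 2 / G + 2 * m * ((80 * (m : ℝ) ^ 4 + 6) / G) + 2 * m * (1 / G) ≤
      1 / (2 * m) := by
    have e : 1 / G + 2 / G + 2 * m * ((80 * (m : ℝ) ^ 4 + 6) / G) + 2 * m * (1 / G) =
        (3 + 160 * (m : ℝ) ^ 5 + 14 * m) / G := by ring
    rw [e, div_le_div_iff₀ hGpos (by positivity), ← hGm]
    have b1 : (m : ℝ) ≤ m ^ 6 := by
      calc (m : ℝ) = m ^ 1 := (pow_one _).symm
        _ ≤ m ^ 6 := pow_le_pow_right₀ hm1 (by norm_num)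
    have b2 : (m : ℝ) ^ 2 ≤ m ^ 6 := pow_le_pow_right₀ hm1 (by norm_num)
    nlinarith
  linarith

/-- For a small model the estimate from all vertices is accurate. -/
theorem abs_approxMag_clip_sub_le' (hm : 0 < m) {n : ℕ} (hn0 : 0 < n) (hn : n ≤ sampleSize m)
    {J : Matrix (Fin n) (Fin n) ℝ} (hJ : ∀ i j, |J i j| ≤ 2 * (m : ℝ) ^ 2 / n) (h : Fin n → ℝ) :
    |approxMag (expPrecision m) J (fun i => clip (fieldBound m) (h i)) -
      IsingModel.magnetization J h| ≤ n * (1 / m) := by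
  have hg := gridSize_le_fieldBound hm
  have h1 : (gridSize m : ℝ) ≤ fieldBound m := by exact_mod_cast hg.1
  have h400 : (1000 : ℝ) ≤ fieldBound m := by exact_mod_cast hg.2.2
  have hm1 : (1 : ℝ) ≤ m := by exact_mod_cast hm
  have hpen := exp_penalty_le hm
  have hGm := (gridSize_ge hm).1
  obtain ⟨p1, p2, p3⟩ := energy_precision hm hn (M := fieldBound m) (by positivity) (by linarith)
  have hn' : (n : ℝ) ≤ fieldBound m ^ 4 := by
    have : n ≤ fieldBound m ^ 4 := hn
    exact_mod_cast this
  set g : ℝ := ((fieldBound m : ℕ) : ℝ) with hgdef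
  have hgpos : 0 < g := by linarith
  set η := Real.exp (4 * (2 * (m : ℝ) ^ 2) - 2 * (g - 1)) with hη
  have hη0 : 0 < η := Real.exp_pos _
  have hη1 : n * η ≤ 1 / g := le_trans (by gcongr) hpen
  have hη2 : n * η < 1 := by
    refine lt_of_le_of_lt hη1 ?_
    rw [div_lt_one hgpos]; linarith
  refine (abs_approxMag_clip_sub_le hn0 (by positivity) hgpos.le hJ h
    (by unfold expPrecision; have : 0 < fieldBound m := by omega
        positivity) p1 p2 hη2).trans ?_
  gcongr
  have h3 : 3 * (1 / g) ≤ 1 / m := by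
    rw [mul_one_div, div_le_div_iff₀ hgpos (by positivity)]
    have : (m : ℝ) ≤ m ^ 6 := by
      calc (m : ℝ) = m ^ 1 := (pow_one _).symm
        _ ≤ m ^ 6 := pow_le_pow_right₀ hm1 (by norm_num)
    linarith
  linarith

end Parameters

/-! ### Concentration of the mean of independent estimates -/

section Concentration

open MeasureTheory ProbabilityTheory

variable {n : ℕ} [NeZero n] {q : ℕ}

/-- The law of a tuple of independent uniformly random vertices. -/
noncomputable def tupleLaw (n q : ℕ) [NeZero n] : Measure (Fin q → Fin n) :=
  Measure.infinitePi fun _ : Fin q => (PMF.uniformOfFintype (Fin n)).toMeasure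

instance : IsProbabilityMeasure (tupleLaw n q) := by
  unfold tupleLaw; infer_instance

/-- The consecutive blocks of length `q` of a sequence of vertices. -/
def blocks (q : ℕ) (ω : ℕ → Fin n) : ℕ → Fin q → Fin n := fun r a => ω (r * q + a)

theorem map_blocks_vertexLaw :
    (RealRAM.vertexLaw n).map (blocks q) = Measure.infinitePi fun _ : ℕ => tupleLaw n q := by
  have hinj : Function.Injective fun p : ℕ × Fin q => p.1 * q + p.2 := by
    rintro ⟨r, a⟩ ⟨r', a'⟩ h
    have hq : 0 < q := a.pos
    simp only at h
    have h1 : r = r' := by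
      have := congrArg (· / q) h
      simpa [Nat.mul_add_div, Nat.div_eq_of_lt a.2, Nat.div_eq_of_lt a'.2,
        mul_comm _ q, hq] using this
    subst h1
    simp only [Prod.mk.injEq, true_and]
    exact Fin.ext (by omega)
  have h1 := Measure.map_infinitePi_infinitePi_of_inj
    (P := fun _ : ℕ => (PMF.uniformOfFintype (Fin n)).toMeasure) hinj
  have h2 := Measure.infinitePi_map_curry (ι := ℕ) (κ := Fin q) (X := Fin n)
    (fun _ _ => (PMF.uniformOfFintype (Fin n)).toMeasure)
  unfold tupleLaw RealRAM.vertexLaw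
  rw [← h2, ← h1, Measure.map_map (by fun_prop) (by fun_prop)]
  rfl

theorem integral_tupleLaw (y : (Fin q → Fin n) → ℝ) : ∫ T, y T ∂tupleLaw n q = 𝔼 T, y T := by
  rw [integral_fintype (Integrable.of_finite)]
  have h : ∀ T : Fin q → Fin n, (tupleLaw n q).real {T} = ((n : ℝ) ^ q)⁻¹ := by
    intro T
    rw [tupleLaw, Measure.infinitePi_eq_pi, measureReal_def, Measure.pi_singleton]
    simp [PMF.uniformOfFintype_apply]
  simp only [h, smul_eq_mul, ← mul_sum]
  rw [Fintype.expect_eq_sum_div_card]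
  simp
  ring

theorem measure_abs_mean_blocks_sub_le {y : (Fin q → Fin n) → ℝ} (hy : ∀ T, |y T| ≤ 1)
    {R : ℕ} (hR : 0 < R) {τ : ℝ} (hτ : 0 ≤ τ) :
    ENNReal.ofReal (1 - 2 * Real.exp (-(R * τ ^ 2 / 2))) ≤ RealRAM.vertexLaw n
      {ω | |(∑ r ∈ range R, y (blocks q ω r)) / R - 𝔼 T, y T| ≤ τ} := by
  have hR' : (0 : ℝ) < R := by exact_mod_cast hR
  set P : Measure (ℕ → Fin q → Fin n) := Measure.infinitePi fun _ : ℕ => tupleLaw n q with hP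
  have hmy : Measurable y := measurable_of_finite y
  have hmb : Measurable (blocks q : (ℕ → Fin n) → ℕ → Fin q → Fin n) := by
    unfold blocks; fun_prop
  set S : Set (ℕ → Fin q → Fin n) :=
    {B | |(∑ r ∈ range R, y (B r)) / R - 𝔼 T, y T| ≤ τ} with hS
  have hmS : MeasurableSet S := by
    refine measurableSet_le ?_ measurable_const
    exact ((Measurable.div_const (Finset.measurable_sum _ fun r _ =>
      hmy.comp (measurable_pi_apply r)) _).sub_const _).abs
  have e : RealRAM.vertexLaw n {ω | |(∑ r ∈ range R, y (blocks q ω r)) / R - 𝔼 T, y T| ≤ τ} =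
      P S := by
    rw [hP, ← map_blocks_vertexLaw, Measure.map_apply hmb hmS]
    rfl
  rw [e]
  have tail : ∀ z : (Fin q → Fin n) → ℝ, (∀ T, |z T| ≤ 1) →
      P.real {B | R * τ ≤ ∑ r ∈ range R, (z (B r) - 𝔼 T, z T)} ≤ Real.exp (-(R * τ ^ 2 / 2)) := by
    intro z hz
    have hmz : Measurable z := measurable_of_finite z
    have hind : iIndepFun (fun (r : ℕ) (B : ℕ → Fin q → Fin n) => z (B r) - 𝔼 T, z T) P :=
      iIndepFun_infinitePi (X := fun _ T => z T - 𝔼 T, z T) fun _ => hmz.sub_const _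
    have hint : ∀ r, ∫ B, z (B r) ∂P = 𝔼 T, z T := by
      intro r
      rw [← integral_tupleLaw, ← Measure.infinitePi_map_eval (fun _ : ℕ => tupleLaw n q) r,
        integral_map (measurable_pi_apply r).aemeasurable hmz.aestronglyMeasurable]
    have hsub : ∀ r < R, HasSubgaussianMGF
        (fun B : ℕ → Fin q → Fin n => z (B r) - 𝔼 T, z T) 1 P := by
      intro r _
      have := hasSubgaussianMGF_of_mem_Icc (μ := P) (X := fun B : ℕ → Fin q → Fin n => z (B r))
        (a := -1) (b := 1) (hmz.comp (measurable_pi_apply r)).aemeasurable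
        (Filter.Eventually.of_forall fun B => abs_le.1 (hz (B r)))
      rw [hint] at this
      convert this using 1
      ext
      norm_num
    have := HasSubgaussianMGF.measure_sum_range_ge_le_of_iIndepFun hind hsub
      (ε := R * τ) (by positivity)
    refine this.trans (le_of_eq ?_)
    congr 1
    simp only [NNReal.coe_one]
    field_simp
  have h1 := tail y hy
  have h2 := tail (fun T => -y T) (fun T => by rw [abs_neg]; exact hy T)
  have hcompl : Sᶜ ⊆ {B | R * τ ≤ ∑ r ∈ range R, (y (B r) - 𝔼 T, y T)} ∪
      {B | R * τ ≤ ∑ r ∈ range R, (-y (B r) - 𝔼 T, -y T)} := by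
    intro B hB
    have hB' : τ < |(∑ r ∈ range R, y (B r)) / R - 𝔼 T, y T| := not_le.1 hB
    simp only [Set.mem_union, Set.mem_ofPred_eq, expect_neg_distrib, sum_sub_distrib,
      sum_neg_distrib, sum_const, card_range, nsmul_eq_mul]
    set A := ∑ r ∈ range R, y (B r) with hA
    have hAR : A = R * (A / R) := by field_simp
    rcases lt_abs.1 hB' with h | h
    · left; rw [hAR]; nlinarith
    · right; rw [hAR]; nlinarith
  have h3 : P.real Sᶜ ≤ 2 * Real.exp (-(R * τ ^ 2 / 2)) := by
    refine (measureReal_mono hcompl).trans ((measureReal_union_le _ _).trans ?_)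
    linarith
  rw [ENNReal.ofReal_le_iff_le_toReal (measure_ne_top _ _)]
  have h4 := probReal_add_probReal_compl (μ := P) hmS
  change _ ≤ P.real S
  linarith

end Concentration

/-! ### Reasoning about programs -/

section Logic

open RealRAM Function

variable {n : ℕ} {J : Matrix (Fin n) (Fin n) ℝ} {h : Fin n → ℝ} {ω : ℕ → Fin n}

/-- The program `p` started in `s` halts within time `B` in a state that satisfies `Q`. -/
def Runs (J : Matrix (Fin n) (Fin n) ℝ) (h : Fin n → ℝ) (ω : ℕ → Fin n) (p : Prog) (s : State)
    (B : ℕ) (Q : State → Prop) : Prop :=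
  ∃ t s', Exec J h ω p s t s' ∧ t ≤ B ∧ Q s'

theorem Runs.mono {p : Prog} {s : State} {B B' : ℕ} {Q Q' : State → Prop}
    (hr : Runs J h ω p s B Q) (hB : B ≤ B') (hQ : ∀ s', Q s' → Q' s') :
    Runs J h ω p s B' Q' := by
  obtain ⟨t, s', he, ht, hq⟩ := hr
  exact ⟨t, s', he, ht.trans hB, hQ s' hq⟩

theorem Runs.setNat {a e : NatExp} {s : State} {B : ℕ} {Q : State → Prop}
    (hB : a.time + e.time + 1 ≤ B)
    (hQ : Q ⟨update s.nat (a.eval s) (e.eval s), s.real, s.drawn⟩) :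
    Runs J h ω (.setNat a e) s B Q :=
  ⟨_, _, .setNat a e s, hB, hQ⟩

theorem Runs.setReal {a : NatExp} {e : RealExp} {s : State} {B : ℕ} {Q : State → Prop}
    (hB : a.time + e.time + 1 ≤ B)
    (hQ : Q ⟨s.nat, update s.real (a.eval s) (e.eval J h s), s.drawn⟩) :
    Runs J h ω (.setReal a e) s B Q :=
  ⟨_, _, .setReal a e s, hB, hQ⟩

theorem Runs.sample {a : NatExp} {s : State} {B : ℕ} {Q : State → Prop}
    (hB : a.time + 1 ≤ B)
    (hQ : Q ⟨update s.nat (a.eval s) (ω s.drawn : ℕ), s.real, s.drawn + 1⟩) :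
    Runs J h ω (.sample a) s B Q :=
  ⟨_, _, .sample a s, hB, hQ⟩

theorem Runs.seq {p q : Prog} {s : State} {B₁ B₂ B : ℕ} {Q : State → Prop}
    (hp : Runs J h ω p s B₁ fun s₁ => Runs J h ω q s₁ B₂ Q) (hB : B₁ + B₂ ≤ B) :
    Runs J h ω (.seq p q) s B Q := by
  obtain ⟨t₁, s₁, he₁, ht₁, t₂, s₂, he₂, ht₂, hQ⟩ := hp
  exact ⟨_, _, .seq he₁ he₂, by omega, hQ⟩

theorem Runs.ite {b : Test} {p q : Prog} {s : State} {B B' : ℕ} {Q : State → Prop}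
    (hB : b.time + B ≤ B')
    (h₁ : b.holds J h s → Runs J h ω p s B Q) (h₂ : ¬ b.holds J h s → Runs J h ω q s B Q) :
    Runs J h ω (.ite b p q) s B' Q := by
  by_cases hb : b.holds J h s
  · obtain ⟨t, s', he, ht, hQ⟩ := h₁ hb
    exact ⟨_, _, .ite_true hb he, by omega, hQ⟩
  · obtain ⟨t, s', he, ht, hQ⟩ := h₂ hb
    exact ⟨_, _, .ite_false hb he, by omega, hQ⟩

/-- A loop that is passed exactly `N` times. -/
theorem Runs.whileCount {b : Test} {p : Prog} {B : ℕ} (I : ℕ → State → Prop) {N : ℕ}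
    (hstep : ∀ k < N, ∀ s, I k s → b.holds J h s ∧ Runs J h ω p s B (I (k + 1)))
    (hend : ∀ s, I N s → ¬ b.holds J h s) {s : State} (h0 : I 0 s) :
    Runs J h ω (.while b p) s (N * (B + b.time) + b.time) (I N) := by
  have key : ∀ j k, j + k = N → ∀ s, I k s →
      Runs J h ω (.while b p) s (j * (B + b.time) + b.time) (I N) := by
    intro j
    induction j with
    | zero =>
      intro k hk s hs
      rw [zero_add] at hk
      subst hk
      exact ⟨_, _, .while_false (hend s hs), by simp, hs⟩
    | succ j ih =>
      intro k hk s hs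
      obtain ⟨hb, t₁, s₁, he₁, ht₁, hI⟩ := hstep k (by omega) s hs
      obtain ⟨t₂, s₂, he₂, ht₂, hI₂⟩ := ih (k + 1) (by omega) s₁ hI
      refine ⟨_, _, .while_true hb he₁ he₂, ?_, hI₂⟩
      rw [Nat.succ_mul]
      omega
  exact key N 0 (by simp) s h0

/-- The value of the cell `k` of the natural-number memory. -/
abbrev natCell (k : ℕ) : NatExp := .load (.lit k)

/-- The value of the cell `k` of the real memory. -/
abbrev realCell (k : ℕ) : RealExp := .load (.lit k)

/-- Repeat `body` while the counter in the cell `c` runs from `0` up to the number in the cell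
`b`. -/
def forLoop (c b : ℕ) (body : Prog) : Prog :=
  .seq (.setNat (.lit c) (.lit 0))
    (.while (.natLE (.add (natCell c) (.lit 1)) (natCell b))
      (.seq body (.setNat (.lit c) (.add (natCell c) (.lit 1)))))

/-- A bound for the time of a loop with `N` passes of time at most `B`. -/
def loopTime (N B : ℕ) : ℕ := N * (B + 20) + 20

theorem Runs.forLoop {c b : ℕ} {body : Prog} {s : State} {N N' B : ℕ} {Q : State → Prop}
    (I : ℕ → State → Prop) (hN' : N ≤ N')
    (hN : ∀ k s, I k s → s.nat b = N)
    (h0 : I 0 ⟨update s.nat c 0, s.real, s.drawn⟩)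
    (hstep : ∀ k < N, ∀ s, s.nat c = k → I k s → Runs J h ω body s B fun s' =>
      s'.nat c = k ∧ I (k + 1) ⟨update s'.nat c (k + 1), s'.real, s'.drawn⟩)
    (hQ : ∀ s, s.nat c = N → I N s → Q s) :
    Runs J h ω (forLoop c b body) s (loopTime N' B) Q := by
  have hw : Runs J h ω (.while (.natLE (.add (natCell c) (.lit 1)) (natCell b))
      (.seq body (.setNat (.lit c) (.add (natCell c) (.lit 1)))))
      ⟨update s.nat c 0, s.real, s.drawn⟩ (N * ((B + 6) + 7) + 7)
      (fun s => s.nat c = N ∧ I N s) := by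
    refine Runs.whileCount (b := .natLE (.add (natCell c) (.lit 1)) (natCell b)) (B := B + 6)
      (fun k s => s.nat c = k ∧ I k s) (fun k hk s hs => ?_) (fun s hs => ?_) ⟨by simp, h0⟩
    · refine ⟨?_, Runs.seq ((hstep k hk s hs.1 hs.2).mono le_rfl fun s' hs' => ?_) le_rfl⟩
      · simp only [Test.holds, NatExp.eval, hs.1, hN k s hs.2]
        exact hk
      · refine Runs.setNat le_rfl ⟨?_, ?_⟩
        · simp [NatExp.eval, hs'.1]
        · simpa [NatExp.eval, hs'.1] using hs'.2
    · simp only [Test.holds, NatExp.eval, hs.1, hN N s hs.2]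
      omega
  refine Runs.seq (B₁ := 3) (Runs.setNat le_rfl (hw.mono le_rfl fun s' hs' => hQ s' hs'.1 hs'.2)) ?_
  unfold loopTime
  have := Nat.mul_le_mul hN' (show B + 6 + 7 ≤ B + 20 by omega)
  omega

/-- The states agree except possibly at the addresses in `X` and in `Y`. -/
structure Agree (X Y : ℕ → Prop) (s s' : State) : Prop where
  nat : ∀ a, ¬ X a → s'.nat a = s.nat a
  real : ∀ a, ¬ Y a → s'.real a = s.real a
  drawn : s'.drawn = s.drawn

theorem Agree.refl (X Y : ℕ → Prop) (s : State) : Agree X Y s s :=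
  ⟨fun _ _ => rfl, fun _ _ => rfl, rfl⟩

theorem Agree.trans {X Y X₁ Y₁ X₂ Y₂ : ℕ → Prop} {s₁ s₂ s₃ : State} (h₁ : Agree X₁ Y₁ s₁ s₂)
    (h₂ : Agree X₂ Y₂ s₂ s₃) (hX₁ : ∀ a, X₁ a → X a) (hX₂ : ∀ a, X₂ a → X a)
    (hY₁ : ∀ a, Y₁ a → Y a) (hY₂ : ∀ a, Y₂ a → Y a) : Agree X Y s₁ s₃ :=
  ⟨fun a ha => (h₂.nat a fun h => ha (hX₂ a h)).trans (h₁.nat a fun h => ha (hX₁ a h)),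
    fun a ha => (h₂.real a fun h => ha (hY₂ a h)).trans (h₁.real a fun h => ha (hY₁ a h)),
    h₂.drawn.trans h₁.drawn⟩

theorem Agree.updateNat {X Y : ℕ → Prop} {s s' : State} (h : Agree X Y s s') {a : ℕ} (ha : X a)
    (v : ℕ) : Agree X Y s ⟨update s'.nat a v, s'.real, s'.drawn⟩ :=
  ⟨fun b hb => (update_of_ne (fun e => hb (by rw [e]; exact ha)) _ _).trans (h.nat b hb), h.real, h.drawn⟩

theorem Agree.updateReal {X Y : ℕ → Prop} {s s' : State} (h : Agree X Y s s') {a : ℕ} (ha : Y a)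
    (v : ℝ) : Agree X Y s ⟨s'.nat, update s'.real a v, s'.drawn⟩ :=
  ⟨h.nat, fun b hb => (update_of_ne (fun e => hb (by rw [e]; exact ha)) _ _).trans (h.real b hb), h.drawn⟩

end Logic

/-! ### The program -/

section Program

open RealRAM

/-- The address of the sampled vertex whose index is in the cell `c`. -/
abbrev vertexAddr (c : ℕ) : NatExp := .add (.lit 20) (natCell c)

/-- The address of the truncated field at the sampled vertex whose index is in the cell `c`. -/
abbrev fieldAddr (c : ℕ) : NatExp := .add (.lit 20) (.mul (.lit 2) (natCell c))

/-- The address of the spin of the sampled vertex whose index is in the cell `c`. -/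
abbrev spinAddr (c : ℕ) : NatExp := .add (.lit 21) (.mul (.lit 2) (natCell c))

/-- A real literal. -/
abbrev realLit (k : ℕ) : RealExp := .ofNat (.lit k)

/-- Add the interactions of a vertex with all vertices to the energy. -/
def interactionLoop : Prog :=
  forLoop 11 5 (.setReal (.lit 5) (.add (realCell 5)
    (.mul (.mul (.mul (.div (.ofNat (natCell 0)) (.ofNat (natCell 5)))
      (.probeJ (.load (vertexAddr 10)) (.load (vertexAddr 11))))
        (.load (spinAddr 10))) (.load (spinAddr 11)))))

/-- Compute the energy and the magnetization of a configuration. -/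
def energyProg : Prog :=
  .seq (.setReal (.lit 5) (realLit 0)) <|
  .seq (.setReal (.lit 10) (realLit 0)) <|
  forLoop 10 5 <|
    .seq (.setReal (.lit 5) (.add (realCell 5)
      (.mul (.add (.load (fieldAddr 10)) (realCell 4)) (.load (spinAddr 10))))) <|
    .seq (.setReal (.lit 10) (.add (realCell 10) (.load (spinAddr 10))))
      interactionLoop

/-- Compute the approximate weight of a configuration. -/
def weightProg : Prog :=
  .seq (.setReal (.lit 6) (realLit 1)) <|
  forLoop 12 13 <|
    .setReal (.lit 6) (.mul (realCell 6)
      (.add (realLit 1) (.div (realCell 5) (.ofNat (natCell 13)))))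

/-- Pass to the next configuration. -/
def nextConfigProg : Prog :=
  .seq (.setReal (.lit 11) (realLit 1)) <|
  forLoop 10 5 <|
    .seq (.setReal (.lit 12) (.div (.mul (realCell 11)
      (.add (realLit 1) (.load (spinAddr 10)))) (realLit 2))) <|
    .seq (.setReal (spinAddr 10) (.mul (.load (spinAddr 10))
      (.sub (realLit 1) (.mul (realLit 2) (realCell 11)))))
      (.setReal (.lit 11) (realCell 12))

/-- Sum over all configurations. -/
def configLoop : Prog :=
  .seq (.setReal (.lit 7) (realLit 0)) <|
  .seq (.setReal (.lit 8) (realLit 0)) <|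
  forLoop 9 6 <|
    .seq energyProg <|
    .seq weightProg <|
    .seq (.setReal (.lit 7) (.add (realCell 7) (realCell 6))) <|
    .seq (.setReal (.lit 8) (.add (realCell 8) (.mul (realCell 6) (realCell 10))))
      nextConfigProg

/-- Choose a vertex. -/
def vertexProg : Prog :=
  .ite (.natLE (natCell 0) (natCell 15)) (.setNat (vertexAddr 10) (natCell 10))
    (.sample (vertexAddr 10))

/-- Truncate the field at a vertex. -/
def clipProg : Prog :=
  .seq (.setReal (fieldAddr 10) (.probeH (.load (vertexAddr 10)))) <|
  .seq (.ite (.realLE (.ofNat (natCell 4)) (.load (fieldAddr 10)))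
    (.setReal (fieldAddr 10) (.ofNat (natCell 4))) .skip)
  (.ite (.realLE (.load (fieldAddr 10)) (.sub (realLit 0) (.ofNat (natCell 4))))
    (.setReal (fieldAddr 10) (.sub (realLit 0) (.ofNat (natCell 4)))) .skip)

/-- Choose the vertices and the homogeneous field, and start with the configuration `-1`. -/
def sampleProg : Prog :=
  .seq (forLoop 10 5 <|
    .seq vertexProg <| .seq clipProg (.setReal (spinAddr 10) (.sub (realLit 0) (realLit 1))))
  (.ite (.natLE (natCell 0) (natCell 15)) (.setReal (.lit 4) (realLit 0))
    (.seq (.sample (.lit 14)) (.setReal (.lit 4)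
      (.div (.mul (.div (realLit 1) (.ofNat (natCell 1))) (.ofNat (natCell 14)))
        (.ofNat (natCell 0))))))

/-- Average the estimates. -/
def repeatProg : Prog :=
  .seq (.setReal (.lit 9) (realLit 0)) <|
  forLoop 8 7 <|
    .seq sampleProg <|
    .seq configLoop
      (.setReal (.lit 9) (.add (realCell 9) (.div (realCell 8) (realCell 7))))

/-- Compute the accuracy `m`. -/
def accuracyProg : Prog :=
  .while (.realLE (.mul (.ofNat (natCell 1)) (.mul (realCell 0) (realCell 1)))
      (.add (realCell 0) (realCell 1)))
    (.setNat (.lit 1) (.add (natCell 1) (.lit 1)))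

/-- The square of a natural number. -/
abbrev sqExp (e : NatExp) : NatExp := .mul e e

/-- Compute the mesh of the grid and the number of sites for the reconstruction. -/
def gridProg : Prog :=
  .seq (.setNat (.lit 2) (.mul (.lit 400)
    (.mul (sqExp (natCell 1)) (.mul (sqExp (natCell 1)) (sqExp (natCell 1))))))
  (.setNat (.lit 3) (.add (sqExp (natCell 2)) (.lit 1)))

/-- Compute the bound for the field. -/
def fieldBoundProg : Prog :=
  .seq (.setNat (.lit 4) (.lit 1)) <|
  forLoop 10 3 (.setNat (.lit 4) (.mul (natCell 4) (.add (.mul (.lit 2) (natCell 2)) (.lit 1))))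

/-- Compute the sample size and the precision. -/
def sizeProg : Prog :=
  .seq (.setNat (.lit 15) (sqExp (sqExp (natCell 4)))) <|
  .seq (.setNat (.lit 13) (.mul (.lit 2)
    (.mul (natCell 15) (.mul (natCell 15) (natCell 15))))) <|
  .ite (.natLE (natCell 0) (natCell 15)) (.setNat (.lit 5) (natCell 0))
    (.setNat (.lit 5) (natCell 15))

/-- Compute the number of configurations. -/
def configCountProg : Prog :=
  .seq (.setNat (.lit 6) (.lit 1)) <|
  forLoop 10 5 (.setNat (.lit 6) (.mul (natCell 6) (.lit 2)))

/-- Compute the number of repetitions. -/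
def repeatCountProg : Prog :=
  .seq (.setReal (.lit 3) (realLit 2)) <|
  .seq (.while (.not (.realLE (realCell 3) (realCell 2)))
    (.seq (.setReal (.lit 3) (.div (realCell 3) (realLit 2)))
      (.setNat (.lit 7) (.add (natCell 7) (.lit 1)))))
  (.setNat (.lit 7) (.mul (.lit 8) (.mul (sqExp (natCell 1)) (natCell 7))))

/-- The program that estimates the magnetization. -/
def magnetizationProg : Prog :=
  .seq accuracyProg <| .seq gridProg <| .seq fieldBoundProg <| .seq sizeProg <|
  .seq configCountProg <| .seq repeatCountProg <| .seq repeatProg <|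
  .setReal (.lit 0) (.div (.mul (.ofNat (natCell 0)) (realCell 9))
    (.mul (.ofNat (natCell 7)) (.ofNat (natCell 5))))

end Program

section Specifications

open RealRAM Function

variable {n : ℕ} {J : Matrix (Fin n) (Fin n) ℝ} {h : Fin n → ℝ} {ω : ℕ → Fin n}

/-! ### The energy of a configuration -/

/-- The interaction terms of the vertex with index `a`. -/
noncomputable def interactionSum (J : Matrix (Fin n) (Fin n) ℝ) (N d : ℕ) (S : ℕ → ℕ)
    (x : ℕ → ℝ) (a k : ℕ) : ℝ :=
  ∑ b ∈ range k, (N : ℝ) / d * entryJ J (S a) (S b) * x a * x b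

theorem interactionLoop_runs {s : State} {D : ℕ} (hD : s.nat 5 ≤ D) :
    Runs J h ω interactionLoop s (loopTime D 50) fun s' =>
      Agree (· = 11) (· = 5) s s' ∧
      s'.real 5 = s.real 5 + interactionSum J (s.nat 0) (s.nat 5) (fun a => s.nat (20 + a))
        (fun a => s.real (21 + 2 * a)) (s.nat 10) (s.nat 5) := by
  refine Runs.forLoop (fun k s' => Agree (· = 11) (· = 5) s s' ∧
      s'.real 5 = s.real 5 + interactionSum J (s.nat 0) (s.nat 5) (fun a => s.nat (20 + a))
        (fun a => s.real (21 + 2 * a)) (s.nat 10) k) hD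
    (fun k s' hs' => hs'.1.nat 5 (by decide))
    ⟨(Agree.refl (· = 11) (· = 5) s).updateNat rfl 0, by simp [interactionSum]⟩ ?_ (fun s' _ hs' => hs')
  rintro k hk s' hc ⟨hA, h5⟩
  refine Runs.setReal (by decide) ⟨hc, (hA.updateReal rfl _).updateNat rfl _, ?_⟩
  simp only [NatExp.eval, RealExp.eval, update_self, hc, h5, interactionSum, sum_range_succ,
    hA.nat 0 (by decide), hA.nat 5 (by decide), hA.nat 10 (by decide),
    hA.nat (20 + k) (by omega), hA.nat (20 + s.nat 10) (by omega),
    hA.real (21 + 2 * k) (by omega), hA.real (21 + 2 * s.nat 10) (by omega)]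
  ring

/-- The energy of a configuration on the sampled vertices with indices below `k`. -/
noncomputable def ramEnergy (J : Matrix (Fin n) (Fin n) ℝ) (N d : ℕ) (S : ℕ → ℕ) (f : ℕ → ℝ)
    (x : ℕ → ℝ) (k : ℕ) : ℝ :=
  ∑ a ∈ range k, (f a * x a + interactionSum J N d S x a d)

theorem energyProg_runs {s : State} {D : ℕ} (hD : s.nat 5 ≤ D) :
    Runs J h ω energyProg s (loopTime D (loopTime D 50 + 100) + 20) fun s' =>
      Agree (fun a => a = 10 ∨ a = 11) (fun a => a = 5 ∨ a = 10) s s' ∧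
      s'.real 5 = ramEnergy J (s.nat 0) (s.nat 5) (fun a => s.nat (20 + a))
        (fun a => s.real (20 + 2 * a) + s.real 4) (fun a => s.real (21 + 2 * a)) (s.nat 5) ∧
      s'.real 10 = ∑ a ∈ range (s.nat 5), s.real (21 + 2 * a) := by
  refine Runs.seq (B₁ := 10) (B₂ := loopTime D (loopTime D 50 + 100) + 10)
    (Runs.setReal (by decide) (Runs.seq (B₁ := 10)
      (Runs.setReal (by decide) ?_) (Nat.add_comm _ _).le)) (by omega)
  refine Runs.forLoop (fun k s' =>
      Agree (fun a => a = 10 ∨ a = 11) (fun a => a = 5 ∨ a = 10) s s' ∧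
      s'.real 5 = ramEnergy J (s.nat 0) (s.nat 5) (fun a => s.nat (20 + a))
        (fun a => s.real (20 + 2 * a) + s.real 4) (fun a => s.real (21 + 2 * a)) k ∧
      s'.real 10 = ∑ a ∈ range k, s.real (21 + 2 * a)) hD
    (fun k s' hs' => hs'.1.nat 5 (by decide))
    ⟨(((Agree.refl _ _ s).updateReal (Or.inl rfl) _).updateReal (Or.inr rfl) _).updateNat
      (Or.inl rfl) 0, by simp [ramEnergy, NatExp.eval, RealExp.eval],
      by simp [NatExp.eval, RealExp.eval]⟩ ?_ (fun s' _ hs' => hs')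
  rintro k hk s' hc ⟨hA, h5, h10⟩
  refine Runs.seq (B₁ := 50) (B₂ := loopTime D 50 + 50) (Runs.setReal (by decide)
    (Runs.seq (B₁ := 50) (Runs.setReal (by decide) ?_) (Nat.add_comm _ _).le)) (by omega)
  set s'' : State := ⟨s'.nat, _, s'.drawn⟩ with hs''
  have hA'' : Agree (fun a => a = 10 ∨ a = 11) (fun a => a = 5 ∨ a = 10) s s'' :=
    (hA.updateReal (Or.inl rfl) _).updateReal (Or.inr rfl) _
  have hn5 : s''.nat 5 = s.nat 5 := hA''.nat 5 (by decide)
  refine (interactionLoop_runs (s := s'') (D := D) (hn5.le.trans hD)).mono le_rfl ?_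
  rintro s₃ ⟨hA₃, h5₃⟩
  have hc'' : s''.nat 10 = k := hc
  refine ⟨(hA₃.nat 10 (by decide)).trans hc, ?_, ?_, ?_⟩
  · exact (hA''.trans hA₃ (fun _ h => h) (fun _ h => Or.inr h) (fun _ h => h)
      (fun _ h => Or.inl h)).updateNat (Or.inl rfl) _
  · have e1 : (fun a => s''.nat (20 + a)) = fun a => s.nat (20 + a) :=
      funext fun a => hA''.nat _ (by omega)
    have e2 : (fun a => s''.real (21 + 2 * a)) = fun a => s.real (21 + 2 * a) :=
      funext fun a => hA''.real _ (by omega)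
    have e3 : s''.real 5 = s'.real 5 + (s'.real (20 + 2 * k) + s'.real 4) *
        s'.real (21 + 2 * k) := by
      simp [hs'', NatExp.eval, RealExp.eval, hc]
    change s₃.real 5 = _
    rw [h5₃, e1, e2, e3, hn5, hc'', hA''.nat 0 (by decide), h5, hA.real (20 + 2 * k) (by omega),
      hA.real 4 (by decide), hA.real (21 + 2 * k) (by omega)]
    simp only [ramEnergy, sum_range_succ]
    ring
  · change s₃.real 10 = _
    rw [hA₃.real 10 (by decide), sum_range_succ]
    have : s''.real 10 = s'.real 10 + s'.real (21 + 2 * k) := by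
      simp only [hs'', NatExp.eval, RealExp.eval, hc, update_self]
      rw [update_of_ne (by decide), update_of_ne (by omega)]
    rw [this, h10, hA.real (21 + 2 * k) (by omega)]

theorem weightProg_runs {s : State} {D : ℕ} (hD : s.nat 13 ≤ D) :
    Runs J h ω weightProg s (loopTime D 50 + 10) fun s' =>
      Agree (· = 12) (· = 6) s s' ∧
      s'.real 6 = (1 + s.real 5 / (s.nat 13 : ℕ)) ^ s.nat 13 := by
  refine Runs.seq (B₁ := 10) (Runs.setReal (by decide) ?_) (Nat.add_comm _ _).le
  refine Runs.forLoop (fun k s' => Agree (· = 12) (· = 6) s s' ∧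
      s'.real 6 = (1 + s.real 5 / (s.nat 13 : ℕ)) ^ k) hD
    (fun k s' hs' => hs'.1.nat 13 (by decide))
    ⟨((Agree.refl (· = 12) (· = 6) s).updateReal rfl _).updateNat rfl 0, by
      simp [NatExp.eval, RealExp.eval]⟩ ?_ (fun s' _ hs' => hs')
  rintro k hk s' hc ⟨hA, h6⟩
  refine Runs.setReal (by decide) ⟨hc, (hA.updateReal rfl _).updateNat rfl _, ?_⟩
  simp only [NatExp.eval, RealExp.eval, update_self, h6, hA.nat 13 (by decide),
    hA.real 5 (by decide), Nat.cast_one]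
  ring

/-! ### The enumeration of the configurations -/

/-- The spin with index `a` in the configuration with number `c`. -/
def configSpin (c a : ℕ) : ℝ := 2 * ((c / 2 ^ a % 2 : ℕ) : ℝ) - 1

/-- The carry into the position `a` when the number `c` is increased. -/
def carry (c a : ℕ) : ℝ := if 2 ^ a ∣ c + 1 then 1 else 0

theorem configSpin_succ (c a : ℕ) :
    configSpin (c + 1) a = configSpin c a * (1 - 2 * carry c a) := by
  unfold configSpin carry
  rw [Nat.succ_div]
  split_ifs with h
  · rcases Nat.mod_two_eq_zero_or_one (c / 2 ^ a) with h' | h'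
    · have : (c / 2 ^ a + 1) % 2 = 1 := by omega
      rw [this, h']; norm_num
    · have : (c / 2 ^ a + 1) % 2 = 0 := by omega
      rw [this, h']; norm_num
  · norm_num

theorem carry_succ (c a : ℕ) : carry c (a + 1) = carry c a * (1 + configSpin c a) / 2 := by
  unfold configSpin carry
  have key : 2 ^ (a + 1) ∣ c + 1 ↔ 2 ^ a ∣ c + 1 ∧ c / 2 ^ a % 2 = 1 := by
    rw [pow_succ]
    constructor
    · intro h
      have h1 : 2 ^ a ∣ c + 1 := (dvd_mul_right _ _).trans h
      refine ⟨h1, ?_⟩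
      have h2 : (c + 1) / 2 ^ a = c / 2 ^ a + 1 := by rw [Nat.succ_div, if_pos h1]
      have h3 : 2 ∣ (c + 1) / 2 ^ a := (Nat.dvd_div_iff_mul_dvd h1).2 h
      omega
    · rintro ⟨h1, h2⟩
      have h3 : (c + 1) / 2 ^ a = c / 2 ^ a + 1 := by rw [Nat.succ_div, if_pos h1]
      exact (Nat.dvd_div_iff_mul_dvd h1).1 (by omega)
  by_cases h1 : 2 ^ a ∣ c + 1
  · rcases Nat.mod_two_eq_zero_or_one (c / 2 ^ a) with h' | h'
    · rw [if_neg (by rw [key]; omega), if_pos h1, h']; norm_num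
    · rw [if_pos (key.2 ⟨h1, h'⟩), if_pos h1, h']; norm_num
  · rw [if_neg (fun h => h1 (key.1 h).1), if_neg h1]; norm_num

theorem nextConfigProg_runs {s : State} {D c : ℕ} (hD : s.nat 5 ≤ D)
    (hx : ∀ a < s.nat 5, s.real (21 + 2 * a) = configSpin c a) :
    Runs J h ω nextConfigProg s (loopTime D 100 + 10) fun s' =>
      Agree (· = 10) (fun a => a = 11 ∨ a = 12 ∨ ∃ b, a = 21 + 2 * b) s s' ∧
      ∀ a < s.nat 5, s'.real (21 + 2 * a) = configSpin (c + 1) a := by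
  refine Runs.seq (B₁ := 10) (Runs.setReal (by decide) ?_) (Nat.add_comm _ _).le
  refine Runs.forLoop (fun k s' =>
      Agree (· = 10) (fun a => a = 11 ∨ a = 12 ∨ ∃ b, a = 21 + 2 * b) s s' ∧
      (∀ a < k, s'.real (21 + 2 * a) = configSpin (c + 1) a) ∧
      (∀ a, k ≤ a → a < s.nat 5 → s'.real (21 + 2 * a) = configSpin c a) ∧
      s'.real 11 = carry c k) hD
    (fun k s' hs' => hs'.1.nat 5 (by decide))
    ⟨((Agree.refl (· = 10) (fun a => a = 11 ∨ a = 12 ∨ ∃ b, a = 21 + 2 * b) s).updateReal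
      (Or.inl rfl) _).updateNat rfl 0, by simp, ?_, ?_⟩ ?_
    (fun s' _ hs' => ⟨hs'.1, hs'.2.1⟩)
  · intro a _ ha
    simp only [NatExp.eval]
    rw [update_of_ne (by omega), hx a ha]
  · simp [NatExp.eval, RealExp.eval, carry]
  rintro k hk s' hc ⟨hA, h1, h2, h3⟩
  refine Runs.seq (B₁ := 50) (B₂ := 50) (Runs.setReal (by decide)
    (Runs.seq (B₁ := 40) (B₂ := 10) (Runs.setReal (by decide)
      (Runs.setReal (by decide) ⟨hc, ?_, ?_, ?_, ?_⟩)) (by decide))) (by decide)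
  · refine (((hA.updateReal (Or.inr (Or.inl rfl)) _).updateReal
      (Or.inr (Or.inr ⟨k, ?_⟩)) _).updateReal (Or.inl rfl) _).updateNat rfl _
    simp [NatExp.eval, hc]
  · intro a ha
    simp only [NatExp.eval, RealExp.eval, hc]
    rw [update_of_ne (by omega)]
    rcases Nat.lt_succ_iff_lt_or_eq.1 ha with ha | rfl
    · rw [update_of_ne (by omega), update_of_ne (by omega)]
      exact h1 a ha
    · rw [update_self, update_of_ne (by omega), update_of_ne (by decide), h2 a le_rfl hk, h3,
        configSpin_succ]
      push_cast
      rfl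
  · intro a ha ha'
    simp only [NatExp.eval, RealExp.eval, hc]
    rw [update_of_ne (by omega), update_of_ne (by omega), update_of_ne (by omega)]
    exact h2 a (by omega) ha'
  · simp only [NatExp.eval, RealExp.eval, hc]
    rw [update_self, update_of_ne (by omega), update_self, h2 k le_rfl hk, h3, carry_succ]
    push_cast
    rfl

/-- The approximate weight of the configuration with number `c`. -/
noncomputable def ramWeight (J : Matrix (Fin n) (Fin n) ℝ) (N d P : ℕ) (S : ℕ → ℕ) (f : ℕ → ℝ)
    (c : ℕ) : ℝ :=
  (1 + ramEnergy J N d S f (configSpin c) d / P) ^ P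

/-- A bound for the time of the loop over all configurations. -/
def configTime (D P C : ℕ) : ℕ :=
  loopTime C (loopTime D (loopTime D 50 + 100) + loopTime P 50 + loopTime D 100 + 100) + 20

theorem interactionSum_congr (J : Matrix (Fin n) (Fin n) ℝ) (N d : ℕ) (S : ℕ → ℕ)
    {x x' : ℕ → ℝ} {a k : ℕ} (ha : a < d) (hk : k ≤ d) (hx : ∀ b < d, x b = x' b) :
    interactionSum J N d S x a k = interactionSum J N d S x' a k :=
  sum_congr rfl fun b hb => by
    rw [hx a ha, hx b ((mem_range.1 hb).trans_le hk)]

theorem ramEnergy_congr (J : Matrix (Fin n) (Fin n) ℝ) (N d : ℕ) (S : ℕ → ℕ) (f : ℕ → ℝ)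
    {x x' : ℕ → ℝ} (hx : ∀ b < d, x b = x' b) :
    ramEnergy J N d S f x d = ramEnergy J N d S f x' d :=
  sum_congr rfl fun a ha => by
    rw [hx a (mem_range.1 ha), interactionSum_congr J N d S (mem_range.1 ha) le_rfl hx]

theorem configLoop_runs {s : State} {D P C : ℕ} (hD : s.nat 5 ≤ D) (hP : s.nat 13 ≤ P)
    (hC : s.nat 6 ≤ C) (hx : ∀ a < s.nat 5, s.real (21 + 2 * a) = configSpin 0 a) :
    Runs J h ω configLoop s (configTime D P C) fun s' =>
      Agree (fun a => 9 ≤ a ∧ a ≤ 12)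
        (fun a => (5 ≤ a ∧ a ≤ 8) ∨ (10 ≤ a ∧ a ≤ 12) ∨ ∃ b, a = 21 + 2 * b) s s' ∧
      s'.real 7 = ∑ c ∈ range (s.nat 6), ramWeight J (s.nat 0) (s.nat 5) (s.nat 13)
        (fun a => s.nat (20 + a)) (fun a => s.real (20 + 2 * a) + s.real 4) c ∧
      s'.real 8 = ∑ c ∈ range (s.nat 6), ramWeight J (s.nat 0) (s.nat 5) (s.nat 13)
        (fun a => s.nat (20 + a)) (fun a => s.real (20 + 2 * a) + s.real 4) c *
          ∑ a ∈ range (s.nat 5), configSpin c a := by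
  set X : ℕ → Prop := fun a => 9 ≤ a ∧ a ≤ 12 with hX
  set Y : ℕ → Prop := fun a => (5 ≤ a ∧ a ≤ 8) ∨ (10 ≤ a ∧ a ≤ 12) ∨ ∃ b, a = 21 + 2 * b with hY
  set W : ℕ → ℝ := ramWeight J (s.nat 0) (s.nat 5) (s.nat 13)
        (fun a => s.nat (20 + a)) (fun a => s.real (20 + 2 * a) + s.real 4) with hW
  refine Runs.seq (B₁ := 10) (B₂ := loopTime C (loopTime D (loopTime D 50 + 100) + loopTime P 50 +
      loopTime D 100 + 100) + 10) (Runs.setReal (by decide) (Runs.seq (B₁ := 10)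
    (Runs.setReal (by decide) ?_) (Nat.add_comm _ _).le)) (by unfold configTime; omega)
  refine Runs.forLoop (fun k s' => Agree X Y s s' ∧
      (∀ a < s.nat 5, s'.real (21 + 2 * a) = configSpin k a) ∧
      s'.real 7 = ∑ c ∈ range k, W c ∧
      s'.real 8 = ∑ c ∈ range k, W c * ∑ a ∈ range (s.nat 5), configSpin c a) hC
    (fun k s' hs' => hs'.1.nat 6 (by simp [hX]))
    ⟨(((Agree.refl _ _ s).updateReal (by simp [hY, NatExp.eval]) _).updateReal
      (by simp [hY, NatExp.eval]) _).updateNat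
      (by simp [hX]) 0, ?_, ?_, ?_⟩ ?_ (fun s' _ hs' => ⟨hs'.1, hs'.2.2⟩)
  · intro a ha
    simp only [NatExp.eval]
    rw [update_of_ne (by omega), update_of_ne (by omega), hx a ha]
  · simp [NatExp.eval, RealExp.eval]
  · simp [NatExp.eval, RealExp.eval]
  rintro k hk s₀ hc ⟨hA, hcfg, h7, h8⟩
  have n5 : s₀.nat 5 = s.nat 5 := hA.nat 5 (by simp [hX])
  have n0 : s₀.nat 0 = s.nat 0 := hA.nat 0 (by simp [hX])
  have n13 : s₀.nat 13 = s.nat 13 := hA.nat 13 (by simp [hX])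
  refine Runs.seq ((energyProg_runs (s := s₀) (n5.le.trans hD)).mono le_rfl ?_)
    (B₂ := loopTime P 50 + loopTime D 100 + 80) (by omega)
  rintro s₁ ⟨hA₁, h5₁, h10₁⟩
  have n13₁ : s₁.nat 13 = s.nat 13 := (hA₁.nat 13 (by decide)).trans n13
  refine Runs.seq ((weightProg_runs (s := s₁) (n13₁.le.trans hP)).mono le_rfl ?_)
    (B₂ := loopTime D 100 + 70) (by omega)
  rintro s₂ ⟨hA₂, h6₂⟩
  have hw : s₂.real 6 = W k := by
    rw [h6₂, n13₁, h5₁, n0, n5]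
    have e1 : (fun a => s₀.nat (20 + a)) = fun a => s.nat (20 + a) :=
      funext fun a => hA.nat _ (by simp only [hX]; omega)
    have e2 : (fun a => s₀.real (20 + 2 * a) + s₀.real 4) =
        fun a => s.real (20 + 2 * a) + s.real 4 := funext fun a => by
      rw [hA.real (20 + 2 * a) (by simp only [hY]; omega), hA.real 4 (by simp only [hY]; omega)]
    rw [e1, e2, ramEnergy_congr _ _ _ _ _ hcfg]
    rfl
  have hm : s₂.real 10 = ∑ a ∈ range (s.nat 5), configSpin k a := by
    rw [hA₂.real 10 (by decide), h10₁, n5]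
    exact sum_congr rfl fun a ha => hcfg a (mem_range.1 ha)
  refine Runs.seq (B₁ := 20) (B₂ := loopTime D 100 + 50) (Runs.setReal (by decide)
    (Runs.seq (B₁ := 20) (B₂ := loopTime D 100 + 10) (Runs.setReal (by decide) ?_) (by omega)))
    (by omega)
  set s₃ : State := ⟨s₂.nat, _, s₂.drawn⟩ with hs₃
  have hA₃ : Agree X Y s s₃ := by
    refine (Agree.updateReal (Agree.updateReal (((hA.trans hA₁ (X := X) (Y := Y) (fun _ h => h)
      (fun a ha => ?_) (fun _ h => h) (fun a ha => ?_)).trans hA₂ (X := X) (Y := Y) (fun _ h => h)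
      (fun a ha => ?_) (fun _ h => h) (fun a ha => ?_))) ?_ _) ?_ _)
    · rcases ha with rfl | rfl <;> simp [hX]
    · rcases ha with rfl | rfl <;> simp [hY]
    · subst ha; simp [hX]
    · subst ha; simp [hY]
    · simp [hY, NatExp.eval]
    · simp [hY, NatExp.eval]
  have n5₃ : s₃.nat 5 = s.nat 5 := hA₃.nat 5 (by simp [hX])
  have hcfg₃ : ∀ a < s₃.nat 5, s₃.real (21 + 2 * a) = configSpin k a := by
    intro a ha
    simp only [hs₃, NatExp.eval]
    rw [update_of_ne (by omega), update_of_ne (by omega), hA₂.real _ (by omega),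
      hA₁.real _ (by omega)]
    exact hcfg a (n5₃ ▸ ha)
  refine (nextConfigProg_runs (s := s₃) (n5₃.le.trans hD) hcfg₃).mono le_rfl ?_
  rintro s₄ ⟨hA₄, hcfg₄⟩
  have f7 : s₃.real 7 = s₀.real 7 + W k := by
    simp only [hs₃, NatExp.eval, RealExp.eval]
    rw [update_of_ne (by decide), update_self, hw, hA₂.real 7 (by decide),
      hA₁.real 7 (by decide)]
  have f8 : s₃.real 8 = s₀.real 8 + W k * ∑ a ∈ range (s.nat 5), configSpin k a := by
    simp only [hs₃, NatExp.eval, RealExp.eval]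
    rw [update_self, update_of_ne (by decide), update_of_ne (by decide),
      update_of_ne (by decide), hw, hm, hA₂.real 8 (by decide), hA₁.real 8 (by decide)]
  refine ⟨?_, ?_, ?_, ?_, ?_⟩
  · rw [hA₄.nat 9 (by decide)]
    change s₂.nat 9 = k
    rw [hA₂.nat 9 (by decide), hA₁.nat 9 (by decide), hc]
  · refine (hA₃.trans hA₄ (fun _ h => h) (fun a ha => ?_) (fun _ h => h)
      (fun a ha => ?_)).updateNat ?_ _
    · subst ha; simp [hX]
    · rcases ha with rfl | rfl | ha
      · simp [hY]
      · simp [hY]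
      · exact Or.inr (Or.inr ha)
    · simp [hX]
  · intro a ha
    exact hcfg₄ a (n5₃.symm ▸ ha)
  · change s₄.real 7 = _
    rw [hA₄.real 7 (by rintro (h | h | ⟨b, h⟩) <;> omega), f7, h7, sum_range_succ]
  · change s₄.real 8 = _
    rw [hA₄.real 8 (by rintro (h | h | ⟨b, h⟩) <;> omega), f8, h8, sum_range_succ]

end Specifications

section Sampling

open RealRAM Function

variable {n : ℕ} {J : Matrix (Fin n) (Fin n) ℝ} {h : Fin n → ℝ} {ω : ℕ → Fin n}

/-! ### Sampling a subsystem -/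

theorem clipProg_runs {s : State} :
    Runs J h ω clipProg s 100 fun s' =>
      Agree (fun _ => False) (· = 20 + 2 * s.nat 10) s s' ∧
      s'.real (20 + 2 * s.nat 10) =
        clip (s.nat 4 : ℕ) (entryH h (s.nat (20 + s.nat 10))) := by
  refine Runs.seq (B₁ := 20) (B₂ := 80) (Runs.setReal (by decide)
    (Runs.seq (B₁ := 40) (B₂ := 40) (Runs.ite (B := 20) (by decide) (fun h₁ => ?_) (fun h₁ => ?_))
      le_rfl)) le_rfl
  · refine Runs.setReal (by decide) (Runs.ite (B := 20) (by decide) (fun h₂ => ?_) (fun h₂ => ?_))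
    · refine Runs.setReal (by decide) ⟨(((Agree.refl _ (· = 20 + 2 * s.nat 10) s).updateReal
        rfl _).updateReal rfl _).updateReal rfl _, ?_⟩
      simp [Test.holds, NatExp.eval, RealExp.eval] at h₁ h₂ ⊢
      rw [clip, min_eq_left h₁, max_eq_left (by simp [h₂])]
    · refine ⟨1, _, .skip _, by decide, ((Agree.refl _ (· = 20 + 2 * s.nat 10) s).updateReal
        rfl _).updateReal rfl _, ?_⟩
      simp [Test.holds, NatExp.eval, RealExp.eval] at h₁ h₂ ⊢
      rw [clip, min_eq_left h₁, max_eq_right (neg_le_self (Nat.cast_nonneg _))]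
  · refine ⟨1, _, .skip _, by decide, Runs.ite (B := 20) (by decide) (fun h₂ => ?_)
      (fun h₂ => ?_)⟩
    · refine Runs.setReal (by decide) ⟨((Agree.refl _ (· = 20 + 2 * s.nat 10) s).updateReal
        rfl _).updateReal rfl _, ?_⟩
      simp [Test.holds, NatExp.eval, RealExp.eval] at h₁ h₂ ⊢
      rw [clip, min_eq_right h₁.le, max_eq_left h₂]
    · refine ⟨1, _, .skip _, by decide, (Agree.refl _ (· = 20 + 2 * s.nat 10) s).updateReal
        rfl _, ?_⟩
      simp [Test.holds, NatExp.eval, RealExp.eval] at h₁ h₂ ⊢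
      rw [clip, min_eq_right h₁.le, max_eq_right h₂.le]

/-- The vertex with index `a` in a subsystem for which the draws from the number `r` on are
used. All vertices are chosen if there are at most `q` of them. -/
def chosenVertex (ω : ℕ → Fin n) (q r a : ℕ) : ℕ := if n ≤ q then a else ω (r + a)

/-- The homogeneous field that is chosen with the draw number `r`. -/
noncomputable def chosenField (ω : ℕ → Fin n) (q m r : ℕ) : ℝ :=
  if n ≤ q then 0 else 1 / (m : ℝ) * (ω r : ℕ) / n

theorem vertexProg_runs {s : State} (hn : s.nat 0 = n) :
    Runs J h ω vertexProg s 40 fun s' =>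
      Agree (· = 20 + s.nat 10) (fun _ => False)
        ⟨s.nat, s.real, s.drawn + if n ≤ s.nat 15 then 0 else 1⟩ s' ∧
      s'.nat (20 + s.nat 10) = if n ≤ s.nat 15 then s.nat 10 else ω s.drawn := by
  refine Runs.ite (B := 20) (by decide) (fun h₁ => ?_) (fun h₁ => ?_)
  · simp only [Test.holds, NatExp.eval, hn] at h₁
    refine Runs.setNat (by decide) ⟨?_, ?_⟩
    · rw [if_pos h₁]
      exact (Agree.refl (· = 20 + s.nat 10) (fun _ => False) s).updateNat rfl _
    · simp [NatExp.eval, h₁]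
  · simp only [Test.holds, NatExp.eval, hn] at h₁
    refine Runs.sample (by decide) ⟨?_, ?_⟩
    · rw [if_neg h₁]
      exact (Agree.refl (· = 20 + s.nat 10) (fun _ => False)
        ⟨s.nat, s.real, s.drawn + 1⟩).updateNat rfl _
    · simp [NatExp.eval, h₁]

/-- The number of draws for a subsystem of size `d`. -/
def drawCount (n q d : ℕ) : ℕ := if n ≤ q then 0 else d + 1

theorem sampleProg_runs {s : State} {D : ℕ} (hn : s.nat 0 = n) (hD : s.nat 5 ≤ D) :
    Runs J h ω sampleProg s (loopTime D 200 + 100) fun s' =>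
      Agree (fun a => a = 10 ∨ a = 14 ∨ 20 ≤ a) (fun a => a = 4 ∨ 20 ≤ a)
        ⟨s.nat, s.real, s.drawn + drawCount n (s.nat 15) (s.nat 5)⟩ s' ∧
      (∀ a < s.nat 5, s'.nat (20 + a) = chosenVertex ω (s.nat 15) s.drawn a) ∧
      (∀ a < s.nat 5, s'.real (20 + 2 * a) =
        clip (s.nat 4 : ℕ) (entryH h (chosenVertex ω (s.nat 15) s.drawn a))) ∧
      (∀ a < s.nat 5, s'.real (21 + 2 * a) = configSpin 0 a) ∧
      s'.real 4 = chosenField ω (s.nat 15) (s.nat 1) (s.drawn + s.nat 5) := by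
  set X : ℕ → Prop := fun a => a = 10 ∨ a = 14 ∨ 20 ≤ a with hX
  set Y : ℕ → Prop := fun a => a = 4 ∨ 20 ≤ a with hY
  set q := s.nat 15 with hq
  refine Runs.seq (B₂ := 100) (Runs.forLoop (fun k s' =>
      Agree X Y ⟨s.nat, s.real, s.drawn + if n ≤ q then 0 else k⟩ s' ∧
      (∀ a < k, s'.nat (20 + a) = chosenVertex ω q s.drawn a) ∧
      (∀ a < k, s'.real (20 + 2 * a) =
        clip (s.nat 4 : ℕ) (entryH h (chosenVertex ω q s.drawn a))) ∧
      (∀ a < k, s'.real (21 + 2 * a) = configSpin 0 a)) hD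
    (fun k s' hs' => hs'.1.nat 5 (by simp [hX]))
    ⟨by
      simp only [ite_self, add_zero]
      exact (Agree.refl X Y s).updateNat (Or.inl rfl) 0, by simp, by simp, by simp⟩ ?_ ?_) le_rfl
  · rintro k hk s₀ hc ⟨hA, hS, hF, hσ⟩
    have n0 : s₀.nat 0 = n := (hA.nat 0 (by simp [hX])).trans hn
    have n15 : s₀.nat 15 = q := hA.nat 15 (by simp [hX])
    have n4 : s₀.nat 4 = s.nat 4 := hA.nat 4 (by simp [hX])
    refine Runs.seq (B₂ := 150) ((vertexProg_runs n0).mono le_rfl ?_) (by decide)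
    rintro s₁ ⟨hA₁, hv⟩
    rw [n15, hc] at hA₁ hv
    have hv' : s₁.nat (20 + k) = chosenVertex ω q s.drawn k := by
      rw [hv, chosenVertex, hA.drawn]
      split_ifs <;> rfl
    have c₁ : s₁.nat 10 = k := (hA₁.nat 10 (by omega)).trans hc
    refine Runs.seq (B₂ := 50) (clipProg_runs.mono le_rfl ?_) (by decide)
    rintro s₂ ⟨hA₂, hf⟩
    rw [c₁] at hA₂ hf
    have c₂ : s₂.nat 10 = k := (hA₂.nat 10 id).trans c₁
    rw [hv', (hA₁.nat 4 (by omega)).trans n4] at hf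
    refine Runs.setReal (by decide) ⟨c₂, ?_, ?_, ?_, ?_⟩
    · simp only [NatExp.eval, RealExp.eval, c₂]
      refine ⟨fun a ha => ?_, fun a ha => ?_, ?_⟩
      · simp only [hX] at ha
        dsimp only
        rw [update_of_ne (by omega), hA₂.nat a id, hA₁.nat a (by omega)]
        exact hA.nat a ha
      · simp only [hY] at ha
        dsimp only
        rw [update_of_ne (by omega), hA₂.real a (by omega), hA₁.real a id]
        exact hA.real a ha
      · dsimp only
        rw [hA₂.drawn, hA₁.drawn]
        dsimp only
        rw [hA.drawn]
        dsimp only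
        split_ifs <;> omega
    · intro a ha
      dsimp only
      rw [update_of_ne (by omega), hA₂.nat _ id]
      rcases Nat.lt_succ_iff_lt_or_eq.1 ha with ha | rfl
      · rw [hA₁.nat _ (by omega)]
        exact hS a ha
      · exact hv'
    · intro a ha
      simp only [NatExp.eval, c₂]
      rw [update_of_ne (by omega)]
      rcases Nat.lt_succ_iff_lt_or_eq.1 ha with ha | rfl
      · rw [hA₂.real _ (by omega), hA₁.real _ id]
        exact hF a ha
      · exact hf
    · intro a ha
      simp only [NatExp.eval, c₂]
      rcases Nat.lt_succ_iff_lt_or_eq.1 ha with ha | rfl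
      · rw [update_of_ne (by omega), hA₂.real _ (by omega), hA₁.real _ id]
        exact hσ a ha
      · rw [update_self]
        simp [RealExp.eval, NatExp.eval, configSpin]
  · rintro s₀ hc ⟨hA, hS, hF, hσ⟩
    have n0 : s₀.nat 0 = n := (hA.nat 0 (by simp [hX])).trans hn
    have n15 : s₀.nat 15 = q := hA.nat 15 (by simp [hX])
    have n1 : s₀.nat 1 = s.nat 1 := hA.nat 1 (by simp [hX])
    refine Runs.ite (B := 80) (by decide) (fun h₁ => ?_) (fun h₁ => ?_)
    · simp only [Test.holds, NatExp.eval, n0, n15] at h₁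
      rw [if_pos h₁] at hA
      refine Runs.setReal (by decide) ⟨?_, hS, fun a ha => ?_, fun a ha => ?_, ?_⟩
      · rw [drawCount, if_pos h₁]
        exact hA.updateReal (Or.inl rfl) _
      · simp only [NatExp.eval]
        rw [update_of_ne (by omega), hF a ha]
      · simp only [NatExp.eval]
        rw [update_of_ne (by omega), hσ a ha]
      · simp [NatExp.eval, RealExp.eval, chosenField, h₁]
    · simp only [Test.holds, NatExp.eval, n0, n15] at h₁
      rw [if_neg h₁] at hA
      refine Runs.seq (B₁ := 10) (B₂ := 50) (Runs.sample (by decide) (Runs.setReal (by decide)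
        ⟨⟨fun a ha => ?_, fun a ha => ?_, ?_⟩, fun a ha => ?_, fun a ha => ?_, fun a ha => ?_,
          ?_⟩)) (by decide)
      · simp only [hX] at ha
        simp only [NatExp.eval]
        rw [update_of_ne (by omega)]
        exact hA.nat a ha
      · simp only [hY] at ha
        simp only [NatExp.eval]
        rw [update_of_ne (by omega)]
        exact hA.real a ha
      · dsimp only
        rw [hA.drawn, drawCount, if_neg h₁]
        dsimp only
        omega
      · simp only [NatExp.eval]
        rw [update_of_ne (by omega), hS a ha]
      · simp only [NatExp.eval]
        rw [update_of_ne (by omega), hF a ha]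
      · simp only [NatExp.eval]
        rw [update_of_ne (by omega), hσ a ha]
      · have hd : s₀.drawn = s.drawn + s.nat 5 := hA.drawn
        simp [NatExp.eval, RealExp.eval, chosenField, h₁, n0, n1, hd]

/-! ### Averaging the estimates -/

theorem ramWeight_congr (J : Matrix (Fin n) (Fin n) ℝ) (N d P : ℕ) {S S' : ℕ → ℕ}
    {f f' : ℕ → ℝ} (hS : ∀ a < d, S a = S' a) (hf : ∀ a < d, f a = f' a) (c : ℕ) :
    ramWeight J N d P S f c = ramWeight J N d P S' f' c := by
  unfold ramWeight
  congr 3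
  refine sum_congr rfl fun a ha => ?_
  rw [mem_range] at ha
  rw [hf a ha]
  congr 1
  refine sum_congr rfl fun b hb => ?_
  rw [mem_range] at hb
  rw [hS a ha, hS b hb]

/-- The estimate of the magnetization of a subsystem. -/
noncomputable def ramEstimate (J : Matrix (Fin n) (Fin n) ℝ) (N d P C : ℕ) (S : ℕ → ℕ)
    (f : ℕ → ℝ) : ℝ :=
  (∑ c ∈ range C, ramWeight J N d P S f c * ∑ a ∈ range d, configSpin c a) /
    ∑ c ∈ range C, ramWeight J N d P S f c

/-- A bound for the time of one repetition. -/
def estimateTime (D P C : ℕ) : ℕ := loopTime D 200 + configTime D P C + 150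

theorem repeatProg_runs {s : State} {D P C : ℕ} (hn : s.nat 0 = n) (h0 : s.drawn = 0)
    (hD : s.nat 5 ≤ D) (hP : s.nat 13 ≤ P) (hC : s.nat 6 ≤ C) :
    Runs J h ω repeatProg s (loopTime (s.nat 7) (estimateTime D P C) + 10) fun s' =>
      s'.nat 0 = n ∧ s'.nat 7 = s.nat 7 ∧ s'.nat 5 = s.nat 5 ∧
      s'.real 9 = ∑ r ∈ range (s.nat 7), ramEstimate J n (s.nat 5) (s.nat 13) (s.nat 6)
        (chosenVertex ω (s.nat 15) (r * drawCount n (s.nat 15) (s.nat 5)))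
        (fun a => clip (s.nat 4 : ℕ) (entryH h (chosenVertex ω (s.nat 15)
          (r * drawCount n (s.nat 15) (s.nat 5)) a)) +
            chosenField ω (s.nat 15) (s.nat 1)
              (r * drawCount n (s.nat 15) (s.nat 5) + s.nat 5)) := by
  set w := drawCount n (s.nat 15) (s.nat 5) with hw
  set E : ℕ → ℝ := fun r => ramEstimate J n (s.nat 5) (s.nat 13) (s.nat 6)
        (chosenVertex ω (s.nat 15) (r * w))
        (fun a => clip (s.nat 4 : ℕ) (entryH h (chosenVertex ω (s.nat 15) (r * w) a)) +
            chosenField ω (s.nat 15) (s.nat 1) (r * w + s.nat 5)) with hE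
  set X : ℕ → Prop := fun a => 8 ≤ a ∧ a ≤ 12 ∨ a = 14 ∨ 20 ≤ a with hX
  set Y : ℕ → Prop := fun a => 4 ≤ a with hY
  refine Runs.seq (B₁ := 10) (Runs.setReal (by decide) ?_) (Nat.add_comm _ _).le
  refine Runs.forLoop (fun k s' => Agree X Y ⟨s.nat, s.real, k * w⟩ s' ∧
      s'.real 9 = ∑ r ∈ range k, E r) le_rfl
    (fun k s' hs' => hs'.1.nat 7 (by simp [hX]))
    ⟨⟨fun a ha => ?_, fun a ha => ?_, ?_⟩, ?_⟩ ?_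
    (fun s' _ hs' => ⟨(hs'.1.nat 0 (by simp [hX])).trans hn, hs'.1.nat 7 (by simp [hX]),
      hs'.1.nat 5 (by simp [hX]), hs'.2⟩)
  · simp only [hX] at ha
    dsimp only
    rw [update_of_ne (by omega)]
  · simp only [hY] at ha
    simp only [NatExp.eval]
    rw [update_of_ne (by omega)]
  · dsimp only
    rw [h0, zero_mul]
  · simp [NatExp.eval, RealExp.eval]
  rintro k hk s₀ hc ⟨hA, h9⟩
  have n0 : s₀.nat 0 = n := (hA.nat 0 (by simp [hX])).trans hn
  have n5 : s₀.nat 5 = s.nat 5 := hA.nat 5 (by simp [hX])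
  have n15 : s₀.nat 15 = s.nat 15 := hA.nat 15 (by simp [hX])
  have d0 : s₀.drawn = k * w := hA.drawn
  refine Runs.seq (B₂ := configTime D P C + 50)
    ((sampleProg_runs n0 (n5.le.trans hD)).mono le_rfl ?_) (by unfold estimateTime; omega)
  rintro s₁ ⟨hA₁, hS, hF, hσ, hu⟩
  rw [n5, n15, d0] at hA₁ hS hF hu
  rw [n5] at hσ
  rw [hA.nat 4 (by simp [hX])] at hF
  rw [hA.nat 1 (by simp [hX])] at hu
  have n5₁ : s₁.nat 5 = s.nat 5 := (hA₁.nat 5 (by decide)).trans n5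
  have n0₁ : s₁.nat 0 = n := (hA₁.nat 0 (by decide)).trans n0
  have n6₁ : s₁.nat 6 = s.nat 6 := (hA₁.nat 6 (by decide)).trans (hA.nat 6 (by simp [hX]))
  have n13₁ : s₁.nat 13 = s.nat 13 := (hA₁.nat 13 (by decide)).trans (hA.nat 13 (by simp [hX]))
  refine Runs.seq (B₂ := 50) ((configLoop_runs (D := D) (P := P) (C := C) (n5₁.le.trans hD)
    (n13₁.le.trans hP) (n6₁.le.trans hC) (by rw [n5₁]; exact hσ)).mono le_rfl ?_) le_rfl
  rintro s₂ ⟨hA₂, h7₂, h8₂⟩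
  have hW : ∀ c, ramWeight J (s₁.nat 0) (s₁.nat 5) (s₁.nat 13) (fun a => s₁.nat (20 + a))
      (fun a => s₁.real (20 + 2 * a) + s₁.real 4) c =
      ramWeight J n (s.nat 5) (s.nat 13) (chosenVertex ω (s.nat 15) (k * w))
        (fun a => clip (s.nat 4 : ℕ) (entryH h (chosenVertex ω (s.nat 15) (k * w) a)) +
            chosenField ω (s.nat 15) (s.nat 1) (k * w + s.nat 5)) c := by
    intro c
    rw [n0₁, n5₁, n13₁]
    exact ramWeight_congr J _ _ _ hS (fun a ha => by rw [hF a ha, hu]) c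
  simp only [hW] at h7₂ h8₂
  rw [n6₁] at h7₂ h8₂
  rw [n5₁] at h8₂
  refine Runs.setReal (by decide) ⟨?_, ⟨fun a ha => ?_, fun a ha => ?_, ?_⟩, ?_⟩
  · dsimp only
    rw [hA₂.nat 8 (by decide), hA₁.nat 8 (by decide)]
    exact hc
  · simp only [hX] at ha
    dsimp only
    rw [update_of_ne (by omega), hA₂.nat a (by omega), hA₁.nat a (by omega)]
    exact hA.nat a (by simp only [hX]; omega)
  · simp only [hY] at ha
    simp only [NatExp.eval]
    rw [update_of_ne (by omega), hA₂.real a (by omega), hA₁.real a (by omega)]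
    exact hA.real a (by simp only [hY]; omega)
  · dsimp only
    rw [hA₂.drawn, hA₁.drawn]
    dsimp only
    rw [Nat.succ_mul]
  · simp only [NatExp.eval, RealExp.eval]
    rw [update_self, h7₂, h8₂, hA₂.real 9 (by omega), hA₁.real 9 (by omega)]
    dsimp only
    rw [h9, sum_range_succ]
    rfl

end Sampling

section Setup

open RealRAM Function

variable {n : ℕ} {J : Matrix (Fin n) (Fin n) ℝ} {h : Fin n → ℝ} {ω : ℕ → Fin n}

/-! ### Computing the parameters -/

/-- The reciprocal of the accuracy. -/
noncomputable def accuracy (ε Δ : ℝ) : ℕ := ⌊(ε + Δ) / (ε * Δ)⌋₊ + 1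

theorem accuracyProg_runs {s : State} {ε Δ : ℝ} (hε : 0 < ε) (hΔ : 0 < Δ) (h0 : s.real 0 = ε)
    (h1 : s.real 1 = Δ) (hm : s.nat 1 = 0) :
    Runs J h ω accuracyProg s (accuracy ε Δ * 30 + 20) fun s' =>
      Agree (· = 1) (fun _ => False) s s' ∧ s'.nat 1 = accuracy ε Δ := by
  have hpos : 0 < ε * Δ := by positivity
  have hiff : ∀ k s', Agree (· = 1) (fun _ => False) s s' ∧ s'.nat 1 = k →
      ((Test.realLE (.mul (.ofNat (natCell 1)) (.mul (realCell 0) (realCell 1)))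
        (.add (realCell 0) (realCell 1))).holds J h s' ↔ k < accuracy ε Δ) := by
    rintro k s' ⟨hA, hk⟩
    simp only [Test.holds, RealExp.eval, NatExp.eval, hk, hA.real _ id, h0, h1]
    rw [accuracy, Nat.lt_succ_iff, Nat.le_floor_iff (by positivity), le_div_iff₀ hpos]
  refine (Runs.whileCount (B := 10) (fun k s' => Agree (· = 1) (fun _ => False) s s' ∧ s'.nat 1 = k)
    (N := accuracy ε Δ) (fun k hk s' hs' => ⟨(hiff k s' hs').2 hk, ?_⟩)
    (fun s' hs' hb => lt_irrefl _ ((hiff _ s' hs').1 hb)) ⟨Agree.refl _ _ s, hm⟩).mono ?_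
    fun _ hs' => hs'
  · refine Runs.setNat (by decide) ⟨hs'.1.updateNat rfl _, ?_⟩
    simp [NatExp.eval, hs'.2]
  · simp only [Test.time, RealExp.time, NatExp.time]
    omega

theorem gridProg_runs {s : State} :
    Runs J h ω gridProg s 50 fun s' =>
      Agree (fun a => a = 2 ∨ a = 3) (fun _ => False) s s' ∧ s'.nat 2 = gridSize (s.nat 1) ∧
      s'.nat 3 = gridSize (s.nat 1) ^ 2 + 1 := by
  refine Runs.seq (B₁ := 30) (B₂ := 20) (Runs.setNat (by decide) (Runs.setNat (by decide)
    ⟨((Agree.refl (fun a => a = 2 ∨ a = 3) _ s).updateNat (Or.inl rfl) _).updateNat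
      (Or.inr rfl) _, ?_, ?_⟩)) le_rfl
  · simp only [NatExp.eval]
    rw [update_of_ne (by decide), update_self, gridSize]
    ring
  · simp only [NatExp.eval, update_self, gridSize]
    ring

theorem fieldBoundProg_runs {s : State} {D : ℕ} (hD : s.nat 3 ≤ D) :
    Runs J h ω fieldBoundProg s (loopTime D 20 + 10) fun s' =>
      Agree (fun a => a = 4 ∨ a = 10) (fun _ => False) s s' ∧
      s'.nat 4 = (2 * s.nat 2 + 1) ^ s.nat 3 := by
  refine Runs.seq (B₁ := 10) (Runs.setNat (by decide) ?_) (Nat.add_comm _ _).le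
  refine Runs.forLoop (fun k s' => Agree (fun a => a = 4 ∨ a = 10) (fun _ => False) s s' ∧
      s'.nat 4 = (2 * s.nat 2 + 1) ^ k) hD (fun k s' hs' => hs'.1.nat 3 (by decide))
    ⟨((Agree.refl (fun a => a = 4 ∨ a = 10) _ s).updateNat (Or.inl rfl) _).updateNat
      (Or.inr rfl) _, by simp [NatExp.eval]⟩ ?_ (fun s' _ hs' => hs')
  rintro k hk s' hc ⟨hA, h4⟩
  refine Runs.setNat (by decide) ⟨?_, (hA.updateNat (Or.inl rfl) _).updateNat (Or.inr rfl) _, ?_⟩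
  · simpa [NatExp.eval] using hc
  · simp only [NatExp.eval]
    rw [update_of_ne (by decide), update_self, h4, hA.nat 2 (by decide), pow_succ]

theorem sizeProg_runs {s : State} :
    Runs J h ω sizeProg s 80 fun s' =>
      Agree (fun a => a = 15 ∨ a = 13 ∨ a = 5) (fun _ => False) s s' ∧
      s'.nat 15 = s.nat 4 ^ 4 ∧ s'.nat 13 = 2 * s.nat 4 ^ 12 ∧
      s'.nat 5 = min (s.nat 0) (s.nat 4 ^ 4) := by
  have e4 : s.nat 4 * s.nat 4 * (s.nat 4 * s.nat 4) = s.nat 4 ^ 4 := by ring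
  refine Runs.seq (B₁ := 20) (B₂ := 60) (Runs.setNat (by decide) (Runs.seq (B₁ := 30) (B₂ := 30)
    (Runs.setNat (by decide) (Runs.ite (B := 20) (by decide) (fun h₁ => ?_) (fun h₁ => ?_)))
    le_rfl)) le_rfl
  all_goals
    simp [Test.holds, NatExp.eval, e4] at h₁
    refine Runs.setNat (by decide) ⟨(((Agree.refl (fun a => a = 15 ∨ a = 13 ∨ a = 5) _ s).updateNat
      (Or.inl rfl) _).updateNat (Or.inr (Or.inl rfl)) _).updateNat (Or.inr (Or.inr rfl)) _,
      ?_, ?_, ?_⟩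
  · simp [NatExp.eval, e4]
  · simp [NatExp.eval, e4]; ring
  · simp [NatExp.eval, h₁]
  · simp [NatExp.eval, e4]
  · simp [NatExp.eval, e4]; ring
  · simp [NatExp.eval, e4, h₁.le]

theorem configCountProg_runs {s : State} {D : ℕ} (hD : s.nat 5 ≤ D) :
    Runs J h ω configCountProg s (loopTime D 20 + 10) fun s' =>
      Agree (fun a => a = 6 ∨ a = 10) (fun _ => False) s s' ∧ s'.nat 6 = 2 ^ s.nat 5 := by
  refine Runs.seq (B₁ := 10) (Runs.setNat (by decide) ?_) (Nat.add_comm _ _).le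
  refine Runs.forLoop (fun k s' => Agree (fun a => a = 6 ∨ a = 10) (fun _ => False) s s' ∧
      s'.nat 6 = 2 ^ k) hD (fun k s' hs' => hs'.1.nat 5 (by decide))
    ⟨((Agree.refl (fun a => a = 6 ∨ a = 10) _ s).updateNat (Or.inl rfl) _).updateNat
      (Or.inr rfl) _, by simp [NatExp.eval]⟩ ?_ (fun s' _ hs' => hs')
  rintro k hk s' hc ⟨hA, h6⟩
  refine Runs.setNat (by decide) ⟨?_, (hA.updateNat (Or.inl rfl) _).updateNat (Or.inr rfl) _, ?_⟩
  · simpa [NatExp.eval] using hc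
  · simp only [NatExp.eval]
    rw [update_of_ne (by decide), update_self, h6, pow_succ]

/-- The logarithm of the reciprocal of the failure probability. -/
noncomputable def confidence (δ : ℝ) : ℕ := ⌈Real.logb 2 (2 / δ)⌉₊

theorem confidence_le_iff {δ : ℝ} (hδ : 0 < δ) (k : ℕ) :
    confidence δ ≤ k ↔ 2 / (2 : ℝ) ^ k ≤ δ := by
  rw [confidence, Nat.ceil_le, Real.logb_le_iff_le_rpow one_lt_two (by positivity),
    Real.rpow_natCast, div_le_iff₀ hδ, div_le_iff₀ (by positivity), mul_comm]

theorem confidence_le {δ : ℝ} (hδ : 0 < δ) (hδ1 : δ < 1) :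
    (confidence δ : ℝ) ≤ 3 * (1 + Real.log (1 / δ)) := by
  have hl : 0 ≤ Real.log (1 / δ) := Real.log_nonneg (by rw [le_div_iff₀ hδ]; linarith)
  have h2 : 0 < Real.log 2 := Real.log_pos one_lt_two
  have hb : 0 ≤ Real.logb 2 (2 / δ) :=
    Real.logb_nonneg one_lt_two (by rw [le_div_iff₀ hδ]; linarith)
  have hc := (Nat.ceil_lt_add_one hb).le
  have he : Real.logb 2 (2 / δ) = 1 + Real.log (1 / δ) / Real.log 2 := by
    rw [Real.logb, show (2 : ℝ) / δ = 2 * (1 / δ) by ring,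
      Real.log_mul two_ne_zero (by positivity), add_div, div_self h2.ne']
  have hd : Real.log (1 / δ) / Real.log 2 ≤ 2 * Real.log (1 / δ) := by
    rw [div_le_iff₀ h2]
    have := Real.log_two_gt_d9
    nlinarith
  unfold confidence
  linarith

theorem confidence_pos {δ : ℝ} (hδ : 0 < δ) (hδ1 : δ < 1) : 0 < confidence δ := by
  rw [pos_iff_ne_zero]
  intro h0
  have := (confidence_le_iff hδ 0).1 h0.le
  norm_num at this
  linarith

theorem repeatCountProg_runs {s : State} {δ : ℝ} (hδ : 0 < δ) (h2 : s.real 2 = δ)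
    (h7 : s.nat 7 = 0) :
    Runs J h ω repeatCountProg s (confidence δ * 50 + 70) fun s' =>
      Agree (· = 7) (· = 3) s s' ∧ s'.nat 7 = 8 * (s.nat 1 ^ 2 * confidence δ) := by
  have hiff : ∀ k s', Agree (· = 7) (· = 3) s s' ∧ s'.nat 7 = k ∧ s'.real 3 = 2 / 2 ^ k →
      ((Test.not (.realLE (realCell 3) (realCell 2))).holds J h s' ↔ k < confidence δ) := by
    rintro k s' ⟨hA, -, hk⟩
    simp only [Test.holds, RealExp.eval, NatExp.eval, hk, hA.real 2 (by decide), h2]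
    rw [← confidence_le_iff hδ, not_le]
  refine Runs.seq (B₁ := 10) (B₂ := confidence δ * 40 + 50) (Runs.setReal (by decide) (Runs.seq
    (B₂ := 30) ((Runs.whileCount (B := 30)
    (fun k s' => Agree (· = 7) (· = 3) s s' ∧ s'.nat 7 = k ∧ s'.real 3 = 2 / 2 ^ k)
    (N := confidence δ) (fun k hk s' hs' => ⟨(hiff k s' hs').2 hk, ?_⟩)
    (fun s' hs' hb => lt_irrefl _ ((hiff _ s' hs').1 hb))
    ⟨(Agree.refl (· = 7) (· = 3) s).updateReal rfl _, h7, ?_⟩).mono le_rfl ?_) ?_)) (by omega)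
  · obtain ⟨hA, hk7, hk3⟩ := hs'
    refine Runs.seq (B₁ := 15) (B₂ := 15) (Runs.setReal (by decide) (Runs.setNat (by decide)
      ⟨(hA.updateReal rfl _).updateNat rfl _, ?_, ?_⟩)) le_rfl
    · simp [NatExp.eval, hk7]
    · simp only [NatExp.eval, RealExp.eval, update_self, hk3, pow_succ]
      push_cast
      rw [div_div]
  · simp [NatExp.eval, RealExp.eval]
  · rintro s' ⟨hA, hk, -⟩
    refine Runs.setNat (by decide) ⟨hA.updateNat rfl _, ?_⟩
    simp only [NatExp.eval, update_self, hk, hA.nat 1 (by decide), sq]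
  · simp only [Test.time, RealExp.time, NatExp.time]
    omega

/-! ### The whole program -/

/-- The size of the subsystems. -/
def subsystemSize (n m : ℕ) : ℕ := min n (sampleSize m)

/-- The estimate of the repetition `r`. -/
noncomputable def runEstimate (J : Matrix (Fin n) (Fin n) ℝ) (h : Fin n → ℝ) (ω : ℕ → Fin n)
    (m r : ℕ) : ℝ :=
  ramEstimate J n (subsystemSize n m) (expPrecision m) (2 ^ subsystemSize n m)
    (chosenVertex ω (sampleSize m) (r * drawCount n (sampleSize m) (subsystemSize n m)))
    (fun a => clip (fieldBound m : ℕ) (entryH h (chosenVertex ω (sampleSize m)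
      (r * drawCount n (sampleSize m) (subsystemSize n m)) a)) +
      chosenField ω (sampleSize m) m
        (r * drawCount n (sampleSize m) (subsystemSize n m) + subsystemSize n m))

/-- The number of repetitions. -/
noncomputable def repetitions (m : ℕ) (δ : ℝ) : ℕ := 8 * (m ^ 2 * confidence δ)

/-- A bound for the time to compute the parameters. -/
def setupTime (m : ℕ) : ℕ :=
  m * 30 + loopTime (gridSize m ^ 2 + 1) 20 + loopTime (sampleSize m) 20

/-- A bound for the time of one repetition. -/
def repetitionTime (m : ℕ) : ℕ :=
  estimateTime (sampleSize m) (expPrecision m) (2 ^ sampleSize m)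

/-- A bound for the running time. -/
noncomputable def runTime (m : ℕ) (δ : ℝ) : ℕ :=
  setupTime m + confidence δ * 50 + loopTime (repetitions m δ) (repetitionTime m) + 500

theorem magnetizationProg_runs {ε Δ δ : ℝ} (hε : 0 < ε) (hΔ : 0 < Δ) (hδ : 0 < δ) :
    Runs J h ω magnetizationProg (init n ε Δ δ) (runTime (accuracy ε Δ) δ) fun s' =>
      s'.real 0 = n * (∑ r ∈ range (repetitions (accuracy ε Δ) δ),
        runEstimate J h ω (accuracy ε Δ) r) /
        (repetitions (accuracy ε Δ) δ * subsystemSize n (accuracy ε Δ)) := by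
  set m := accuracy ε Δ with hm
  set q := sampleSize m with hq
  set P := expPrecision m with hP
  set L := loopTime (repetitions m δ) (estimateTime q P (2 ^ q)) with hL
  refine Runs.seq (B₂ := loopTime (gridSize m ^ 2 + 1) 20 + loopTime q 20 + confidence δ * 50 +
    L + 480) ((accuracyProg_runs hε hΔ rfl rfl rfl).mono le_rfl ?_)
    (show _ ≤ m * 30 + loopTime (gridSize m ^ 2 + 1) 20 + loopTime q 20 + confidence δ * 50 + L +
      500 by omega)
  rintro s₁ ⟨hA₁, h1⟩
  rw [← hm] at h1
  refine Runs.seq (B₂ := loopTime (gridSize m ^ 2 + 1) 20 + loopTime q 20 + confidence δ * 50 +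
    L + 430) (gridProg_runs.mono le_rfl ?_) (by omega)
  rintro s₂ ⟨hA₂, h2, h3⟩
  rw [h1] at h2 h3
  refine Runs.seq (B₂ := loopTime q 20 + confidence δ * 50 + L + 420)
    ((fieldBoundProg_runs h3.le).mono le_rfl ?_) (by omega)
  rintro s₃ ⟨hA₃, h4⟩
  rw [h2, h3] at h4
  refine Runs.seq (B₂ := loopTime q 20 + confidence δ * 50 + L + 340)
    (sizeProg_runs.mono le_rfl ?_) (by omega)
  rintro s₄ ⟨hA₄, h15, h13, h5⟩
  have h0₃ : s₃.nat 0 = n := by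
    rw [hA₃.nat 0 (by decide), hA₂.nat 0 (by decide), hA₁.nat 0 (by decide)]; rfl
  change s₃.nat 4 = fieldBound m at h4
  rw [h4] at h15 h13 h5
  rw [h0₃] at h5
  change s₄.nat 15 = q at h15
  change s₄.nat 13 = P at h13
  change s₄.nat 5 = subsystemSize n m at h5
  have hdq : subsystemSize n m ≤ q := min_le_right _ _
  refine Runs.seq (B₂ := confidence δ * 50 + L + 330)
    ((configCountProg_runs (h5.le.trans hdq)).mono le_rfl ?_) (by omega)
  rintro s₅ ⟨hA₅, h6⟩
  rw [h5] at h6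
  have h7₅ : s₅.nat 7 = 0 := by
    rw [hA₅.nat 7 (by decide), hA₄.nat 7 (by decide), hA₃.nat 7 (by decide),
      hA₂.nat 7 (by decide), hA₁.nat 7 (by decide)]; rfl
  have h2₅ : s₅.real 2 = δ := by
    rw [hA₅.real 2 id, hA₄.real 2 id, hA₃.real 2 id, hA₂.real 2 id, hA₁.real 2 id]; simp [init]
  refine Runs.seq (B₂ := L + 260) ((repeatCountProg_runs hδ h2₅ h7₅).mono le_rfl ?_) (by omega)
  rintro s₆ ⟨hA₆, h7⟩
  have h1₆ : s₅.nat 1 = m := by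
    rw [hA₅.nat 1 (by decide), hA₄.nat 1 (by decide), hA₃.nat 1 (by decide),
      hA₂.nat 1 (by decide), h1]
  rw [h1₆] at h7
  change s₆.nat 7 = repetitions m δ at h7
  have k0 : s₆.nat 0 = n := by
    rw [hA₆.nat 0 (by decide), hA₅.nat 0 (by decide), hA₄.nat 0 (by decide), h0₃]
  have k1 : s₆.nat 1 = m := by rw [hA₆.nat 1 (by decide), h1₆]
  have k4 : s₆.nat 4 = fieldBound m := by
    rw [hA₆.nat 4 (by decide), hA₅.nat 4 (by decide), hA₄.nat 4 (by decide), h4]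
  have k5 : s₆.nat 5 = subsystemSize n m := by
    rw [hA₆.nat 5 (by decide), hA₅.nat 5 (by decide), h5]
  have k6 : s₆.nat 6 = 2 ^ subsystemSize n m := by rw [hA₆.nat 6 (by decide), h6]
  have k13 : s₆.nat 13 = P := by rw [hA₆.nat 13 (by decide), hA₅.nat 13 (by decide), h13]
  have k15 : s₆.nat 15 = q := by rw [hA₆.nat 15 (by decide), hA₅.nat 15 (by decide), h15]
  have kd : s₆.drawn = 0 := by
    rw [hA₆.drawn, hA₅.drawn, hA₄.drawn, hA₃.drawn, hA₂.drawn, hA₁.drawn]; rfl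
  have hrun := repeatProg_runs (J := J) (h := h) (ω := ω) (D := q) (P := P) (C := 2 ^ q) k0 kd
    (k5.le.trans hdq) k13.le (k6.le.trans (Nat.pow_le_pow_right two_pos hdq))
  rw [k1, k4, k5, k6, k13, k15, h7] at hrun
  refine Runs.seq (B₂ := 100) (hrun.mono le_rfl ?_) (by omega)
  rintro s₇ ⟨l0, l7, l5, l9⟩
  refine Runs.setReal (by decide) ?_
  simp only [NatExp.eval, RealExp.eval, update_self, l0, l7, l5, l9]
  rfl

/-- A bound for the running time per unit of `1 + log (1 / δ)`. -/
noncomputable def timeBound (m : ℕ) : ℝ :=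
  (setupTime m : ℕ) + 520 + 3 * (50 + 8 * m ^ 2 * ((repetitionTime m : ℕ) + 20))

theorem add_mul_time_le (a E m k : ℕ) {l : ℝ} (hl : 0 ≤ l) (hk : (k : ℝ) ≤ 3 * (1 + l)) :
    ((a + k * 50 + (8 * (m ^ 2 * k) * (E + 20) + 20) + 500 : ℕ) : ℝ) ≤
      (a + 520 + 3 * (50 + 8 * m ^ 2 * (E + 20))) * (1 + l) := by
  have hE0 : (0 : ℝ) ≤ 50 + 8 * m ^ 2 * (E + 20) := by positivity
  have hA0 : (0 : ℝ) ≤ a + 520 := by positivity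
  push_cast
  nlinarith [mul_le_mul_of_nonneg_right hk hE0, mul_nonneg hA0 hl]

theorem runTime_le (m : ℕ) {δ : ℝ} (hδ : 0 < δ) (hδ1 : δ < 1) :
    (runTime m δ : ℝ) ≤ timeBound m * (1 + Real.log (1 / δ)) :=
  add_mul_time_le (setupTime m) (repetitionTime m) m (confidence δ)
    (Real.log_nonneg (by rw [le_div_iff₀ hδ]; linarith)) (confidence_le hδ hδ1)

end Setup

section Conversion

open RealRAM

variable {n d : ℕ}

/-! ### The estimates of the program -/

/-- The binary digits as spins. -/
noncomputable def digitSpin : Fin 2 ≃ ℤˣ :=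
  Equiv.ofBijective (fun b => if b = 0 then -1 else 1) (by decide)

theorem spin_digitSpin (b : Fin 2) : spin (digitSpin b) = 2 * (b : ℕ) - 1 := by
  fin_cases b <;> norm_num [digitSpin, spin]

/-- The configurations in the order of the program. -/
noncomputable def configEquiv (d : ℕ) : Fin (2 ^ d) ≃ (Fin d → ℤˣ) :=
  finFunctionFinEquiv.symm.trans (Equiv.piCongrRight fun _ => digitSpin)

theorem spin_configEquiv (c : Fin (2 ^ d)) (a : Fin d) :
    spin (configEquiv d c a) = configSpin c a := by
  change spin (digitSpin (finFunctionFinEquiv.symm c a)) = _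
  rw [spin_digitSpin, finFunctionFinEquiv_symm_apply_val, configSpin]

theorem sum_range_configSpin (F : (Fin d → ℝ) → ℝ) :
    ∑ c ∈ range (2 ^ d), F (fun a => configSpin c a) =
      ∑ x : Fin d → ℤˣ, F (fun a => spin (x a)) := by
  rw [sum_range, ← (configEquiv d).sum_comp]
  simp only [spin_configEquiv]

theorem ramEnergy_eq (J : Matrix (Fin n) (Fin n) ℝ) {S : ℕ → ℕ} {S' : Fin d → Fin n}
    (hS : ∀ a : Fin d, S a = S' a) (f : ℕ → ℝ) (x : ℕ → ℝ) :
    ramEnergy J n d S f x d = quad (subInteraction J S') (fun a => x a) +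
      ∑ a : Fin d, f a * x a := by
  rw [ramEnergy, sum_add_distrib, add_comm, sum_range, sum_range]
  congr 1
  refine sum_congr rfl fun a _ => ?_
  rw [interactionSum, sum_range]
  refine sum_congr rfl fun b _ => ?_
  simp [hS, entryJ, subInteraction]

theorem ramEstimate_eq (J : Matrix (Fin n) (Fin n) ℝ) (P : ℕ) {S : ℕ → ℕ} {S' : Fin d → Fin n}
    (hS : ∀ a : Fin d, S a = S' a) {f : ℕ → ℝ} {f' : Fin d → ℝ} (hf : ∀ a : Fin d, f a = f' a) :
    ramEstimate J n d P (2 ^ d) S f = approxMag P (subInteraction J S') f' := by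
  have e : ∀ c, ramWeight J n d P S f c = (1 + (quad (subInteraction J S')
      (fun a => configSpin c a) + ∑ a, f' a * configSpin c a) / P) ^ P := fun c => by
    simp only [ramWeight, ramEnergy_eq J hS, hf]
  simp only [ramEstimate, e, sum_range (fun a => configSpin _ a), approxMag]
  congr 1
  · exact sum_range_configSpin fun y => (1 + (quad (subInteraction J S') y +
      ∑ a, f' a * y a) / P) ^ P * ∑ a, y a
  · exact sum_range_configSpin fun y => (1 + (quad (subInteraction J S') y +
      ∑ a, f' a * y a) / P) ^ P

theorem entryH_val (h : Fin n → ℝ) (i : Fin n) : entryH h i = h i := by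
  simp [entryH]

theorem runEstimate_of_le (J : Matrix (Fin n) (Fin n) ℝ) (h : Fin n → ℝ) (ω : ℕ → Fin n)
    {m : ℕ} (hn0 : 0 < n) (hn : n ≤ sampleSize m) (r : ℕ) :
    runEstimate J h ω m r =
      approxMag (expPrecision m) J fun i => clip (fieldBound m) (h i) := by
  have hJ : J = subInteraction J id := by
    funext i j
    have : (n : ℝ) ≠ 0 := by positivity
    simp [subInteraction, this]
  have hs : subsystemSize n m = n := min_eq_left hn
  rw [runEstimate, hs]
  conv_rhs => rw [hJ]
  exact ramEstimate_eq J _ (fun a => by simp [chosenVertex, hn]) fun a => by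
    simp only [chosenVertex, chosenField, if_pos hn, add_zero, entryH_val]

theorem runEstimate_of_lt (J : Matrix (Fin n) (Fin n) ℝ) (h : Fin n → ℝ) (ω : ℕ → Fin n)
    {m : ℕ} (hq : 0 < sampleSize m) (hn : sampleSize m < n) (r : ℕ) :
    runEstimate J h ω m r = sampleSize m * sampleEstimate (expPrecision m) (fieldBound m) (1 / m)
      J h (blocks (sampleSize m + 1) ω r) := by
  have hs : subsystemSize n m = sampleSize m := min_eq_right hn.le
  have hq' : (sampleSize m : ℝ) ≠ 0 := by positivity
  rw [runEstimate, hs, sampleEstimate, mul_div_cancel₀ _ hq', drawCount, if_neg hn.not_ge]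
  exact ramEstimate_eq J _ (fun a => by simp [chosenVertex, hn.not_ge, blocks]) fun a => by
    simp only [chosenVertex, chosenField, if_neg hn.not_ge, entryH_val, blocks,
      Fin.val_castSucc, Fin.val_last]

end Conversion

section Main

open RealRAM

variable {n : ℕ}

/-! ### The estimate of the magnetization -/

/-- The output of the program. -/
noncomputable def runOutput (J : Matrix (Fin n) (Fin n) ℝ) (h : Fin n → ℝ) (m : ℕ) (δ : ℝ)
    (ω : ℕ → Fin n) : ℝ :=
  n * (∑ r ∈ range (repetitions m δ), runEstimate J h ω m r) /
    (repetitions m δ * subsystemSize n m)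

theorem fieldBound_pos (m : ℕ) : 0 < fieldBound m := by unfold fieldBound; positivity

theorem sampleSize_pos (m : ℕ) : 0 < sampleSize m := by
  have := fieldBound_pos m
  unfold sampleSize; positivity

theorem subsystemSize_pos (m : ℕ) (hn : 0 < n) : 0 < subsystemSize n m :=
  lt_min hn (sampleSize_pos m)

theorem repetitions_pos {m : ℕ} (hm : 0 < m) {δ : ℝ} (hδ : 0 < δ) (hδ1 : δ < 1) :
    0 < repetitions m δ := by
  have := confidence_pos hδ hδ1
  unfold repetitions; positivity

theorem abs_runEstimate_le (J : Matrix (Fin n) (Fin n) ℝ) (h : Fin n → ℝ) (ω : ℕ → Fin n)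
    (m : ℕ) (hn : 0 < n) (r : ℕ) : |runEstimate J h ω m r| ≤ subsystemSize n m := by
  rcases le_or_gt n (sampleSize m) with hq | hq
  · rw [runEstimate_of_le J h ω hn hq, subsystemSize, min_eq_left hq]
    exact abs_approxMag_le (even_expPrecision m) _ _
  · rw [runEstimate_of_lt J h ω (sampleSize_pos m) hq, subsystemSize, min_eq_right hq.le, abs_mul,
      Nat.abs_cast]
    exact mul_le_of_le_one_right (Nat.cast_nonneg _)
      (abs_sampleEstimate_le (even_expPrecision m) _ _ _ _ _)

theorem abs_runOutput_le (J : Matrix (Fin n) (Fin n) ℝ) (h : Fin n → ℝ) (ω : ℕ → Fin n)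
    {m : ℕ} (hm : 0 < m) (hn : 0 < n) {δ : ℝ} (hδ : 0 < δ) (hδ1 : δ < 1) :
    |runOutput J h m δ ω| ≤ n := by
  have hR : (0 : ℝ) < repetitions m δ := by exact_mod_cast repetitions_pos hm hδ hδ1
  have hd : (0 : ℝ) < subsystemSize n m := by exact_mod_cast subsystemSize_pos m hn
  rw [runOutput, abs_div, abs_mul, Nat.abs_cast, abs_of_pos (mul_pos hR hd),
    div_le_iff₀ (mul_pos hR hd)]
  gcongr
  refine (abs_sum_le_sum_abs _ _).trans ((sum_le_sum fun r _ =>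
    abs_runEstimate_le J h ω m hn r).trans ?_)
  simp

theorem runOutput_of_le (J : Matrix (Fin n) (Fin n) ℝ) (h : Fin n → ℝ) (ω : ℕ → Fin n)
    {m : ℕ} (hm : 0 < m) (hn0 : 0 < n) (hn : n ≤ sampleSize m) {δ : ℝ} (hδ : 0 < δ)
    (hδ1 : δ < 1) :
    runOutput J h m δ ω = approxMag (expPrecision m) J fun i => clip (fieldBound m) (h i) := by
  have hR : (repetitions m δ : ℝ) ≠ 0 := by exact_mod_cast (repetitions_pos hm hδ hδ1).ne'
  have hn' : (n : ℝ) ≠ 0 := by exact_mod_cast hn0.ne'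
  rw [runOutput, sum_congr rfl fun r _ => runEstimate_of_le J h ω hn0 hn r, sum_const, card_range,
    nsmul_eq_mul, subsystemSize, min_eq_left hn]
  field_simp

theorem runOutput_of_lt (J : Matrix (Fin n) (Fin n) ℝ) (h : Fin n → ℝ) (ω : ℕ → Fin n)
    {m : ℕ} (hn : sampleSize m < n) (δ : ℝ) :
    runOutput J h m δ ω = n * ((∑ r ∈ range (repetitions m δ),
      sampleEstimate (expPrecision m) (fieldBound m) (1 / m) J h
        (blocks (sampleSize m + 1) ω r)) / repetitions m δ) := by
  have hq : (sampleSize m : ℝ) ≠ 0 := by exact_mod_cast (sampleSize_pos m).ne'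
  rw [runOutput, sum_congr rfl fun r _ => runEstimate_of_lt J h ω (sampleSize_pos m) hn r,
    ← mul_sum, subsystemSize, min_eq_right hn.le]
  field_simp

theorem magnetizationProg_outputs {ε Δ δ : ℝ} (hε : 0 < ε) (hΔ : 0 < Δ) (hδ : 0 < δ)
    (J : Matrix (Fin n) (Fin n) ℝ) (h : Fin n → ℝ) (ω : ℕ → Fin n) :
    Outputs J h ω magnetizationProg (init n ε Δ δ) (runOutput J h (accuracy ε Δ) δ ω) := by
  obtain ⟨t, s', he, -, hy⟩ := magnetizationProg_runs (J := J) (h := h) (ω := ω) hε hΔ hδ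
  exact ⟨t, s', he, hy⟩

theorem magnetizationProg_haltsWithin {ε Δ δ : ℝ} (hε : 0 < ε) (hΔ : 0 < Δ) (hδ : 0 < δ)
    (hδ1 : δ < 1) (J : Matrix (Fin n) (Fin n) ℝ) (h : Fin n → ℝ) (ω : ℕ → Fin n) :
    HaltsWithin J h ω magnetizationProg (init n ε Δ δ)
      (timeBound (accuracy ε Δ) * (1 + Real.log (1 / δ))) := by
  obtain ⟨t, s', he, ht, -⟩ := magnetizationProg_runs (J := J) (h := h) (ω := ω) hε hΔ hδ
  exact ⟨t, s', he, (Nat.cast_le.2 ht).trans (runTime_le _ hδ hδ1)⟩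

theorem accuracy_pos (ε Δ : ℝ) : 0 < accuracy ε Δ := Nat.succ_pos _

theorem lt_accuracy {ε Δ : ℝ} (hε : 0 < ε) (hΔ : 0 < Δ) :
    1 / ε < accuracy ε Δ ∧ 1 / Δ < accuracy ε Δ := by
  have h1 : (ε + Δ) / (ε * Δ) < accuracy ε Δ := by
    unfold accuracy
    push_cast
    exact Nat.lt_floor_add_one _
  have h2 : (ε + Δ) / (ε * Δ) = 1 / Δ + 1 / ε := by field_simp
  have h3 : 0 < 1 / ε := by positivity
  have h4 : 0 < 1 / Δ := by positivity
  constructor <;> linarith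

theorem abs_entry_le_of_dense {ε Δ : ℝ} (hε : 0 < ε) (hΔ : 0 < Δ) (hn : 0 < n)
    {J : Matrix (Fin n) (Fin n) ℝ} (hJ : IsingModel.DenseMatrix Δ J)
    (hs : IsingModel.matrixNormOne J ≤ 2 * n / ε) (i j : Fin n) :
    |J i j| ≤ 2 * (accuracy ε Δ : ℝ) ^ 2 / n := by
  have hn' : (0 : ℝ) < n := by exact_mod_cast hn
  obtain ⟨h1, h2⟩ := lt_accuracy hε hΔ
  have h3 : |J i j| ≤ IsingModel.matrixNormInf J :=
    norm_le_pi_norm (fun p : Fin n × Fin n => J p.1 p.2) (i, j)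
  have h4 : Δ * |J i j| ≤ 2 / (ε * n) :=
    calc Δ * |J i j| ≤ Δ * IsingModel.matrixNormInf J := by gcongr
      _ ≤ IsingModel.matrixNormOne J / (n : ℝ) ^ 2 := hJ
      _ ≤ 2 * n / ε / (n : ℝ) ^ 2 := by gcongr
      _ = 2 / (ε * n) := by field_simp
  calc |J i j| = 1 / Δ * (Δ * |J i j|) := by field_simp
    _ ≤ 1 / Δ * (2 / (ε * n)) := by gcongr
    _ = 2 * (1 / ε * (1 / Δ)) / n := by field_simp
    _ ≤ 2 * (accuracy ε Δ * accuracy ε Δ) / n := by gcongr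
    _ = _ := by rw [sq]

theorem two_mul_exp_neg_confidence_le {δ : ℝ} (hδ : 0 < δ) :
    2 * Real.exp (-(confidence δ : ℝ)) ≤ δ := by
  have h1 := (confidence_le_iff hδ (confidence δ)).1 le_rfl
  have h2 : (2 : ℝ) ^ confidence δ ≤ Real.exp (confidence δ) := by
    rw [← mul_one (confidence δ : ℝ), Real.exp_nat_mul]
    gcongr
    linarith [Real.add_one_le_exp 1]
  refine le_trans ?_ h1
  rw [Real.exp_neg, div_eq_mul_inv]
  gcongr

/-- The output of the program is a good estimate with high probability. -/
theorem exists_measure_abs_runOutput_sub_le {ε Δ : ℝ} (hε : 0 < ε) (hΔ : 0 < Δ) [NeZero n]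
    {J : Matrix (Fin n) (Fin n) ℝ} (hsymm : J.IsSymm) (hJ : IsingModel.DenseMatrix Δ J)
    (h : Fin n → ℝ) :
    ∃ h₀ : ℝ, |h₀| < ε ∧ ∀ δ : ℝ, 0 < δ → δ < 1 →
      ENNReal.ofReal (1 - δ) ≤ vertexLaw n {ω | |runOutput J h (accuracy ε Δ) δ ω -
        IsingModel.magnetization J (fun i => h i + h₀)| ≤
          ε * ((n : ℝ) + IsingModel.matrixNormOne J)} := by
  set m := accuracy ε Δ with hmdef
  have hm : 0 < m := accuracy_pos ε Δ
  have hm' : (0 : ℝ) < m := by exact_mod_cast hm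
  have hn : 0 < n := Nat.pos_of_neZero n
  have hn' : (0 : ℝ) < n := by exact_mod_cast hn
  have hmε : 1 / (m : ℝ) < ε := by
    rw [div_lt_comm₀ hm' hε]
    exact (lt_accuracy hε hΔ).1
  have hJ0 : 0 ≤ IsingModel.matrixNormOne J :=
    sum_nonneg fun i _ => sum_nonneg fun j _ => abs_nonneg _
  have hnm : n * (1 / (m : ℝ)) ≤ ε * ((n : ℝ) + IsingModel.matrixNormOne J) := by
    rw [mul_comm]
    gcongr
    linarith
  have hall : ∀ {A : Set (ℕ → Fin n)}, (∀ ω, ω ∈ A) → ∀ δ : ℝ, 0 < δ →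
      ENNReal.ofReal (1 - δ) ≤ vertexLaw n A := by
    intro A hA δ hδ
    have : MeasureTheory.IsProbabilityMeasure (vertexLaw n) := by unfold vertexLaw; infer_instance
    rw [Set.eq_univ_of_forall hA, MeasureTheory.measure_univ]
    exact ENNReal.ofReal_le_one.2 (by linarith)
  rcases le_or_gt (2 * n / ε) (IsingModel.matrixNormOne J) with hlarge | hsmall
  · refine ⟨0, by simpa using hε, fun δ hδ hδ1 => hall (fun ω => ?_) δ hδ⟩
    have h1 := abs_le.1 (abs_runOutput_le J h ω hm hn hδ hδ1)
    have h2 := abs_le.1 (abs_magnetization_le J fun i => h i + 0)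
    rw [div_le_iff₀ hε] at hlarge
    have h3 : 0 ≤ ε * n := by positivity
    rw [Set.mem_ofPred_eq, mul_add]
    refine abs_le.2 ⟨?_, ?_⟩ <;> linarith
  have hK := abs_entry_le_of_dense hε hΔ hn hJ hsmall.le
  rw [← hmdef] at hK
  rcases le_or_gt n (sampleSize m) with hq | hq
  · refine ⟨0, by simpa using hε, fun δ hδ hδ1 => hall (fun ω => ?_) δ hδ⟩
    simp only [Set.mem_ofPred_eq, add_zero]
    rw [runOutput_of_le J h ω hm hn hq hδ hδ1]
    exact (abs_approxMag_clip_sub_le' hm hn hq hK h).trans hnm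
  obtain ⟨h₀, h0, h1, hb⟩ := exists_abs_expect_sampleEstimate_sub_le' hm hq.le hsymm hK h
  refine ⟨h₀, by rw [abs_of_nonneg h0]; linarith, fun δ hδ hδ1 => ?_⟩
  have hR := repetitions_pos hm hδ hδ1
  have hmeas := measure_abs_mean_blocks_sub_le (n := n) (q := sampleSize m + 1)
    (y := sampleEstimate (expPrecision m) (fieldBound m) (1 / m) J h)
    (abs_sampleEstimate_le (even_expPrecision m) _ _ _ _) hR (τ := 1 / (2 * m)) (by positivity)
  have hexp : (repetitions m δ : ℝ) * (1 / (2 * m)) ^ 2 / 2 = confidence δ := by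
    unfold repetitions
    push_cast
    field_simp
    ring
  rw [hexp] at hmeas
  refine (ENNReal.ofReal_le_ofReal ?_).trans (hmeas.trans (MeasureTheory.measure_mono ?_))
  · linarith [two_mul_exp_neg_confidence_le hδ]
  · intro ω hω
    simp only [Set.mem_ofPred_eq] at hω ⊢
    refine le_trans ?_ hnm
    rw [runOutput_of_lt J h ω hq]
    change |_ - mag J h h₀| ≤ _
    set a := (∑ r ∈ range (repetitions m δ), sampleEstimate (expPrecision m) (fieldBound m) (1 / m)
      J h (blocks (sampleSize m + 1) ω r)) / repetitions m δ
    have e : n * a - mag J h h₀ = n * (a - mag J h h₀ / n) := by field_simp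
    rw [e, abs_mul, Nat.abs_cast]
    gcongr
    refine (abs_sub_le _ _ _).trans ((add_le_add hω hb).trans_eq ?_)
    field_simp
    norm_num

end Main

end IsingSampling

theorem mainTheorem5 :
    ∃ (P : RealRAM.Prog) (T : ℝ → ℝ → ℝ),
      ∀ (ε Δ : ℝ), 0 < ε → 0 < Δ →
      ∀ (n : ℕ) [NeZero n] (J : Matrix (Fin n) (Fin n) ℝ) (h : Fin n → ℝ),
        J.IsSymm → IsingModel.DenseMatrix Δ J → IsingModel.DenseField Δ h →
        ∃ h₀ : ℝ, |h₀| < ε ∧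
          ∀ δ : ℝ, 0 < δ → δ < 1 →
            (∀ ω : ℕ → Fin n, RealRAM.HaltsWithin J h ω P (RealRAM.init n ε Δ δ)
              (T ε Δ * (1 + Real.log (1 / δ)))) ∧
            ENNReal.ofReal (1 - δ) ≤ RealRAM.vertexLaw n
              {ω | ∃ y : ℝ, RealRAM.Outputs J h ω P (RealRAM.init n ε Δ δ) y ∧
                |y - IsingModel.magnetization J (fun i => h i + h₀)| ≤
                  ε * ((n : ℝ) + IsingModel.matrixNormOne J)} := by
  refine ⟨IsingSampling.magnetizationProg, fun ε Δ => IsingSampling.timeBound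
    (IsingSampling.accuracy ε Δ), fun ε Δ hε hΔ n _ J h hsymm hJ _ => ?_⟩
  obtain ⟨h₀, hh₀, hmeas⟩ :=
    IsingSampling.exists_measure_abs_runOutput_sub_le hε hΔ hsymm hJ h
  refine ⟨h₀, hh₀, fun δ hδ hδ1 => ⟨fun ω =>
    IsingSampling.magnetizationProg_haltsWithin hε hΔ hδ hδ1 J h ω,
    (hmeas δ hδ hδ1).trans (MeasureTheory.measure_mono fun ω hω =>
      ⟨_, IsingSampling.magnetizationProg_outputs hε hΔ hδ J h ω, hω⟩)⟩⟩
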